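/- Let $k\ge 1$ be an integer. A capacitated graph $(H,c)$ with vertex set $V+s$ (where $s\notin V$) is a finite undirected graph without loops and parallel edges, with positive integer edge capacities $c$ (and $c(xy)=0$ for non-edges $xy$). A biset on $V$ is a pair $\mathsf X=(X_O,X_I)$ with $X_I\subseteq X_O\subseteq V$; it is nontrivial if $X_I\ne\emptyset$ and $X_O\neq V$. Put $$f_{(H,c)}(\mathsf X)=k\,|X_O\setminus X_I|+\sum_{x\in X_I}\ \sum_{y\in (V+s)\setminus X_O}c(xy).$$ $(H,c)$ is $(2,k)$-connected in $V$ if $|V|\ge 3$ and $f_{(H,c)}(\mathsf X)\ge 2k$ for every nontrivial biset $\mathsf X$ on $V$. A nontrivial biset $\mathsf X$ blocks $(su,sv)$ in $(H,c)$ if either $f_{(H,c)}(\mathsf X)\le 2k+1$ and $u,v\in X_I$, or $f_{(H,c)}(\mathsf X)=2k$, $u,v\in X_O$ and $\{u,v\}\cap X_I\ne\emptyset$. For neighbours $u,v$ of $s$ and an integer $\alpha\ge 0$, $(H,c)_{u,v}^{\alpha}$ is obtained by decreasing $c(su)$ by $\alpha$, decreasing $c(sv)$ by $\alpha$ (so $c(su)$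 decreases by $2\alpha$ in total if $u=v$), increasing $c(uv)$ by $\alpha$ if $u\ne v$, and deleting edges of capacity $0$; it is well-defined if no capacity becomes negative. If $(H,c)$ is $(2,k)$-connected in $V$, then $(H,c)^{\max}_{u,v}$ denotes $(H,c)_{u,v}^{\alpha}$ for the maximum integer $\alpha\ge 0$ such that $(H,c)_{u,v}^{\alpha}$ is well-defined and $(2,k)$-connected in $V$. **Lemma.** There is an algorithm which, given $k$, a capacitated graph $(H,c)$ that is $(2,k)$-connected in $V$, as a list of its edges with their capacities, and neighbours $u,v$ of $s$, computes $(H',c')=(H,c)^{\max}_{u,v}$ in $O(n^2(m+n\log n))$ time, where $n=|V|$ and $m$ is the number of edges of $H$. Further, if $c'(su)\ne 0$ and $c'(sv)\neq 0$ (and $c'(su)\ge 2$ in case $u=v$), it also computes, within the same time, a biset that blocks $(su,sv)$ in $(H',c')$. Running times are on a random access machine with integer cells in which additions, subtractions, halvings with rounding down, comparisons and (indirect) memory accesses take constant time each, independently of the size of the integers. The constant in $O(\cdot)$ is absolute. -/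

import Mathlib

/-! ### Capacitated graphs -/

/-- A finite loopless undirected graph with positive integer edge capacities, given by the
capacity of every pair of vertices; the edges are exactly the pairs of nonzero capacity. -/
structure CapGraph (W : Type*) where
  cap : W → W → ℕ
  symm : ∀ x y, cap x y = cap y x
  loopless : ∀ x, cap x x = 0

/-- The underlying simple graph. -/
def CapGraph.graph {W : Type*} (G : CapGraph W) : SimpleGraph W where
  Adj x y := G.cap x y ≠ 0
  symm := ⟨fun x y h => by rw [G.symm y x]; exact h⟩
  loopless := ⟨fun x h => h (G.loopless x)⟩

/-! ### Bisets

A graph with vertex set `V + s`, where `s ∉ V`, is a `CapGraph (Option V)`; the distinguished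
vertex `s` is `none`, and `v ∈ V` is `some v`. -/

/-- A biset on `V`: an inner set contained in an outer set. -/
structure Biset (V : Type*) where
  outer : Finset V
  inner : Finset V
  inner_subset : inner ⊆ outer

section

variable {V : Type*} [Fintype V] [DecidableEq V]

/-- The wall of a biset. -/
def Biset.wall (X : Biset V) : Finset V := X.outer \ X.inner

/-- A biset is nontrivial with respect to `V`. -/
def Biset.Nontrivial (X : Biset V) : Prop :=
  X.inner ≠ ∅ ∧ X.outer ≠ Finset.univ

/-- The value `f(X) = k |w(X)| + c(δ_H(X_I, (V + s) - X_O))`. The complement of the outer set is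
taken in `V + s`, so it always contains `s`. -/
def CapGraph.bisetValue (H : CapGraph (Option V)) (k : ℕ) (X : Biset V) : ℕ :=
  k * X.wall.card +
    ∑ x ∈ X.inner, (H.cap (some x) none + ∑ y ∈ X.outerᶜ, H.cap (some x) (some y))

/-- The graph `H` on `V + s` is `(2,k)`-connected in `V`. -/
def CapGraph.TwoConnectedIn (H : CapGraph (Option V)) (k : ℕ) : Prop :=
  3 ≤ Fintype.card V ∧ ∀ X : Biset V, X.Nontrivial → 2 * k ≤ H.bisetValue k X

/-- The biset `X` blocks the pair `(su, sv)` in `H`. -/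
def CapGraph.Blocks (H : CapGraph (Option V)) (k : ℕ) (X : Biset V) (u v : V) : Prop :=
  X.Nontrivial ∧
    ((H.bisetValue k X ≤ 2 * k + 1 ∧ u ∈ X.inner ∧ v ∈ X.inner) ∨
      (H.bisetValue k X = 2 * k ∧ u ∈ X.outer ∧ v ∈ X.outer ∧ (u ∈ X.inner ∨ v ∈ X.inner)))

end

/-! ### Splitting off -/

section

variable {V : Type*} [DecidableEq V]

/-- What the `α`-multiple splitting off of `su` and `sv` takes away from the capacity of `xy`:
`α` from `su` and `α` from `sv` (hence `2α` from `su` if `u = v`). -/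
def splitLoss (u v : V) (α : ℕ) (x y : Option V) : ℕ :=
  (if s(x, y) = s(none, some u) then α else 0) + (if s(x, y) = s(none, some v) then α else 0)

/-- What it adds: `α` to `uv`, nothing if `u = v` (the arising loop is deleted). -/
def splitGain (u v : V) (α : ℕ) (x y : Option V) : ℕ :=
  if u ≠ v ∧ s(x, y) = s(some u, some v) then α else 0

/-- The `α`-multiple splitting off of `su` and `sv` is well-defined: no capacity would
become negative. -/
def CapGraph.SplitDefined (H : CapGraph (Option V)) (u v : V) (α : ℕ) : Prop :=
  ∀ x y, splitLoss u v α x y ≤ H.cap x y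

/-- The `α`-multiple splitting off of `su` and `sv` (used only where it is well-defined). -/
def CapGraph.split (H : CapGraph (Option V)) (u v : V) (α : ℕ) : CapGraph (Option V) where
  cap x y := H.cap x y - splitLoss u v α x y + splitGain u v α x y
  symm x y := by
    simp only [splitLoss, splitGain, H.symm x y, Sym2.eq_swap (a := x) (b := y)]
  loopless x := by
    have h : splitGain u v α x x = 0 := by
      unfold splitGain
      rw [if_neg]
      rintro ⟨huv, h⟩
      simp only [Sym2.eq_iff] at h
      rcases h with ⟨h₁, h₂⟩ | ⟨h₁, h₂⟩
      · exact huv (Option.some.inj (h₁.symm.trans h₂))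
      · exact huv (Option.some.inj (h₂.symm.trans h₁))
    rw [H.loopless, h, Nat.zero_sub]

/-- `α` is the multiplicity of the maximal splitting off of `(su, sv)`: the greatest integer for
which the `α`-multiple splitting off is well-defined and `(2,k)`-connected in `V`. -/
def CapGraph.IsMaxSplit [Fintype V] (H : CapGraph (Option V)) (k : ℕ) (u v : V) (α : ℕ) : Prop :=
  IsGreatest {β : ℕ | H.SplitDefined u v β ∧ (H.split u v β).TwoConnectedIn k} α

end

/-! ### The machine model

A random access machine with integer memory cells, presented as a structured programming
language. A program is a fixed finite text; it uses finitely many scalar registers and finitely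
many arrays with indirect addressing. Addition, subtraction, halving with rounding down,
comparison, and reading or writing one cell take one unit of time each. There is no unit-cost
multiplication. -/

/-- Contents of the memory: registers, and arrays of cells addressed by integers. -/
structure Store where
  var : ℕ → ℤ
  arr : ℕ → ℤ → ℤ

/-- Integer expressions. -/
inductive Expr where
  | const (z : ℤ)
  | var (x : ℕ)
  | get (a : ℕ) (i : Expr)
  | add (e₁ e₂ : Expr)
  | sub (e₁ e₂ : Expr)
  | half (e : Expr)

/-- Value of an expression; `half` is `⌊e / 2⌋`. -/
def Expr.eval (σ : Store) : Expr → ℤ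
  | .const z => z
  | .var x => σ.var x
  | .get a i => σ.arr a (i.eval σ)
  | .add e₁ e₂ => e₁.eval σ + e₂.eval σ
  | .sub e₁ e₂ => e₁.eval σ - e₂.eval σ
  | .half e => e.eval σ / 2

/-- Time to evaluate an expression: one unit for each operation. -/
def Expr.cost : Expr → ℕ
  | .const _ => 1
  | .var _ => 1
  | .get _ i => i.cost + 1
  | .add e₁ e₂ => e₁.cost + e₂.cost + 1
  | .sub e₁ e₂ => e₁.cost + e₂.cost + 1
  | .half e => e.cost + 1

/-- Boolean tests. -/
inductive Test where
  | le (e₁ e₂ : Expr)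
  | not (b : Test)
  | and (b₁ b₂ : Test)

/-- Truth of a test. -/
def Test.holds (σ : Store) : Test → Prop
  | .le e₁ e₂ => e₁.eval σ ≤ e₂.eval σ
  | .not b => ¬ b.holds σ
  | .and b₁ b₂ => b₁.holds σ ∧ b₂.holds σ

/-- Time to evaluate a test. -/
def Test.cost : Test → ℕ
  | .le e₁ e₂ => e₁.cost + e₂.cost + 1
  | .not b => b.cost + 1
  | .and b₁ b₂ => b₁.cost + b₂.cost + 1

/-- Programs. -/
inductive Program where
  | skip
  | assign (x : ℕ) (e : Expr)
  | store (a : ℕ) (i e : Expr)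
  | seq (p q : Program)
  | ite (b : Test) (p q : Program)
  | loop (b : Test) (p : Program)

/-- Write `z` to register `x`. -/
def Store.setVar (σ : Store) (x : ℕ) (z : ℤ) : Store :=
  { σ with var := Function.update σ.var x z }

/-- Write `z` to cell `i` of array `a`. -/
def Store.setArr (σ : Store) (a : ℕ) (i z : ℤ) : Store :=
  { σ with arr := Function.update σ.arr a (Function.update (σ.arr a) i z) }

/-- `Exec p σ τ t`: started in memory `σ`, the program `p` halts after exactly `t` units of time
with memory `τ`. -/
inductive Exec : Program → Store → Store → ℕ → Prop where
  | skip (σ : Store) : Exec .skip σ σ 1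
  | assign (σ : Store) (x : ℕ) (e : Expr) :
      Exec (.assign x e) σ (σ.setVar x (e.eval σ)) (e.cost + 1)
  | store (σ : Store) (a : ℕ) (i e : Expr) :
      Exec (.store a i e) σ (σ.setArr a (i.eval σ) (e.eval σ)) (i.cost + e.cost + 1)
  | seq {p q : Program} {σ τ ρ : Store} {t₁ t₂ : ℕ} (h₁ : Exec p σ τ t₁) (h₂ : Exec q τ ρ t₂) :
      Exec (.seq p q) σ ρ (t₁ + t₂)
  | iteTrue {b : Test} {p q : Program} {σ τ : Store} {t : ℕ} (hb : b.holds σ)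
      (h : Exec p σ τ t) : Exec (.ite b p q) σ τ (b.cost + t)
  | iteFalse {b : Test} {p q : Program} {σ τ : Store} {t : ℕ} (hb : ¬ b.holds σ)
      (h : Exec q σ τ t) : Exec (.ite b p q) σ τ (b.cost + t)
  | loopDone {b : Test} {p : Program} {σ : Store} (hb : ¬ b.holds σ) :
      Exec (.loop b p) σ σ b.cost
  | loopStep {b : Test} {p : Program} {σ τ ρ : Store} {t₁ t₂ : ℕ} (hb : b.holds σ)
      (h₁ : Exec p σ τ t₁) (h₂ : Exec (.loop b p) τ ρ t₂) :
      Exec (.loop b p) σ ρ (b.cost + t₁ + t₂)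

/-! ### Input and output

The vertices of `V` are numbered `0, …, n - 1`, and `s` has the number `n`. A capacitated graph is
given by a list of its edges in arbitrary order, each edge once, with its capacity. -/

/-- The list `L` enumerates the edges of `G`, each once and in one of its two orientations. -/
def CapGraph.IsEdgeList {W : Type*} (G : CapGraph W) (L : List (W × W)) : Prop :=
  (L.map fun e => s(e.1, e.2)).Nodup ∧
    ∀ x y, s(x, y) ∈ L.map (fun e => s(e.1, e.2)) ↔ G.graph.Adj x y

/-- The number of a vertex. -/
def vertexCode {n : ℕ} : Option (Fin n) → ℤ
  | some v => (v : ℕ)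
  | none => n

/-- The array with entries `xs` in the cells `0, …, xs.length - 1` and `0` elsewhere. -/
def listArray (xs : List ℤ) (i : ℤ) : ℤ :=
  if 0 ≤ i then xs.getD i.toNat 0 else 0

/-- The initial memory: registers `0, …, 4` hold `n`, `m`, `k`, `u`, `v`; arrays `0, 1, 2` hold the
two ends and the capacities of the `m` edges; everything else is `0`. -/
def inputStore {n : ℕ} (H : CapGraph (Option (Fin n))) (L : List (Option (Fin n) × Option (Fin n)))
    (k : ℕ) (u v : Fin n) : Store where
  var := fun x => ([(n : ℤ), L.length, k, vertexCode (some u), vertexCode (some v)]).getD x 0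
  arr := fun a => listArray
    (([L.map fun e => vertexCode e.1, L.map fun e => vertexCode e.2,
      L.map fun e => (H.cap e.1 e.2 : ℤ)]).getD a [])

/-- The final memory gives the graph `G`: for some list of its edges, register `5` holds their
number, and arrays `3, 4, 5` hold the two ends and the capacities. -/
def Store.OutputsGraph {n : ℕ} (τ : Store) (G : CapGraph (Option (Fin n))) : Prop :=
  ∃ L : List (Option (Fin n) × Option (Fin n)), G.IsEdgeList L ∧ τ.var 5 = L.length ∧
    ∀ (j : ℕ) (hj : j < L.length),
      τ.arr 3 j = vertexCode (L[j]).1 ∧ τ.arr 4 j = vertexCode (L[j]).2 ∧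
        τ.arr 5 j = G.cap (L[j]).1 (L[j]).2

/-- The final memory gives the biset `X`: arrays `6` and `7` hold the indicator functions of its
inner and its outer set. -/
def Store.OutputsBiset {n : ℕ} (τ : Store) (X : Biset (Fin n)) : Prop :=
  ∀ x : Fin n, τ.arr 6 (x : ℕ) = (if x ∈ X.inner then 1 else 0) ∧
    τ.arr 7 (x : ℕ) = (if x ∈ X.outer then 1 else 0)

/-! ### Reasoning about programs with time credits -/

/-! Splitting off `(su, sv)` with multiplicity `α` lowers the value of a biset by `α` times its
loss: 2 if `u` and `v` are both in the inner set, 1 if one is in the inner set and the other in the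
wall, 0 otherwise (`CapGraph.bisetValue_split`). So one may split off the greatest well-defined
multiplicity `α₀` at once and ask how much of it must be taken back. A biset of value `h` after this
splitting forces a reduction by its defect, which is `2k - h` if the wall meets `{u, v}` and `⌈(2k -
h)/2⌉` otherwise; a biset of loss 0 has kept its value, so its defect is not positive. If `b` is the
maximum of 0 and all defects, then `α₀ - b` is the multiplicity sought. If `b > 0`, a biset of
defect `b` blocks; if `b = 0`, the capacity of `su` or `sv` is used up (up to one unit if `u = v`)
and no blocking biset is due (`CapGraph.isMaxSplit_of_defect`).

Two wall vertices alone give the value `2k`, so only walls with at most one vertex `w` matter. Such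
a biset is a cut of `V + s - w` whose side `X` avoiding `s` is a nonempty proper subset of `V - w`,
and for fixed `w` the defect is greatest where the capacity is least (`defect_anti`,
`CutData.Represents.cutDefect_eq`). This leaves `n + 1` minimum cut problems, solved by maximum
adjacency orderings: if the ordering starts at `s`, its last element `y` yields a minimum cut among
those separating `y` from its predecessor `p` (`AdjacencyOrder.step`), after which `y` and `p` are
merged. Since `s` comes first it is never merged, and the phases stop when `V - w` is one class.
Every admissible `X` separates two vertices of `V - w`, hence is dealt with in the phase in which it
is first split (`Splits.of_merge`, `CutData.wallSearch_spec`).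

There are fewer than `n` phases for each choice of the wall, and a phase takes time `O(m + n log n)`
with a Fibonacci heap. Running times are proved in a program logic with time credits (`Wp`), in
which the potential of the heap is a reserve of credits, so that amortization becomes part of the
invariants. The logarithm comes from `HeapOK.two_mul_card_le`: at most half as many elements have
degree at least `s + 3` as have degree at least `s`. -/

@[simp] theorem Store.setVar_var (σ : Store) (x : ℕ) (z : ℤ) (y : ℕ) :
    (σ.setVar x z).var y = if y = x then z else σ.var y := by
  simp [Store.setVar, Function.update_apply]

@[simp] theorem Store.setVar_arr (σ : Store) (x : ℕ) (z : ℤ) :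
    (σ.setVar x z).arr = σ.arr := rfl

@[simp] theorem Store.setArr_var (σ : Store) (a : ℕ) (i z : ℤ) :
    (σ.setArr a i z).var = σ.var := rfl

@[simp] theorem Store.setArr_arr (σ : Store) (a : ℕ) (i z : ℤ) (b : ℕ) :
    (σ.setArr a i z).arr b = if b = a then Function.update (σ.arr a) i z else σ.arr b := by
  by_cases h : b = a
  · subst h; simp [Store.setArr]
  · simp [Store.setArr, h]

/-- The registers a program may write to. -/
def Program.writesVar : Program → ℕ → Bool
  | .skip, _ => false
  | .assign x _, y => y == x
  | .store _ _ _, _ => false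
  | .seq p q, y => p.writesVar y || q.writesVar y
  | .ite _ p q, y => p.writesVar y || q.writesVar y
  | .loop _ p, y => p.writesVar y

/-- The arrays a program may write to. -/
def Program.writesArr : Program → ℕ → Bool
  | .skip, _ => false
  | .assign _ _, _ => false
  | .store a _ _, b => b == a
  | .seq p q, y => p.writesArr y || q.writesArr y
  | .ite _ p q, y => p.writesArr y || q.writesArr y
  | .loop _ p, y => p.writesArr y

theorem Exec.var_eq {p : Program} {σ τ : Store} {t : ℕ} (h : Exec p σ τ t) (x : ℕ)
    (hx : p.writesVar x = false) : τ.var x = σ.var x := by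
  induction h with
  | skip => rfl
  | assign σ y e => simp only [Program.writesVar, beq_eq_false_iff_ne] at hx; simp [hx]
  | store => rfl
  | seq _ _ ih₁ ih₂ =>
    simp only [Program.writesVar, Bool.or_eq_false_iff] at hx
    rw [ih₂ hx.2, ih₁ hx.1]
  | iteTrue _ _ ih => simp only [Program.writesVar, Bool.or_eq_false_iff] at hx; exact ih hx.1
  | iteFalse _ _ ih => simp only [Program.writesVar, Bool.or_eq_false_iff] at hx; exact ih hx.2
  | loopDone => rfl
  | loopStep _ _ _ ih₁ ih₂ => rw [ih₂ hx, ih₁ hx]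

theorem Exec.arr_eq {p : Program} {σ τ : Store} {t : ℕ} (h : Exec p σ τ t) (a : ℕ)
    (ha : p.writesArr a = false) : τ.arr a = σ.arr a := by
  induction h with
  | skip => rfl
  | assign => rfl
  | store σ y i e => simp only [Program.writesArr, beq_eq_false_iff_ne] at ha; simp [ha]
  | seq _ _ ih₁ ih₂ =>
    simp only [Program.writesArr, Bool.or_eq_false_iff] at ha
    rw [ih₂ ha.2, ih₁ ha.1]
  | iteTrue _ _ ih => simp only [Program.writesArr, Bool.or_eq_false_iff] at ha; exact ih ha.1
  | iteFalse _ _ ih => simp only [Program.writesArr, Bool.or_eq_false_iff] at ha; exact ih ha.2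
  | loopDone => rfl
  | loopStep _ _ _ ih₁ ih₂ => rw [ih₂ ha, ih₁ ha]

/-- Started in `σ` with `c` time credits, `p` halts in a memory `τ` with `c'` credits left such
that `Q τ c'` holds; credits may be wasted. -/
def Wp (p : Program) (Q : Store → ℤ → Prop) (σ : Store) (c : ℤ) : Prop :=
  ∃ τ t c', Exec p σ τ t ∧ (t : ℤ) + c' ≤ c ∧ Q τ c'

/-- What a program leaves unchanged. -/
def Unchanged (p : Program) (σ τ : Store) : Prop :=
  (∀ x, p.writesVar x = false → τ.var x = σ.var x) ∧
    ∀ a, p.writesArr a = false → τ.arr a = σ.arr a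

/-- Frame rule for the memory and the credits. -/
theorem Wp.frame {p : Program} {Q R : Store → ℤ → Prop} {σ : Store} {c c' : ℤ} (h : Wp p Q σ c)
    (hQ : ∀ τ d, Q τ d → Unchanged p σ τ → R τ (d + (c' - c))) : Wp p R σ c' := by
  obtain ⟨τ, t, d, he, ht, hq⟩ := h
  exact ⟨τ, t, d + (c' - c), he, by omega, hQ _ _ hq ⟨he.var_eq, he.arr_eq⟩⟩

theorem Wp.seq {p q : Program} {Q : Store → ℤ → Prop} {σ : Store} {c : ℤ}
    (h : Wp p (fun τ d => Wp q Q τ d) σ c) : Wp (.seq p q) Q σ c := by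
  obtain ⟨τ, t, d, he, ht, ρ, t', d', he', ht', hq⟩ := h
  exact ⟨ρ, t + t', d', .seq he he', by push_cast; omega, hq⟩

theorem Wp.ite {b : Test} {p q : Program} {Q : Store → ℤ → Prop} {σ : Store} {c : ℤ}
    (h₁ : b.holds σ → Wp p Q σ (c - b.cost)) (h₂ : ¬ b.holds σ → Wp q Q σ (c - b.cost)) :
    Wp (.ite b p q) Q σ c := by
  by_cases hb : b.holds σ
  · obtain ⟨τ, t, d, he, ht, hq⟩ := h₁ hb
    exact ⟨τ, _, d, .iteTrue hb he, by push_cast; omega, hq⟩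
  · obtain ⟨τ, t, d, he, ht, hq⟩ := h₂ hb
    exact ⟨τ, _, d, .iteFalse hb he, by push_cast; omega, hq⟩

theorem Test.cost_pos (b : Test) : 0 < b.cost := by
  cases b <;> simp [Test.cost]

theorem Unchanged.refl (p : Program) (σ : Store) : Unchanged p σ σ :=
  ⟨fun _ _ => rfl, fun _ _ => rfl⟩

theorem Unchanged.trans {p : Program} {σ τ ρ : Store} (h₁ : Unchanged p σ τ)
    (h₂ : Unchanged p τ ρ) : Unchanged p σ ρ :=
  ⟨fun x hx => (h₂.1 x hx).trans (h₁.1 x hx), fun a ha => (h₂.2 a ha).trans (h₁.2 a ha)⟩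

/-- The loop rule: an invariant that guarantees nonnegative credits also guarantees
termination. -/
theorem Wp.loop {b : Test} {p : Program} {Q : Store → ℤ → Prop} {σ : Store} {c : ℤ}
    (I : Store → ℤ → Prop)
    (hpos : ∀ τ d, I τ d → 0 ≤ d)
    (hstep : ∀ τ d, Unchanged p σ τ → I τ d → b.holds τ → Wp p I τ (d - b.cost))
    (hdone : ∀ τ d, Unchanged p σ τ → I τ d → ¬ b.holds τ → Q τ (d - b.cost))
    (h : I σ c) : Wp (.loop b p) Q σ c := by
  -- Each round spends at least one unit on its test, so the credits bound the number of rounds;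
  -- with none left, a further round would contradict `hpos`.
  have key : ∀ N : ℕ, ∀ (τ : Store) (d : ℤ), d ≤ N → Unchanged p σ τ → I τ d →
      Wp (.loop b p) Q τ d := by
    intro N
    induction N with
    | zero =>
      intro τ c hc hU hI
      by_cases hb : b.holds τ
      · obtain ⟨ρ, t, d, he, ht, hq⟩ := hstep τ c hU hI hb
        have := hpos _ _ hq
        have := b.cost_pos
        push_cast at hc
        omega
      · exact ⟨τ, _, _, .loopDone hb, by omega, hdone _ _ hU hI hb⟩
    | succ N ih =>
      intro τ c hc hU hI
      by_cases hb : b.holds τ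
      · obtain ⟨ρ, t, d, he, ht, hq⟩ := hstep τ c hU hI hb
        have := b.cost_pos
        obtain ⟨ρ', t', d', he', ht', hq'⟩ :=
          ih ρ d (by push_cast at hc; omega) (hU.trans ⟨he.var_eq, he.arr_eq⟩) hq
        exact ⟨ρ', _, d', .loopStep hb he he', by push_cast; omega, hq'⟩
      · exact ⟨τ, _, _, .loopDone hb, by omega, hdone _ _ hU hI hb⟩
  exact key c.toNat σ c (by omega) (.refl _ _) h

/-! ### Loop-free programs and counting loops -/

/-- Programs without loops. -/
def Program.isFlat : Program → Bool
  | .skip => true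
  | .assign _ _ => true
  | .store _ _ _ => true
  | .seq p q => p.isFlat && q.isFlat
  | .ite _ p q => p.isFlat && q.isFlat
  | .loop _ _ => false

/-- An upper bound for the running time of a program without loops. -/
def Program.flatCost : Program → ℕ
  | .skip => 1
  | .assign _ e => e.cost + 1
  | .store _ i e => i.cost + e.cost + 1
  | .seq p q => p.flatCost + q.flatCost
  | .ite b p q => b.cost + (p.flatCost + q.flatCost)
  | .loop _ _ => 0

open Classical in
/-- The effect of a program without loops. -/
noncomputable def Program.run : Program → Store → Store
  | .skip, σ => σ
  | .assign x e, σ => σ.setVar x (e.eval σ)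
  | .store a i e, σ => σ.setArr a (i.eval σ) (e.eval σ)
  | .seq p q, σ => q.run (p.run σ)
  | .ite b p q, σ => if b.holds σ then p.run σ else q.run σ
  | .loop _ _, σ => σ

theorem exec_run (p : Program) (hp : p.isFlat = true) (σ : Store) :
    ∃ t, t ≤ p.flatCost ∧ Exec p σ (p.run σ) t := by
  induction p generalizing σ with
  | skip => exact ⟨1, le_rfl, .skip σ⟩
  | assign x e => exact ⟨_, le_rfl, .assign σ x e⟩
  | store a i e => exact ⟨_, le_rfl, .store σ a i e⟩
  | seq p q ihp ihq =>
    simp only [Program.isFlat, Bool.and_eq_true] at hp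
    obtain ⟨t, ht, he⟩ := ihp hp.1 σ
    obtain ⟨t', ht', he'⟩ := ihq hp.2 (p.run σ)
    exact ⟨t + t', by simp only [Program.flatCost]; omega, .seq he he'⟩
  | ite b p q ihp ihq =>
    simp only [Program.isFlat, Bool.and_eq_true] at hp
    by_cases hb : b.holds σ
    · obtain ⟨t, ht, he⟩ := ihp hp.1 σ
      refine ⟨b.cost + t, by simp only [Program.flatCost]; omega, ?_⟩
      simp only [Program.run, if_pos hb]
      exact .iteTrue hb he
    · obtain ⟨t, ht, he⟩ := ihq hp.2 σ
      refine ⟨b.cost + t, by simp only [Program.flatCost]; omega, ?_⟩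
      simp only [Program.run, if_neg hb]
      exact .iteFalse hb he
  | loop b p _ => simp [Program.isFlat] at hp

theorem Wp.flat {p : Program} {Q : Store → ℤ → Prop} {σ : Store} {c : ℤ} (hp : p.isFlat = true)
    (hQ : Q (p.run σ) (c - p.flatCost)) : Wp p Q σ c := by
  obtain ⟨t, ht, he⟩ := exec_run p hp σ
  exact ⟨_, t, _, he, by omega, hQ⟩

theorem run_unchanged (p : Program) (hp : p.isFlat = true) (σ : Store) :
    Unchanged p σ (p.run σ) := by
  obtain ⟨t, -, he⟩ := exec_run p hp σ
  exact ⟨he.var_eq, he.arr_eq⟩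

/-- The test `e < f`. -/
abbrev Test.lt (e f : Expr) : Test := .not (.le f e)

/-- The test `e = f`. -/
abbrev Test.eq (e f : Expr) : Test := .and (.le e f) (.le f e)

@[simp] theorem Test.holds_le (σ : Store) (e f : Expr) :
    (Test.le e f).holds σ ↔ e.eval σ ≤ f.eval σ := Iff.rfl

@[simp] theorem Test.holds_not (σ : Store) (b : Test) :
    (Test.not b).holds σ ↔ ¬ b.holds σ := Iff.rfl

@[simp] theorem Test.holds_lt (σ : Store) (e f : Expr) :
    (Test.lt e f).holds σ ↔ e.eval σ < f.eval σ := by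
  simp [Test.holds]

@[simp] theorem Test.holds_eq (σ : Store) (e f : Expr) :
    (Test.eq e f).holds σ ↔ e.eval σ = f.eval σ := by
  simp only [Test.holds]
  omega

/-- Sequential composition of a list of programs. -/
def Program.block : List Program → Program
  | [] => .skip
  | [p] => p
  | p :: q :: l => .seq p (Program.block (q :: l))

/-- `for i := i, …, hi - 1 do p`. -/
abbrev Program.forUp (i hi : ℕ) (p : Program) : Program :=
  .loop (.lt (.var i) (.var hi)) (.seq p (.assign i (.add (.var i) (.const 1))))

/-- Rule for counting loops: each round draws `K` credits from the loop, and possibly more from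
the invariant. -/
theorem Wp.forUp {i hi : ℕ} {p : Program} {Q : Store → ℤ → Prop} {σ : Store} {c : ℤ}
    (lo N K : ℤ) (I : ℤ → Store → ℤ → Prop) (hne : (i == hi) = false)
    (hi' : p.writesVar i = false) (hhi : p.writesVar hi = false) (hK : 0 ≤ K)
    (hpos : ∀ j τ d, lo ≤ j → j ≤ N → I j τ d → 0 ≤ d)
    (hstep : ∀ j τ d, lo ≤ j → j < N → τ.var i = j → τ.var hi = N →
      Unchanged (Program.forUp i hi p) σ τ → I j τ d →
      Wp p (fun ρ c' => I (j + 1) (ρ.setVar i (j + 1)) c') τ (d + K))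
    (hdone : ∀ τ d, τ.var i = N → τ.var hi = N → Unchanged (Program.forUp i hi p) σ τ → I N τ d →
      Q τ d)
    (hlo : σ.var i = lo) (hN : σ.var hi = N) (hle : lo ≤ N)
    (h : I lo σ (c - ((K + 8) * (N - lo) + 4))) : Wp (Program.forUp i hi p) Q σ c := by
  -- Besides the body, a round pays 4 units for the test and 4 for the increment, whence `K + 8`;
  -- the summand 4 is the last, failing test.
  refine Wp.loop (fun τ d => τ.var hi = N ∧ lo ≤ τ.var i ∧ τ.var i ≤ N ∧
    I (τ.var i) τ (d - ((K + 8) * (N - τ.var i) + 4))) ?_ ?_ ?_ ?_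
  · rintro σ c ⟨-, h1, h2, h3⟩
    have := hpos _ _ _ h1 h2 h3
    have : 0 ≤ (K + 8) * (N - σ.var i) := mul_nonneg (by omega) (by omega)
    omega
  · rintro τ c hU ⟨h0, h1, h2, h3⟩ hb
    simp only [Test.holds_lt, Expr.eval, h0] at hb
    apply Wp.seq
    refine Wp.frame (hstep _ _ _ h1 hb rfl h0 hU h3) ?_
    intro ρ d hI hU
    apply Wp.flat rfl
    have e1 : ρ.var i = τ.var i := hU.1 i hi'
    have e2 : ρ.var hi = τ.var hi := hU.1 hi hhi
    have hne' : hi ≠ i := fun hh => by simp [hh] at hne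
    simp only [Program.run, Store.setVar_var, Expr.eval, hne', if_false, if_true]
    rw [e1, e2]
    refine ⟨h0, by omega, by omega, ?_⟩
    convert hI using 1
    simp only [Program.flatCost, Expr.cost, Test.cost]
    push_cast
    ring
  · rintro τ c hU ⟨h0, h1, h2, h3⟩ hb
    simp only [Test.holds_lt, Expr.eval, h0] at hb
    have : τ.var i = N := by omega
    rw [this] at h3
    refine hdone _ _ this h0 hU ?_
    convert h3 using 1
    simp [Test.cost, Expr.cost]
  · simp only [hlo, hN]
    exact ⟨trivial, le_rfl, hle, h⟩

/-- Counting loops with a body without loops. -/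
theorem Wp.forFlat {i hi : ℕ} {p : Program} {σ : Store} (lo N : ℤ) (I : ℤ → Store → Prop)
    (hne : (i == hi) = false) (hf : p.isFlat = true)
    (hi' : p.writesVar i = false) (hhi : p.writesVar hi = false)
    (hstep : ∀ j τ, lo ≤ j → j < N → τ.var i = j → τ.var hi = N →
      Unchanged (Program.forUp i hi p) σ τ → I j τ → I (j + 1) ((p.run τ).setVar i (j + 1)))
    (hlo : σ.var i = lo) (hN : σ.var hi = N) (hle : lo ≤ N) (h : I lo σ) :
    Wp (Program.forUp i hi p) (fun τ d => I N τ ∧ 0 ≤ d) σ ((p.flatCost + 8) * (N - lo) + 4) := by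
  refine Wp.forUp lo N p.flatCost (fun j τ d => I j τ ∧ 0 ≤ d) hne hi' hhi (by omega)
    (fun _ _ _ _ _ h => h.2) ?_ (fun _ _ _ _ _ h => h) hlo hN hle ⟨h, by omega⟩
  rintro j τ d h1 h2 h3 h4 hU ⟨h5, h6⟩
  exact Wp.flat hf ⟨hstep j τ h1 h2 h3 h4 hU h5, by omega⟩

/-! ### Linked lists in arrays -/

/-- The linked list that starts at the pointer `e` holds the items `l`; all its pointers are
between `1` and `bd`. -/
def ListAt (nxt item : ℤ → ℤ) (bd : ℤ) : ℤ → List ℤ → Prop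
  | e, [] => e = 0
  | e, y :: l => 1 ≤ e ∧ e ≤ bd ∧ item e = y ∧ ListAt nxt item bd (nxt e) l

/-- New cells are only allocated above `bd`, so the lists built before survive. -/
theorem ListAt.congr {nxt item nxt' item' : ℤ → ℤ} {bd bd' : ℤ} (hb : bd ≤ bd')
    (h₁ : ∀ e, e ≤ bd → nxt' e = nxt e) (h₂ : ∀ e, e ≤ bd → item' e = item e) {e : ℤ} {l : List ℤ}
    (h : ListAt nxt item bd e l) : ListAt nxt' item' bd' e l := by
  induction l generalizing e with
  | nil => exact h
  | cons y l ih =>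
    obtain ⟨a, b, c, d⟩ := h
    exact ⟨a, b.trans hb, (h₂ e b).trans c, by rw [h₁ e b]; exact ih d⟩

theorem ListAt.eq_nil {nxt item : ℤ → ℤ} {bd : ℤ} {l : List ℤ} (h : ListAt nxt item bd 0 l) :
    l = [] := by
  cases l with
  | nil => rfl
  | cons y l => exact absurd h.1 (by norm_num)

theorem ListAt.eq_cons {nxt item : ℤ → ℤ} {bd e : ℤ} {l : List ℤ} (h : ListAt nxt item bd e l)
    (he : e ≠ 0) : ∃ l', l = item e :: l' ∧ ListAt nxt item bd (nxt e) l' := by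
  cases l with
  | nil => exact absurd h he
  | cons y l => exact ⟨l, by rw [h.2.2.1], h.2.2.2⟩

theorem ListAt.nonneg {nxt item : ℤ → ℤ} {bd e : ℤ} {l : List ℤ} (h : ListAt nxt item bd e l) :
    0 ≤ e := by
  cases l with
  | nil => exact le_of_eq h.symm
  | cons y l => have := h.1; omega

/-! ### Fibonacci heaps in arrays

The heap elements are the members of `S`; `par` is the parent (`-1` for a root), `deg` the number
of children, `mark` says whether a child has been lost. The children of `x` are found in a linked
list, which may hold items that are no longer children of `x`. `r y` is the number of children of
`y` at the time when `y` became a child, `lvl` witnesses acyclicity. The elements `exk` and `exd`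
may violate the heap order and, by one, the lower bound for the degree. -/
structure HeapOK (n : ℤ) (S : Finset ℤ) (exk exd : ℤ) (key par mark deg head nxt item : ℤ → ℤ)
    (pc : ℤ) (r : ℤ → ℤ) (lvl : ℤ → ℕ) (ch : ℤ → List ℤ) : Prop where
  range : ∀ y ∈ S, 0 ≤ y ∧ y < n
  par_mem : ∀ y ∈ S, par y ≠ -1 → par y ∈ S
  deg_eq : ∀ x ∈ S, deg x = ((S.filter (par · = x)).card : ℤ)
  mark_mem : ∀ y ∈ S, mark y = 0 ∨ mark y = 1
  deg_ge : ∀ y ∈ S, par y ≠ -1 → y ≠ exd → r y ≤ deg y + mark y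
  deg_ge' : ∀ y ∈ S, par y ≠ -1 → r y ≤ deg y + mark y + 1
  count : ∀ x ∈ S, ∀ t, 0 ≤ t → ((S.filter (fun y => par y = x ∧ r y ≤ t)).card : ℤ) ≤ t + 1
  key_le : ∀ y ∈ S, par y ≠ -1 → y ≠ exk → key y ≤ key (par y)
  lvl_lt : ∀ y ∈ S, par y ≠ -1 → lvl y < lvl (par y)
  list : ∀ x ∈ S, ListAt nxt item pc (head x) (ch x)
  mem : ∀ y ∈ S, par y ≠ -1 → y ∈ ch (par y)
  pc_nonneg : 0 ≤ pc

namespace HeapOK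

variable {n : ℤ} {S : Finset ℤ} {exk exd : ℤ} {key par mark deg head nxt item : ℤ → ℤ}
  {pc : ℤ} {r : ℤ → ℤ} {lvl : ℤ → ℕ} {ch : ℤ → List ℤ}

/-- Because of this, `-1` in the place of `exk` or `exd` means that there is no exception. -/
theorem neg_one_notMem (h : HeapOK n S exk exd key par mark deg head nxt item pc r lvl ch) :
    (-1 : ℤ) ∉ S := fun hh => by have := (h.range _ hh).1; omega

theorem weaken (h : HeapOK n S (-1) (-1) key par mark deg head nxt item pc r lvl ch) (y z : ℤ) :
    HeapOK n S y z key par mark deg head nxt item pc r lvl ch :=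
  { h with
    deg_ge := fun w hw hp _ => h.deg_ge w hw hp fun e => h.neg_one_notMem (e ▸ hw)
    key_le := fun w hw hp _ => h.key_le w hw hp fun e => h.neg_one_notMem (e ▸ hw) }

theorem weaken_left {z : ℤ}
    (h : HeapOK n S (-1) z key par mark deg head nxt item pc r lvl ch) (y : ℤ) :
    HeapOK n S y z key par mark deg head nxt item pc r lvl ch :=
  { h with
    key_le := fun w hw hp _ => h.key_le w hw hp fun e => h.neg_one_notMem (e ▸ hw) }

/-- Heap order and degree bound only speak of elements with a parent, so an exception at a root is
void. -/
theorem of_root (h : HeapOK n S exk exd key par mark deg head nxt item pc r lvl ch)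
    (hk : par exk = -1) (hd : par exd = -1) :
    HeapOK n S (-1) (-1) key par mark deg head nxt item pc r lvl ch :=
  { h with
    deg_ge := fun w hw hp _ => h.deg_ge w hw hp fun e => hp (e ▸ hd)
    key_le := fun w hw hp _ => h.key_le w hw hp fun e => hp (e ▸ hk) }

/-- The missing child of `x` is made up for by its mark, since only the sum of degree and mark is
bounded below. -/
theorem setMark {x : ℤ} (h : HeapOK n S (-1) x key par mark deg head nxt item pc r lvl ch)
    (h0 : mark x = 0) :
    HeapOK n S (-1) (-1) key par (Function.update mark x 1) deg head nxt item pc r lvl ch :=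
  { h with
    mark_mem := fun w hw => by
      rw [Function.update_apply]
      split_ifs
      · exact Or.inr rfl
      · exact h.mark_mem w hw
    deg_ge := fun w hw hp _ => by
      rw [Function.update_apply]
      split_ifs with hwx
      · have := h.deg_ge' w hw hp
        rw [hwx, h0] at this; rw [hwx]; omega
      · exact h.deg_ge w hw hp hwx
    deg_ge' := fun w hw hp => by
      have := h.deg_ge' w hw hp
      rw [Function.update_apply]
      split_ifs with hwx
      · rw [hwx, h0] at this; rw [hwx]; omega
      · exact this }

/-- A greater key at `z` can only violate the order between `z` and its parent; towards its children
the order improves. -/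
theorem increase (h : HeapOK n S (-1) (-1) key par mark deg head nxt item pc r lvl ch) (z δ : ℤ)
    (hδ : 0 ≤ δ) :
    HeapOK n S z z (Function.update key z (key z + δ)) par mark deg head nxt item pc r lvl ch :=
  { h with
    deg_ge := fun w hw hp _ => h.deg_ge w hw hp fun e => h.neg_one_notMem (e ▸ hw)
    key_le := fun w hw hp hwz => by
      have := h.key_le w hw hp fun e => h.neg_one_notMem (e ▸ hw)
      rw [Function.update_of_ne hwz, Function.update_apply]
      split_ifs with e
      · rw [e] at this; omega
      · exact this }

/-- The former parent is one child short and becomes the degree exception. Its list is left alone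
and keeps `y` as an outdated item, which spares doubly linked lists. -/
theorem cut {y : ℤ} (h : HeapOK n S y y key par mark deg head nxt item pc r lvl ch) (hy : y ∈ S)
    (hx : par y ≠ -1) :
    HeapOK n S (-1) (par y) key (Function.update par y (-1)) (Function.update mark y 0)
      (Function.update deg (par y) (deg (par y) - 1)) head nxt item pc r lvl ch := by
  have hxS := h.par_mem y hy hx
  have hxy : par y ≠ y := fun e => by have := h.lvl_lt y hy hx; rw [e] at this; omega
  have hroot : ∀ w, Function.update par y (-1) w ≠ -1 → w ≠ y ∧ par w ≠ -1 ∧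
      Function.update par y (-1) w = par w := by
    intro w hw
    have hwy : w ≠ y := fun e => hw (by simp [e])
    rw [Function.update_of_ne hwy] at hw ⊢
    exact ⟨hwy, hw, rfl⟩
  refine ⟨h.range, ?_, ?_, ?_, ?_, ?_, ?_, ?_, ?_, h.list, ?_, h.pc_nonneg⟩
  · intro w hw hp
    obtain ⟨-, h1, h2⟩ := hroot w hp
    rw [h2]; exact h.par_mem w hw h1
  · intro x hxS'
    have hx1 : x ≠ -1 := fun e => h.neg_one_notMem (e ▸ hxS')
    by_cases e : x = par y
    · subst e
      have : S.filter (Function.update par y (-1) · = par y) =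
          (S.filter (par · = par y)).erase y := by
        ext w
        simp only [Finset.mem_filter, Finset.mem_erase]
        by_cases hw : w = y
        · subst hw; simp [hx.symm]
        · simp [hw]
      rw [this, Function.update_self, Finset.card_erase_of_mem (by simp [hy]), h.deg_eq _ hxS']
      have : 0 < (S.filter (par · = par y)).card := Finset.card_pos.2 ⟨y, by simp [hy]⟩
      omega
    · have : S.filter (Function.update par y (-1) · = x) = S.filter (par · = x) := by
        ext w
        simp only [Finset.mem_filter]
        by_cases hw : w = y
        · subst hw; simp [hx1.symm, Ne.symm e]
        · simp [Function.update_of_ne hw]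
      rw [this, Function.update_of_ne e, h.deg_eq _ hxS']
  · intro w hw
    rw [Function.update_apply]
    split_ifs
    · exact Or.inl rfl
    · exact h.mark_mem w hw
  · intro w hw hp hwx
    obtain ⟨h0, h1, h2⟩ := hroot w hp
    rw [Function.update_of_ne h0, Function.update_of_ne hwx]
    exact h.deg_ge w hw h1 h0
  · intro w hw hp
    obtain ⟨h0, h1, h2⟩ := hroot w hp
    have := h.deg_ge w hw h1 h0
    rw [Function.update_of_ne h0, Function.update_apply]
    split_ifs with e
    · rw [← e]; omega
    · omega
  · intro x hx' t ht
    refine le_trans ?_ (h.count x hx' t ht)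
    have hx1 : x ≠ -1 := fun e => h.neg_one_notMem (e ▸ hx')
    refine Nat.cast_le.2 (Finset.card_le_card fun w => ?_)
    simp only [Finset.mem_filter]
    rintro ⟨h1, h2, h3⟩
    obtain ⟨-, -, h4⟩ := hroot w (h2 ▸ hx1)
    exact ⟨h1, h4 ▸ h2, h3⟩
  · intro w hw hp _
    obtain ⟨h0, h1, h2⟩ := hroot w hp
    rw [h2]; exact h.key_le w hw h1 h0
  · intro w hw hp
    obtain ⟨h0, h1, h2⟩ := hroot w hp
    rw [h2]; exact h.lvl_lt w hw h1
  · intro w hw hp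
    obtain ⟨h0, h1, h2⟩ := hroot w hp
    rw [h2]; exact h.mem w hw h1

/-- The new child records `r y = deg y`, which equals the number of children of `x` at this moment.
The level of `x` may be raised freely because `x` is a root. -/
theorem link {x y : ℤ} (h : HeapOK n S (-1) (-1) key par mark deg head nxt item pc r lvl ch)
    (hx : x ∈ S) (hy : y ∈ S) (hxr : par x = -1) (hyr : par y = -1) (hxy : x ≠ y)
    (hd : deg x = deg y) (hk : key y ≤ key x) :
    HeapOK n S (-1) (-1) key (Function.update par y x) (Function.update mark y 0)
      (Function.update deg x (deg x + 1)) (Function.update head x (pc + 1))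
      (Function.update nxt (pc + 1) (head x)) (Function.update item (pc + 1) y) (pc + 1)
      (Function.update r y (deg y)) (Function.update lvl x (max (lvl x) (lvl y) + 1))
      (Function.update ch x (y :: ch x)) := by
  have hx1 : x ≠ -1 := fun e => h.neg_one_notMem (e ▸ hx)
  have hlist : ∀ {e l}, ListAt nxt item pc e l → ListAt (Function.update nxt (pc + 1) (head x))
      (Function.update item (pc + 1) y) (pc + 1) e l := by
    intro e l hl
    refine hl.congr (by omega) ?_ ?_ <;>
    · intro e' he'
      rw [Function.update_of_ne (by omega)]
  refine ⟨h.range, ?_, ?_, ?_, ?_, ?_, ?_, ?_, ?_, ?_, ?_, by have := h.pc_nonneg; omega⟩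
  · intro w hw hp
    by_cases e : w = y
    · subst e; simpa using hx
    · rw [Function.update_of_ne e] at hp ⊢; exact h.par_mem w hw hp
  · intro a ha
    by_cases e : a = x
    · subst e
      have : S.filter (Function.update par y a · = a) = insert y (S.filter (par · = a)) := by
        ext w
        simp only [Finset.mem_filter, Finset.mem_insert]
        by_cases hw : w = y
        · subst hw; simp [hy]
        · simp [hw]
      rw [this, Function.update_self, Finset.card_insert_of_notMem (by simp [hyr, hx1.symm]),
        h.deg_eq _ ha]
      push_cast; ring
    · have : S.filter (Function.update par y x · = a) = S.filter (par · = a) := by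
        ext w
        simp only [Finset.mem_filter]
        have ha1 : a ≠ -1 := fun e => h.neg_one_notMem (e ▸ ha)
        by_cases hw : w = y
        · subst hw; simp [Ne.symm e, hyr, ha1.symm]
        · simp [Function.update_of_ne hw]
      rw [this, Function.update_of_ne e, h.deg_eq _ ha]
  · intro w hw
    rw [Function.update_apply]
    split_ifs
    · exact Or.inl rfl
    · exact h.mark_mem w hw
  · intro w hw hp _
    by_cases e : w = y
    · subst e
      rw [Function.update_self, Function.update_self, Function.update_of_ne hxy.symm]; omega
    · rw [Function.update_of_ne e] at hp
      rw [Function.update_of_ne e, Function.update_of_ne e,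
        Function.update_of_ne (show w ≠ x from fun e => hp (by rw [e, hxr]))]
      exact h.deg_ge w hw hp fun e => h.neg_one_notMem (e ▸ hw)
  · intro w hw hp
    by_cases e : w = y
    · subst e
      rw [Function.update_self, Function.update_self, Function.update_of_ne hxy.symm]; omega
    · rw [Function.update_of_ne e] at hp
      rw [Function.update_of_ne e, Function.update_of_ne e,
        Function.update_of_ne (show w ≠ x from fun e => hp (by rw [e, hxr]))]
      exact h.deg_ge' w hw hp
  · intro a ha t ht
    have ha1 : a ≠ -1 := fun e => h.neg_one_notMem (e ▸ ha)
    -- For `t ≥ deg y` the root `x` had `deg x = deg y ≤ t` children in all, so with `y` there are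
    -- at most `t + 1`. For smaller `t` the new child is not counted.
    by_cases e : a = x ∧ deg y ≤ t
    · obtain ⟨rfl, hdt⟩ := e
      have : S.filter (fun w => Function.update par y a w = a ∧ Function.update r y (deg y) w ≤ t) ⊆
          insert y (S.filter (par · = a)) := by
        intro w
        simp only [Finset.mem_filter, Finset.mem_insert]
        rintro ⟨h1, h2, -⟩
        by_cases hw : w = y
        · exact Or.inl hw
        · rw [Function.update_of_ne hw] at h2; exact Or.inr ⟨h1, h2⟩
      have h1 := Finset.card_le_card this
      have h2 := Finset.card_insert_le y (S.filter (par · = a))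
      have h3 := h.deg_eq a ha
      omega
    · refine le_trans ?_ (h.count a ha t ht)
      refine Nat.cast_le.2 (Finset.card_le_card fun w => ?_)
      simp only [Finset.mem_filter]
      rintro ⟨h1, h2, h3⟩
      by_cases hw : w = y
      · subst hw
        rw [Function.update_self] at h2 h3
        exact absurd ⟨h2.symm, h3⟩ e
      · rw [Function.update_of_ne hw] at h2 h3
        exact ⟨h1, h2, h3⟩
  · intro w hw hp _
    by_cases e : w = y
    · subst e; simpa using hk
    · rw [Function.update_of_ne e] at hp ⊢
      exact h.key_le w hw hp fun e => h.neg_one_notMem (e ▸ hw)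
  · intro w hw hp
    by_cases e : w = y
    · subst e
      rw [Function.update_self, Function.update_self, Function.update_of_ne hxy.symm]; omega
    · rw [Function.update_of_ne e] at hp ⊢
      have := h.lvl_lt w hw hp
      rw [Function.update_of_ne (show w ≠ x from fun e => hp (by rw [e, hxr])),
        Function.update_apply]
      split_ifs with e2
      · rw [e2] at this; omega
      · exact this
  · intro a ha
    by_cases e : a = x
    · subst e
      rw [Function.update_self, Function.update_self]
      have := h.pc_nonneg
      exact ⟨by omega, le_rfl, by simp, by simpa using hlist (h.list _ ha)⟩
    · rw [Function.update_of_ne e, Function.update_of_ne e]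
      exact hlist (h.list _ ha)
  · intro w hw hp
    by_cases e : w = y
    · subst e; simp
    · rw [Function.update_of_ne e] at hp ⊢
      have := h.mem w hw hp
      rw [Function.update_apply]
      split_ifs with e2
      · exact List.mem_cons_of_mem _ (e2 ▸ this)
      · exact this

theorem erase {b : ℤ} (h : HeapOK n S (-1) (-1) key par mark deg head nxt item pc r lvl ch)
    (hb : par b = -1) (hkids : ∀ y ∈ S, par y ≠ b) :
    HeapOK n (S.erase b) (-1) (-1) key par mark deg head nxt item pc r lvl ch := by
  have hS : ∀ y ∈ S.erase b, y ∈ S := fun y => Finset.mem_of_mem_erase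
  refine ⟨fun y hy => h.range y (hS y hy), ?_, ?_, fun y hy => h.mark_mem y (hS y hy),
    fun y hy => h.deg_ge y (hS y hy), fun y hy => h.deg_ge' y (hS y hy), ?_, fun y hy => h.key_le y (hS y hy),
    fun y hy => h.lvl_lt y (hS y hy), fun y hy => h.list y (hS y hy),
    fun y hy => h.mem y (hS y hy), h.pc_nonneg⟩
  · intro y hy hp
    exact Finset.mem_erase.2 ⟨hkids y (hS y hy), h.par_mem y (hS y hy) hp⟩
  · intro x hx
    have hx1 : x ≠ -1 := fun e => h.neg_one_notMem (e ▸ hS x hx)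
    rw [h.deg_eq x (hS x hx), Finset.filter_erase, Finset.erase_eq_of_notMem]
    simp [hb, hx1.symm]
  · intro x hx t ht
    refine le_trans (Nat.cast_le.2 (Finset.card_le_card ?_)) (h.count x (hS x hx) t ht)
    exact Finset.filter_subset_filter _ (Finset.erase_subset _ _)

/-- Among the elements with keys at least `key z`, one of greatest level is a root: its parent would
have a key at least as great and a higher level. -/
theorem exists_root (h : HeapOK n S (-1) (-1) key par mark deg head nxt item pc r lvl ch) {z : ℤ}
    (hz : z ∈ S) : ∃ ρ ∈ S, par ρ = -1 ∧ key z ≤ key ρ := by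
  obtain ⟨ρ, hρ, hmax⟩ := Finset.exists_max_image (S.filter (key z ≤ key ·)) lvl ⟨z, by simp [hz]⟩
  simp only [Finset.mem_filter] at hρ hmax
  refine ⟨ρ, hρ.1, ?_, hρ.2⟩
  by_contra hp
  have h1 := h.key_le ρ hρ.1 hp fun e => h.neg_one_notMem (e ▸ hρ.1)
  have h2 := h.lvl_lt ρ hρ.1 hp
  have := hmax _ ⟨h.par_mem ρ hρ.1 hp, hρ.2.trans h1⟩
  omega

/-- By `count`, an element of degree at least `s + 3` has at most `s + 1` children with `r ≤ s`,
hence two with `r ≥ s + 1`. These have degree at least `s`, as a mark accounts for at most one lost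
child. Children of different parents are different. -/
theorem two_mul_card_le (h : HeapOK n S (-1) (-1) key par mark deg head nxt item pc r lvl ch)
    {s : ℤ} (hs : 0 ≤ s) :
    2 * (S.filter (s + 3 ≤ deg ·)).card ≤ (S.filter (s ≤ deg ·)).card := by
  have h2 : ∀ x ∈ S.filter (s + 3 ≤ deg ·),
      2 ≤ ((S.filter (s ≤ deg ·)).filter (par · = x)).card := by
    intro x hx
    simp only [Finset.mem_filter] at hx
    have hx1 : x ≠ -1 := fun e => h.neg_one_notMem (e ▸ hx.1)
    have h1 := h.deg_eq x hx.1
    have h2 := h.count x hx.1 s hs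
    have h3 := Finset.card_filter_add_card_filter_not (s := S.filter (par · = x)) (r · ≤ s)
    rw [Finset.filter_filter] at h3
    have h4 : ((S.filter (par · = x)).filter (fun y => ¬ r y ≤ s)).card ≤
        ((S.filter (s ≤ deg ·)).filter (par · = x)).card := by
      refine Finset.card_le_card fun y => ?_
      simp only [Finset.mem_filter]
      rintro ⟨⟨ha, hb⟩, hc⟩
      have := h.deg_ge y ha (hb ▸ hx1) fun e => h.neg_one_notMem (e ▸ ha)
      have := h.mark_mem y ha
      exact ⟨⟨ha, by omega⟩, hb⟩
    omega
  have h3 : ∑ x ∈ S.filter (s + 3 ≤ deg ·), ((S.filter (s ≤ deg ·)).filter (par · = x)).card ≤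
      (S.filter (s ≤ deg ·)).card := by
    rw [← Finset.card_biUnion]
    · refine Finset.card_le_card fun y => ?_
      simp only [Finset.mem_biUnion, Finset.mem_filter]
      tauto
    · intro a _ b _ hab
      rw [Function.onFun, Finset.disjoint_left]
      simp only [Finset.mem_filter]
      rintro y ⟨-, h1⟩ ⟨-, h2⟩
      exact hab (h1.symm.trans h2)
  have h4 := Finset.sum_le_sum h2
  simp only [Finset.sum_const, smul_eq_mul] at h4
  omega

theorem pow_mul_card_le (h : HeapOK n S (-1) (-1) key par mark deg head nxt item pc r lvl ch)
    (j : ℕ) : 2 ^ j * (S.filter (3 * (j : ℤ) ≤ deg ·)).card ≤ S.card := by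
  induction j with
  | zero => simpa using Finset.card_filter_le _ _
  | succ j ih =>
    refine le_trans ?_ ih
    have := h.two_mul_card_le (s := 3 * j) (by omega)
    have e : (3 * ((j + 1 : ℕ) : ℤ)) = 3 * j + 3 := by push_cast; ring
    rw [e, pow_succ, mul_assoc]
    exact Nat.mul_le_mul_left _ this

/-- A degree of `3 * j` would give `2 ^ j ≤ |S| ≤ n`. Compared with the usual Fibonacci estimate
this is weaker by a constant factor, but no subtree sizes are needed. -/
theorem deg_lt (h : HeapOK n S (-1) (-1) key par mark deg head nxt item pc r lvl ch)
    {j : ℕ} (hj : n < 2 ^ j) {x : ℤ} (hx : x ∈ S) : deg x < 3 * j := by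
  by_contra hlt
  have h1 := h.pow_mul_card_le j
  have h2 : 0 < (S.filter (3 * (j : ℤ) ≤ deg ·)).card :=
    Finset.card_pos.2 ⟨x, by simp only [Finset.mem_filter]; exact ⟨hx, by omega⟩⟩
  have h3 : 2 ^ j * 1 ≤ 2 ^ j * (S.filter (3 * (j : ℤ) ≤ deg ·)).card := Nat.mul_le_mul_left _ h2
  have h4 : S.card ≤ (Finset.Ico 0 n).card :=
    Finset.card_le_card fun y hy => Finset.mem_Ico.2 (h.range y hy)
  rw [Int.card_Ico] at h4
  have h5 := h.range x hx
  have h6 : ((2 ^ j : ℕ) : ℤ) ≤ n := by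
    have : ((2 ^ j : ℕ) : ℤ) ≤ (n - 0).toNat := by exact_mod_cast (by omega)
    omega
  push_cast at h6
  omega

theorem deg_nonneg (h : HeapOK n S exk exd key par mark deg head nxt item pc r lvl ch)
    {x : ℤ} (hx : x ∈ S) : 0 ≤ deg x := by
  rw [h.deg_eq x hx]; positivity

end HeapOK

/-! ### The heap on the machine: increasing a key -/

/-- The cells `0, …, rc - 1` of `rs` hold the members of `R`, each once. -/
structure StackIs (rs : ℤ → ℤ) (rc : ℤ) (R : Finset ℤ) : Prop where
  mem : ∀ i, 0 ≤ i → i < rc → rs i ∈ R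
  inj : ∀ i j, 0 ≤ i → i < rc → 0 ≤ j → j < rc → rs i = rs j → i = j
  card : (R.card : ℤ) = rc

theorem StackIs.push {rs : ℤ → ℤ} {rc : ℤ} {R : Finset ℤ} (h : StackIs rs rc R) {y : ℤ}
    (hy : y ∉ R) : StackIs (Function.update rs rc y) (rc + 1) (insert y R) := by
  refine ⟨?_, ?_, by rw [Finset.card_insert_of_notMem hy]; push_cast; rw [h.card]⟩
  · intro i h0 h1
    rw [Function.update_apply]
    split_ifs with e
    · exact Finset.mem_insert_self _ _
    · exact Finset.mem_insert_of_mem (h.mem i h0 (by omega))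
  · intro i j hi hi' hj hj'
    rw [Function.update_apply, Function.update_apply]
    split_ifs with e e' e'
    · omega
    · exact fun hh => absurd (hh ▸ h.mem j hj (by omega)) hy
    · exact fun hh => absurd (hh ▸ h.mem i hi (by omega)) hy
    · exact h.inj i j hi (by omega) hj (by omega)

theorem StackIs.pop {rs : ℤ → ℤ} {rc : ℤ} {R : Finset ℤ} (h : StackIs rs rc R) (hrc : 0 < rc) :
    rs (rc - 1) ∈ R ∧ StackIs rs (rc - 1) (R.erase (rs (rc - 1))) := by
  have h0 := h.mem (rc - 1) (by omega) (by omega)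
  refine ⟨h0, ?_, fun i j hi hi' hj hj' => h.inj i j hi (by omega) hj (by omega), ?_⟩
  · intro i hi hi'
    exact Finset.mem_erase.2 ⟨fun e => by
      have := h.inj i (rc - 1) hi (by omega) (by omega) (by omega) e; omega, h.mem i hi (by omega)⟩
  · have := Finset.card_erase_of_mem h0
    have := h.card
    have := Finset.card_pos.2 ⟨_, h0⟩
    omega

theorem StackIs.nonneg {rs : ℤ → ℤ} {rc : ℤ} {R : Finset ℤ} (h : StackIs rs rc R) : 0 ≤ rc := by
  rw [← h.card]; positivity

theorem StackIs.eq_empty {rs : ℤ → ℤ} {R : Finset ℤ} (h : StackIs rs 0 R) : R = ∅ := by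
  have := h.card
  exact Finset.card_eq_zero.1 (by omega)

/-- The amortization potential of a heap. -/
def heapPot (S : Finset ℤ) (rc : ℤ) (mark : ℤ → ℤ) (ch : ℤ → List ℤ) : ℤ :=
  -- A root saves for its treatment in `consolidate`, a mark for the cut that will remove it
  -- together with the 300 of the root so created, and a list cell for its visit in
  -- `releaseChildren`.
  300 * rc + 400 * ∑ v ∈ S, mark v + 100 * ∑ x ∈ S, ((ch x).length : ℤ)

/-- The memory holds a heap on `S` whose potential is at most `c`. Arrays `15, …, 22` are the keys,
parents, marks, degrees, list heads, list pointers, list items and the stack of roots; registers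
`19` and `20` are the heights of the stack and the number of list cells used. The roots in `U` are
not on the stack. -/
def HeapStC (n : ℤ) (S : Finset ℤ) (exk exd : ℤ) (U : Finset ℤ) (ch : ℤ → List ℤ) (σ : Store)
    (c : ℤ) : Prop :=
  ∃ r lvl R, HeapOK n S exk exd (σ.arr 15) (σ.arr 16) (σ.arr 17) (σ.arr 18) (σ.arr 19)
    (σ.arr 20) (σ.arr 21) (σ.var 20) r lvl ch ∧ StackIs (σ.arr 22) (σ.var 19) R ∧
    Disjoint R U ∧ (∀ y, (y ∈ S ∧ σ.arr 16 y = -1) ↔ (y ∈ R ∨ y ∈ U)) ∧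
    heapPot S (σ.var 19) (σ.arr 17) ch ≤ c

/-- As `HeapStC`, for some contents of the lists of children. -/
def HeapSt (n : ℤ) (S : Finset ℤ) (exk exd : ℤ) (U : Finset ℤ) (σ : Store) (c : ℤ) : Prop :=
  ∃ ch, HeapStC n S exk exd U ch σ c

theorem HeapSt.mono {n : ℤ} {S : Finset ℤ} {exk exd : ℤ} {U : Finset ℤ} {σ : Store} {c c' : ℤ}
    (h : HeapSt n S exk exd U σ c) (hc : c ≤ c') : HeapSt n S exk exd U σ c' := by
  obtain ⟨ch, r, lvl, R, h1, h2, h3, h4, h5⟩ := h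
  exact ⟨ch, r, lvl, R, h1, h2, h3, h4, h5.trans hc⟩

theorem HeapStC.congr {n : ℤ} {S : Finset ℤ} {exk exd : ℤ} {U : Finset ℤ}
    {ch : ℤ → List ℤ} {σ τ : Store} {c : ℤ} (h : HeapStC n S exk exd U ch σ c) (ha : ∀ a, 15 ≤ a → a ≤ 22 → τ.arr a = σ.arr a)
    (h19 : τ.var 19 = σ.var 19) (h20 : τ.var 20 = σ.var 20) : HeapStC n S exk exd U ch τ c := by
  unfold HeapStC
  rw [ha 15 (by omega) (by omega), ha 16 (by omega) (by omega), ha 17 (by omega) (by omega),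
    ha 18 (by omega) (by omega), ha 19 (by omega) (by omega), ha 20 (by omega) (by omega),
    ha 21 (by omega) (by omega), ha 22 (by omega) (by omega), h19, h20]
  exact h

theorem HeapSt.congr {n : ℤ} {S : Finset ℤ} {exk exd : ℤ} {U : Finset ℤ} {σ τ : Store} {c : ℤ}
    (h : HeapSt n S exk exd U σ c) (ha : ∀ a, 15 ≤ a → a ≤ 22 → τ.arr a = σ.arr a)
    (h19 : τ.var 19 = σ.var 19) (h20 : τ.var 20 = σ.var 20) : HeapSt n S exk exd U τ c := by
  obtain ⟨ch, h⟩ := h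
  exact ⟨ch, h.congr ha h19 h20⟩

theorem HeapOK.pot_nonneg {n : ℤ} {S : Finset ℤ} {exk exd : ℤ}
    {key par mark deg head nxt item : ℤ → ℤ} {pc : ℤ} {r : ℤ → ℤ} {lvl : ℤ → ℕ} {ch : ℤ → List ℤ}
    (h : HeapOK n S exk exd key par mark deg head nxt item pc r lvl ch) {rc : ℤ} (hrc : 0 ≤ rc) :
    0 ≤ heapPot S rc mark ch := by
  have h1 : 0 ≤ ∑ v ∈ S, mark v := Finset.sum_nonneg fun v hv => by
    rcases h.mark_mem v hv with e | e <;> omega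
  have h2 : 0 ≤ ∑ x ∈ S, ((ch x).length : ℤ) := Finset.sum_nonneg fun v hv => by positivity
  unfold heapPot
  omega

theorem HeapSt.nonneg {n : ℤ} {S : Finset ℤ} {exk exd : ℤ} {U : Finset ℤ} {σ : Store} {c : ℤ}
    (h : HeapSt n S exk exd U σ c) : 0 ≤ c := by
  obtain ⟨ch, r, lvl, R, h1, h2, -, -, h5⟩ := h
  exact (h1.pot_nonneg h2.nonneg).trans h5

theorem sum_update_eq {S : Finset ℤ} {f : ℤ → ℤ} {y : ℤ} (hy : y ∈ S) (z : ℤ) :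
    ∑ v ∈ S, Function.update f y z v = ∑ v ∈ S, f v - f y + z := by
  rw [Finset.sum_update_of_mem hy, Finset.sum_eq_add_sum_sdiff_singleton_of_mem hy f]
  ring

/-- Makes the child `y` (register `25`) of `x` (register `26`) a root. -/
def cutProg : Program := .block [
  .store 16 (.var 25) (.const (-1)),
  .store 17 (.var 25) (.const 0),
  .store 18 (.var 26) (.sub (.get 18 (.var 26)) (.const 1)),
  .store 22 (.var 19) (.var 25),
  .assign 19 (.add (.var 19) (.const 1))]

/-- Roots may be marked too. This is harmless: the cascade stops at a root anyway, and `linkProg`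
clears the mark when the root becomes a child. -/
def cascadeBody : Program := .block [
  .assign 26 (.get 16 (.var 25)),
  cutProg,
  .ite (.eq (.get 17 (.var 26)) (.const 0))
    (.store 17 (.var 26) (.const 1))
    (.assign 25 (.var 26))]

/-- Increases the key of the heap element in register `23` by the contents of register `24`. -/
def incKey : Program := .block [
  .store 15 (.var 23) (.add (.get 15 (.var 23)) (.var 24)),
  .assign 25 (.var 23),
  .loop (.le (.const 0) (.get 16 (.var 25))) cascadeBody]

/-- The new root costs 300, and clearing a mark returns 400. Hence the cut of a marked element pays
for itself, and a cascade has constant amortized cost. -/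
theorem cutProg_heapStC {n : ℤ} {S U : Finset ℤ} {ch : ℤ → List ℤ} {σ : Store}
    {c : ℤ}
    (h : HeapStC n S (σ.var 25) (σ.var 25) U ch σ c) (hy : σ.var 25 ∈ S)
    (hp : σ.arr 16 (σ.var 25) ≠ -1) (hx : σ.var 26 = σ.arr 16 (σ.var 25)) :
    HeapStC n S (-1) (σ.var 26) U ch (cutProg.run σ) (c + 300 - 400 * σ.arr 17 (σ.var 25)) := by
  obtain ⟨r, lvl, R, h1, h2, h3, h4, h5⟩ := h
  have hno : ¬ (σ.var 25 ∈ R ∨ σ.var 25 ∈ U) := fun hh => hp ((h4 _).2 hh).2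
  rw [not_or] at hno
  refine ⟨r, lvl, insert (σ.var 25) R, ?_, ?_, ?_, ?_, ?_⟩
  · have := h1.cut hy hp
    rw [← hx] at this
    simpa [cutProg, Program.block, Program.run, Expr.eval] using this
  · simpa [cutProg, Program.block, Program.run, Expr.eval] using h2.push hno.1
  · exact Finset.disjoint_insert_left.2 ⟨hno.2, h3⟩
  · intro y
    simp only [cutProg, Program.block, Program.run, Expr.eval, Store.setVar_arr,
      Store.setArr_arr, Finset.mem_insert]
    by_cases e : y = σ.var 25
    · simp [e, hy]
    · simpa [e] using h4 y
  · have := sum_update_eq (f := σ.arr 17) hy 0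
    simp only [heapPot] at h5 ⊢
    simp only [cutProg, Program.block, Program.run, Expr.eval, Store.setVar_arr,
      Store.setArr_arr, Store.setVar_var, Store.setArr_var]
    simp only [if_true, reduceIte, Nat.reduceEqDiff, this]
    omega

theorem cutProg_heapSt {n : ℤ} {S U : Finset ℤ} {σ : Store} {c : ℤ}
    (h : HeapSt n S (σ.var 25) (σ.var 25) U σ c) (hy : σ.var 25 ∈ S)
    (hp : σ.arr 16 (σ.var 25) ≠ -1) (hx : σ.var 26 = σ.arr 16 (σ.var 25)) :
    HeapSt n S (-1) (σ.var 26) U (cutProg.run σ) (c + 300 - 400 * σ.arr 17 (σ.var 25)) := by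
  obtain ⟨ch, h⟩ := h
  exact ⟨ch, cutProg_heapStC h hy hp hx⟩

theorem HeapSt.setMark {n x : ℤ} {S U : Finset ℤ} {σ : Store} {c : ℤ}
    (h : HeapSt n S (-1) x U σ c) (hx : x ∈ S) (h0 : σ.arr 17 x = 0) :
    HeapSt n S (-1) (-1) U (σ.setArr 17 x 1) (c + 400) := by
  obtain ⟨ch, r, lvl, R, h1, h2, h3, h4, h5⟩ := h
  refine ⟨ch, r, lvl, R, by simpa using h1.setMark h0, by simpa using h2, h3, by simpa using h4, ?_⟩
  have := sum_update_eq (f := σ.arr 17) hx 1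
  simp only [heapPot] at h5 ⊢
  simp only [Store.setArr_arr, Store.setArr_var, if_true, this]
  omega

theorem HeapSt.weaken {n y z : ℤ} {S U : Finset ℤ} {σ : Store} {c : ℤ}
    (h : HeapSt n S (-1) (-1) U σ c) : HeapSt n S y z U σ c := by
  obtain ⟨ch, r, lvl, R, h1, h2⟩ := h
  exact ⟨ch, r, lvl, R, h1.weaken y z, h2⟩

theorem HeapSt.weaken_left {n y z : ℤ} {S U : Finset ℤ} {σ : Store} {c : ℤ}
    (h : HeapSt n S (-1) z U σ c) : HeapSt n S y z U σ c := by
  obtain ⟨ch, r, lvl, R, h1, h2⟩ := h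
  exact ⟨ch, r, lvl, R, h1.weaken_left y, h2⟩

theorem HeapSt.of_root {n y z : ℤ} {S U : Finset ℤ} {σ : Store} {c : ℤ}
    (h : HeapSt n S y z U σ c) (hy : σ.arr 16 y = -1) (hz : σ.arr 16 z = -1) :
    HeapSt n S (-1) (-1) U σ c := by
  obtain ⟨ch, r, lvl, R, h1, h2⟩ := h
  exact ⟨ch, r, lvl, R, h1.of_root hy hz, h2⟩

theorem HeapSt.par_nonneg {n y z x : ℤ} {S U : Finset ℤ} {σ : Store} {c : ℤ}
    (h : HeapSt n S y z U σ c) (hx : x ∈ S) (hp : σ.arr 16 x ≠ -1) :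
    σ.arr 16 x ∈ S ∧ σ.arr 16 x ≠ x ∧ 0 ≤ σ.arr 16 x := by
  obtain ⟨ch, r, lvl, R, h1, h2⟩ := h
  have h3 := h1.par_mem x hx hp
  exact ⟨h3, fun e => by have := h1.lvl_lt x hx hp; rw [e] at this; omega, (h1.range _ h3).1⟩

theorem HeapSt.mark_mem {n y z x : ℤ} {S U : Finset ℤ} {σ : Store} {c : ℤ}
    (h : HeapSt n S y z U σ c) (hx : x ∈ S) : σ.arr 17 x = 0 ∨ σ.arr 17 x = 1 := by
  obtain ⟨ch, r, lvl, R, h1, h2⟩ := h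
  exact h1.mark_mem x hx

theorem incKey_spec {n : ℤ} {S : Finset ℤ} {σ : Store} {c : ℤ}
    (h : HeapSt n S (-1) (-1) ∅ σ c) (hz : σ.var 23 ∈ S) (hδ : 0 ≤ σ.var 24) :
    Wp incKey (fun τ d => HeapSt n S (-1) (-1) ∅ τ d ∧ τ.arr 15 =
      Function.update (σ.arr 15) (σ.var 23) (σ.arr 15 (σ.var 23) + σ.var 24)) σ (c + 900) := by
  apply Wp.seq
  apply Wp.flat rfl
  apply Wp.seq
  apply Wp.flat rfl
  -- `e` is the reserve outside the potential. A last cut may need 300 for the new root, 400 for the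
  -- mark of its parent and some work; a mark at the current element contributes 400 of this.
  refine Wp.loop (fun τ d => τ.var 25 ∈ S ∧ τ.arr 15 =
      Function.update (σ.arr 15) (σ.var 23) (σ.arr 15 (σ.var 23) + σ.var 24) ∧
      ∃ e, HeapSt n S (τ.var 25) (τ.var 25) ∅ τ (d - e) ∧ 10 ≤ e ∧
        (τ.arr 16 (τ.var 25) ≠ -1 → 810 - 400 * τ.arr 17 (τ.var 25) ≤ e)) ?_ ?_ ?_ ?_
  · rintro τ d ⟨-, -, e, h1, h2, -⟩
    have := h1.nonneg; omega
  · rintro τ d - ⟨hy, hkey, e, h1, he, he'⟩ hb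
    simp only [Test.holds, Expr.eval] at hb
    have hp : τ.arr 16 (τ.var 25) ≠ -1 := by omega
    replace he' := he' hp
    obtain ⟨hx, hxy, -⟩ := h1.par_nonneg hy hp
    apply Wp.flat rfl
    have h2 := cutProg_heapSt (σ := τ.setVar 26 (τ.arr 16 (τ.var 25))) (c := d - e)
      (by simpa using h1.congr (by simp) (by simp) (by simp)) (by simpa) (by simpa) (by simp)
    have h25 : ∀ σ, (cutProg.run σ).var 25 = σ.var 25 :=
      fun σ => (run_unchanged cutProg rfl σ).1 25 rfl
    have h26 : ∀ σ, (cutProg.run σ).var 26 = σ.var 26 :=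
      fun σ => (run_unchanged cutProg rfl σ).1 26 rfl
    have h15 : ∀ σ, (cutProg.run σ).arr 15 = σ.arr 15 :=
      fun σ => (run_unchanged cutProg rfl σ).2 15 rfl
    have h16 : (cutProg.run (τ.setVar 26 (τ.arr 16 (τ.var 25)))).arr 16 (τ.var 25) = -1 := by
      simp [cutProg, Program.block, Program.run, Expr.eval]
    have h16' : (cutProg.run (τ.setVar 26 (τ.arr 16 (τ.var 25)))).arr 16 =
        Function.update (τ.arr 16) (τ.var 25) (-1) := by
      simp [cutProg, Program.block, Program.run, Expr.eval]
    have h17 : (cutProg.run (τ.setVar 26 (τ.arr 16 (τ.var 25)))).arr 17 =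
        Function.update (τ.arr 17) (τ.var 25) 0 := by
      simp [cutProg, Program.block, Program.run, Expr.eval]
    set ρ := cutProg.run (τ.setVar 26 (τ.arr 16 (τ.var 25))) with hρ
    have hrun : cascadeBody.run τ = if ρ.arr 17 (τ.arr 16 (τ.var 25)) = 0 then
        ρ.setArr 17 (τ.arr 16 (τ.var 25)) 1 else ρ.setVar 25 (τ.arr 16 (τ.var 25)) := by
      simp only [cascadeBody, Program.block, Program.run, Expr.eval, ← hρ, Test.holds_eq]
      simp [h26, hρ]
    have hcost : (cascadeBody.flatCost : ℤ) ≤ 60 := by decide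
    have hm := h1.mark_mem hy
    have hv25 : ρ.var 25 = τ.var 25 := by rw [hρ, h25]; simp
    have hk : ρ.arr 15 = τ.arr 15 := by rw [hρ, h15]; simp
    simp only [Store.setVar_var, Store.setVar_arr, reduceIte, Nat.reduceEqDiff] at h2
    have hm' := h2.mark_mem hx
    rw [hrun]
    simp only [Test.cost, Expr.cost]
    split_ifs with h0
    -- Unmarked parent: register `25` still holds the element just cut, now a root, so the loop is
    -- about to stop.
    · refine ⟨by simpa [hv25] using hy, by simpa [hk] using hkey, 10, ?_, le_rfl, ?_⟩
      · exact (h2.setMark hx h0).weaken.mono (by push_cast; omega)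
      · intro hh
        simp only [Store.setArr_arr, Store.setArr_var, hv25] at hh
        exact absurd h16 hh
    -- Marked parent: the cascade moves on to it, and its mark reduces the reserve needed to `810 -
    -- 400`.
    · refine ⟨by simpa using hx, by simpa [hk] using hkey, 410, ?_, by norm_num, ?_⟩
      · simp only [Store.setVar_var, if_true]
        refine HeapSt.congr (h2.weaken_left.mono (by push_cast; omega)) (by simp) (by simp) (by simp)
      · intro _
        simp only [Store.setVar_var, if_true, Store.setVar_arr]
        omega
  · rintro τ d - ⟨hy, hkey, e, h1, he, -⟩ hb
    simp only [Test.holds, Expr.eval] at hb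
    have hp : τ.arr 16 (τ.var 25) = -1 := by
      by_contra hp
      have := (h1.par_nonneg hy hp).2.2
      omega
    refine ⟨(h1.of_root hp hp).mono ?_, hkey⟩
    simp only [Test.cost, Expr.cost]
    push_cast; omega
  · have hm := h.mark_mem hz
    obtain ⟨ch, r, lvl, R, h1, h2, h3, h4, h5⟩ := h
    refine ⟨by simpa [Program.run, Expr.eval] using hz, by simp [Program.run, Expr.eval],
      810, ?_, by norm_num, ?_⟩
    · refine ⟨ch, r, lvl, R, ?_, ?_, h3, ?_, ?_⟩
      · simpa [Program.run, Expr.eval] using h1.increase _ _ hδ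
      · simpa [Program.run, Expr.eval] using h2
      · simpa [Program.run, Expr.eval] using h4
      · simp [Program.run, Expr.eval, Program.flatCost, Expr.cost]
        omega
    · intro _
      simp [Program.run, Expr.eval]
      omega

/-! ### The heap on the machine: extracting a maximum -/

/-- Makes the root in register `31` a child of the root in register `32` and puts the latter on the
stack of roots. -/
def linkProg : Program := .block [
  .store 16 (.var 31) (.var 32),
  .store 17 (.var 31) (.const 0),
  .store 18 (.var 32) (.add (.get 18 (.var 32)) (.const 1)),
  .assign 20 (.add (.var 20) (.const 1)),
  .store 21 (.var 20) (.var 31),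
  .store 20 (.var 20) (.get 19 (.var 32)),
  .store 19 (.var 32) (.var 20),
  .store 22 (.var 19) (.var 32),
  .assign 19 (.add (.var 19) (.const 1))]

/-- The 400 credits are 300 for the root put on the stack and 100 for the new list cell. -/
theorem linkProg_heapSt {n : ℤ} {S U : Finset ℤ} {σ : Store} {c : ℤ}
    (h : HeapSt n S (-1) (-1) U σ c) (hx : σ.var 32 ∈ U) (hy : σ.var 31 ∈ U)
    (hxy : σ.var 32 ≠ σ.var 31)
    (hd : σ.arr 18 (σ.var 32) = σ.arr 18 (σ.var 31))
    (hk : σ.arr 15 (σ.var 31) ≤ σ.arr 15 (σ.var 32)) :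
    HeapSt n S (-1) (-1) ((U.erase (σ.var 31)).erase (σ.var 32)) (linkProg.run σ) (c + 400) := by
  obtain ⟨ch, r, lvl, R, h1, h2, h3, h4, h5⟩ := h
  obtain ⟨hxS, hxr⟩ := (h4 _).2 (Or.inr hx)
  obtain ⟨hyS, hyr⟩ := (h4 _).2 (Or.inr hy)
  have hxR : σ.var 32 ∉ R := fun hh => Finset.disjoint_left.1 h3 hh hx
  have hyR : σ.var 31 ∉ R := fun hh => Finset.disjoint_left.1 h3 hh hy
  refine ⟨Function.update ch (σ.var 32) (σ.var 31 :: ch (σ.var 32)),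
    Function.update r (σ.var 31) (σ.arr 18 (σ.var 31)),
    Function.update lvl (σ.var 32) (max (lvl (σ.var 32)) (lvl (σ.var 31)) + 1),
    insert (σ.var 32) R, ?_, ?_, ?_, ?_, ?_⟩
  · simpa [linkProg, Program.block, Program.run, Expr.eval] using
      h1.link hxS hyS hxr hyr hxy hd hk
  · simpa [linkProg, Program.block, Program.run, Expr.eval] using h2.push hxR
  · rw [Finset.disjoint_left]
    intro a ha hb
    simp only [Finset.mem_erase] at hb
    rcases Finset.mem_insert.1 ha with e | e
    · exact hb.1 e
    · exact Finset.disjoint_left.1 h3 e hb.2.2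
  · intro y
    have hx1 : σ.var 32 ≠ -1 := fun e => h1.neg_one_notMem (e ▸ hxS)
    simp only [linkProg, Program.block, Program.run, Expr.eval, Store.setVar_arr,
      Store.setArr_arr, Finset.mem_insert, Finset.mem_erase]
    by_cases e : y = σ.var 31
    · subst e; simp [hx1, hyR, hxy.symm]
    · have := h4 y
      by_cases e' : y = σ.var 32
      · subst e'; simp [hxS, hxr, e]
      · simpa [e, e'] using this
  · have e1 := sum_update_eq (f := σ.arr 17) hyS 0
    have e2 : ∑ a ∈ S, ((Function.update ch (σ.var 32) (σ.var 31 :: ch (σ.var 32)) a).length : ℤ) =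
        ∑ a ∈ S, ((ch a).length : ℤ) + 1 := by
      have := sum_update_eq (f := fun a => ((ch a).length : ℤ)) hxS ((ch (σ.var 32)).length + 1)
      have e3 : ∀ a, ((Function.update ch (σ.var 32) (σ.var 31 :: ch (σ.var 32)) a).length : ℤ) =
          Function.update (fun a => ((ch a).length : ℤ)) (σ.var 32)
            ((ch (σ.var 32)).length + 1) a := by
        intro a
        by_cases e : a = σ.var 32
        · subst e; simp
        · simp [e]
      simp only [e3, this]; ring
    have := h1.mark_mem _ hyS
    simp only [heapPot] at h5 ⊢
    simp only [linkProg, Program.block, Program.run, Expr.eval, Store.setVar_arr,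
      Store.setArr_arr, Store.setVar_var, Store.setArr_var]
    simp only [if_true, reduceIte, Nat.reduceEqDiff, e1, e2]
    omega

theorem HeapSt.pop {n : ℤ} {S U : Finset ℤ} {σ : Store} {c : ℤ}
    (h : HeapSt n S (-1) (-1) U σ c) (hrc : 0 < σ.var 19) :
    σ.arr 22 (σ.var 19 - 1) ∉ U ∧ HeapSt n S (-1) (-1) (insert (σ.arr 22 (σ.var 19 - 1)) U)
      (σ.setVar 19 (σ.var 19 - 1)) (c - 300) := by
  obtain ⟨ch, r, lvl, R, h1, h2, h3, h4, h5⟩ := h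
  obtain ⟨h6, h7⟩ := h2.pop hrc
  refine ⟨Finset.disjoint_left.1 h3 h6, ch, r, lvl, R.erase (σ.arr 22 (σ.var 19 - 1)),
    by simpa using h1, by simpa using h7, ?_, ?_, ?_⟩
  · rw [Finset.disjoint_left]
    intro a ha hb
    rw [Finset.mem_erase] at ha
    rcases Finset.mem_insert.1 hb with e | e
    · exact ha.1 e
    · exact Finset.disjoint_left.1 h3 ha.2 e
  · intro y
    simp only [Store.setVar_arr, h4, Finset.mem_erase, Finset.mem_insert]
    by_cases e : y = σ.arr 22 (σ.var 19 - 1)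
    · simp [e, h6]
    · simp [e]
  · simp only [heapPot, Store.setVar_arr, Store.setVar_var, if_true] at h5 ⊢
    omega

theorem HeapSt.push {n y : ℤ} {S U : Finset ℤ} {σ : Store} {c : ℤ}
    (h : HeapSt n S (-1) (-1) U σ c) (hy : y ∈ U) :
    HeapSt n S (-1) (-1) (U.erase y)
      ((σ.setArr 22 (σ.var 19) y).setVar 19 (σ.var 19 + 1)) (c + 300) := by
  obtain ⟨ch, r, lvl, R, h1, h2, h3, h4, h5⟩ := h
  have hyR : y ∉ R := fun hh => Finset.disjoint_left.1 h3 hh hy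
  refine ⟨ch, r, lvl, insert y R, by simpa using h1, by simpa using h2.push hyR, ?_, ?_, ?_⟩
  · rw [Finset.disjoint_left]
    intro a ha hb
    rw [Finset.mem_erase] at hb
    rcases Finset.mem_insert.1 ha with e | e
    · exact hb.1 e
    · exact Finset.disjoint_left.1 h3 e hb.2
  · intro z
    have := h4 z
    by_cases e : z = y
    · subst e; simpa [hy] using this
    · simpa [e] using this
  · simp only [heapPot, Store.setVar_arr, Store.setVar_var, if_true, Store.setArr_arr] at h5 ⊢
    simp only [Nat.reduceEqDiff, reduceIte]
    omega

theorem HeapSt.root_of_mem {n y : ℤ} {S U : Finset ℤ} {σ : Store} {c : ℤ}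
    (h : HeapSt n S (-1) (-1) U σ c) (hy : y ∈ U) : y ∈ S ∧ σ.arr 16 y = -1 := by
  obtain ⟨ch, r, lvl, R, h1, h2, h3, h4, h5⟩ := h
  exact (h4 _).2 (Or.inr hy)

theorem HeapSt.mem_of_root {n y : ℤ} {S U : Finset ℤ} {σ : Store} {c : ℤ}
    (h : HeapSt n S (-1) (-1) U σ c) (hrc : σ.var 19 = 0) (hy : y ∈ S) (hr : σ.arr 16 y = -1) :
    y ∈ U := by
  obtain ⟨ch, r, lvl, R, h1, h2, h3, h4, h5⟩ := h
  rw [hrc] at h2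
  simpa [h2.eq_empty] using (h4 y).1 ⟨hy, hr⟩

theorem HeapSt.stack_nonneg {n x y : ℤ} {S U : Finset ℤ} {σ : Store} {c : ℤ}
    (h : HeapSt n S x y U σ c) : 0 ≤ σ.var 19 := by
  obtain ⟨ch, r, lvl, R, h1, h2, h3, h4, h5⟩ := h
  exact h2.nonneg

theorem HeapSt.range {n y x z : ℤ} {S U : Finset ℤ} {σ : Store} {c : ℤ}
    (h : HeapSt n S x z U σ c) (hy : y ∈ S) : 0 ≤ y ∧ y < n := by
  obtain ⟨ch, r, lvl, R, h1, h2, h3, h4, h5⟩ := h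
  exact h1.range y hy

/-- The array `A` holds the set `T` of vertices, indexed by their degrees. -/
structure Buckets (A deg : ℤ → ℤ) (T : Finset ℤ) : Prop where
  -- Shifted by one, since 0 is a possible vertex and also marks an empty bucket.
  get : ∀ y ∈ T, A (deg y) = y + 1
  mem : ∀ d, A d ≠ 0 → A d - 1 ∈ T ∧ deg (A d - 1) = d

theorem Buckets.insert {A deg : ℤ → ℤ} {T : Finset ℤ} (h : Buckets A deg T) {y : ℤ}
    (h0 : A (deg y) = 0) (hT : ∀ z ∈ T, z ≠ -1) :
    Buckets (Function.update A (deg y) (y + 1)) deg (insert y T) := by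
  refine ⟨?_, ?_⟩
  · intro z hz
    rcases Finset.mem_insert.1 hz with e | e
    · simp [e]
    · have := h.get z e
      rw [Function.update_of_ne, this]
      intro e'
      rw [← e', this] at h0
      exact hT z e (by omega)
  · intro d hd
    by_cases e : d = deg y
    · subst e; simp
    · rw [Function.update_of_ne e] at hd ⊢
      exact ⟨Finset.mem_insert_of_mem (h.mem d hd).1, (h.mem d hd).2⟩

theorem Buckets.erase {A deg : ℤ → ℤ} {T : Finset ℤ} (h : Buckets A deg T) {d : ℤ} :
    Buckets (Function.update A d 0) deg (T.erase (A d - 1)) := by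
  refine ⟨?_, ?_⟩
  · intro z hz
    rw [Finset.mem_erase] at hz
    have := h.get z hz.2
    rw [Function.update_of_ne, this]
    intro e
    rw [e] at this
    omega
  · intro d' hd
    by_cases e : d' = d
    · subst e; simp at hd
    · rw [Function.update_of_ne e] at hd ⊢
      obtain ⟨h1, h2⟩ := h.mem d' hd
      refine ⟨Finset.mem_erase.2 ⟨fun e' => e ?_, h1⟩, h2⟩
      have h3 : A d ≠ 0 := fun e0 => by
        have := h.get _ h1
        rw [h2] at this
        omega
      rw [← h2, e', (h.mem d h3).2]

theorem Buckets.congr {A deg deg' : ℤ → ℤ} {T : Finset ℤ} (h : Buckets A deg T)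
    (hd : ∀ y ∈ T, deg' y = deg y) : Buckets A deg' T :=
  ⟨fun y hy => by rw [hd y hy]; exact h.get y hy,
    fun d hA => ⟨(h.mem d hA).1, by rw [hd _ (h.mem d hA).1]; exact (h.mem d hA).2⟩⟩

/-- Takes a root off the stack and either puts it into the free bucket of its degree or links it
with the root in that bucket. -/
def consolidateBody : Program := .block [
  .assign 19 (.sub (.var 19) (.const 1)),
  .assign 28 (.get 22 (.var 19)),
  .assign 29 (.get 18 (.var 28)),
  .ite (.eq (.get 23 (.var 29)) (.const 0))
    (.store 23 (.var 29) (.add (.var 28) (.const 1)))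
    (.block [
      .assign 30 (.sub (.get 23 (.var 29)) (.const 1)),
      .store 23 (.var 29) (.const 0),
      .assign 31 (.var 28),
      .assign 32 (.var 30),
      .ite (.le (.get 15 (.var 28)) (.get 15 (.var 30))) .skip
        (.block [.assign 31 (.var 30), .assign 32 (.var 28)]),
      linkProg])]

def consolidate : Program := .loop (.lt (.const 0) (.var 19)) consolidateBody

theorem consolidate_spec {n : ℤ} {S : Finset ℤ} {σ : Store} {c : ℤ}
    (h : HeapSt n S (-1) (-1) ∅ σ c) (hA : ∀ d, σ.arr 23 d = 0) :
    Wp consolidate (fun τ d => ∃ T, HeapSt n S (-1) (-1) T τ d ∧ τ.var 19 = 0 ∧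
      Buckets (τ.arr 23) (τ.arr 18) T) σ (c + 10) := by
  -- A root in a bucket keeps 200 of the 300 credits that it had on the stack; the other 100 pay for
  -- the round. A link has 300 from the popped root and 200 from the bucket, spends 400 in
  -- `linkProg`, and again leaves 100.
  refine Wp.loop (fun τ d => ∃ T, HeapSt n S (-1) (-1) T τ (d - 10 - 200 * T.card) ∧
      Buckets (τ.arr 23) (τ.arr 18) T) ?_ ?_ ?_ ?_
  · rintro τ d ⟨T, h1, -⟩
    have := h1.nonneg; omega
  · rintro τ d - ⟨T, h1, hB⟩ hb
    simp only [Test.holds_lt, Expr.eval] at hb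
    obtain ⟨hyT, h2⟩ := h1.pop hb
    apply Wp.flat rfl
    have hcost : (consolidateBody.flatCost : ℤ) ≤ 96 := by decide
    set y := τ.arr 22 (τ.var 19 - 1) with hy
    obtain ⟨hyS, hyr⟩ := h2.root_of_mem (Finset.mem_insert_self _ _)
    have hT1 : ∀ z ∈ T, z ≠ -1 := fun z hz e => by
      have := (h1.range (h1.root_of_mem hz).1).1; omega
    set τ' := ((τ.setVar 19 (τ.var 19 - 1)).setVar 28 y).setVar 29 (τ.arr 18 y) with hτ'
    have h3 : HeapSt n S (-1) (-1) (insert y T) τ' (d - 10 - 200 * T.card - 300) :=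
      h2.congr (by simp [hτ']) (by simp [hτ']) (by simp [hτ'])
    by_cases h0 : τ.arr 23 (τ.arr 18 y) = 0
    · have hrun : consolidateBody.run τ = τ'.setArr 23 (τ.arr 18 y) (y + 1) := by
        simp [consolidateBody, Program.block, Program.run, Expr.eval, ← hy, h0, hτ']
      rw [hrun]
      refine ⟨insert y T, ?_, ?_⟩
      · refine HeapSt.congr (h3.mono ?_) ?_ (by simp) (by simp)
        · rw [Finset.card_insert_of_notMem hyT]
          simp only [Test.cost, Expr.cost]; push_cast; omega
        · intro a ha ha'
          have : a ≠ 23 := by omega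
          simp [this]
      · simpa [hτ'] using hB.insert h0 hT1
    · obtain ⟨hz, hzd⟩ := hB.mem _ h0
      set z := τ.arr 23 (τ.arr 18 y) - 1 with hzdef
      have hyz : y ≠ z := fun e => hyT (e ▸ hz)
      have hBe := hB.erase (d := τ.arr 18 y)
      rw [← hzdef] at hBe
      -- Both outcomes of the comparison of keys end here; they differ in which of `y`, `z` is in
      -- register `31` and which in `32`.
      have hfin : ∀ τ'' : Store, (τ''.arr = (τ'.setArr 23 (τ.arr 18 y) 0).arr) →
          τ''.var 19 = τ'.var 19 → τ''.var 20 = τ'.var 20 →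
          ({τ''.var 31, τ''.var 32} : Finset ℤ) = {y, z} → 
          τ.arr 15 (τ''.var 31) ≤ τ.arr 15 (τ''.var 32) → 
          HeapSt n S (-1) (-1) (T.erase z) (linkProg.run τ'') 
            (d - 10 - 200 * T.card + 100) ∧
          Buckets ((linkProg.run τ'').arr 23) ((linkProg.run τ'').arr 18) (T.erase z) := by
        intro τ'' e1 e2 e3 e4 e5
        have h31 : τ''.var 31 ∈ ({y, z} : Finset ℤ) := by rw [← e4]; simp
        have h32 : τ''.var 32 ∈ ({y, z} : Finset ℤ) := by rw [← e4]; simp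
        have hne : τ''.var 32 ≠ τ''.var 31 := by
          intro e
          have : ({y, z} : Finset ℤ).card = 1 := by rw [← e4, e]; simp
          rw [Finset.card_pair hyz] at this
          omega
        simp only [Finset.mem_insert, Finset.mem_singleton] at h31 h32
        have h4 : HeapSt n S (-1) (-1) (insert y T) τ'' (d - 10 - 200 * T.card - 300) := by
          refine h3.congr (fun a ha ha' => ?_) e2 e3
          have : a ≠ 23 := by omega
          rw [e1]; simp [this]
        have hmem : ∀ {w}, w = y ∨ w = z → w ∈ insert y T := by
          rintro w (rfl | rfl)
          · exact Finset.mem_insert_self _ _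
          · exact Finset.mem_insert_of_mem hz
        have hdeg : ∀ {w}, w = y ∨ w = z → τ''.arr 18 w = τ.arr 18 y := by
          rintro w (rfl | rfl)
          · rw [e1]; simp [hτ']
          · rw [e1]; simp [hτ', hzd]
        have h5 := linkProg_heapSt h4 (hmem h32) (hmem h31) hne
          (by rw [hdeg h31, hdeg h32]) (by rw [e1]; simpa [hτ'] using e5)
        have hset : ((insert y T).erase (τ''.var 31)).erase (τ''.var 32) = T.erase z := by
          ext w
          simp only [Finset.mem_erase, Finset.mem_insert]
          have hwz : w = y → w ∉ T := fun e => e ▸ hyT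
          rcases h31 with a | a <;> rcases h32 with b | b
          · exact absurd (b.trans a.symm) hne
          · rw [a, b]; tauto
          · rw [a, b]; tauto
          · exact absurd (b.trans a.symm) hne
        rw [hset] at h5
        refine ⟨h5.mono (by omega), ?_⟩
        have e6 : (linkProg.run τ'').arr 23 = Function.update (τ.arr 23) (τ.arr 18 y) 0 := by
          rw [(run_unchanged linkProg rfl τ'').2 23 rfl, e1]; simp [hτ']
        have e7 : (linkProg.run τ'').arr 18 = Function.update (τ.arr 18) (τ''.var 32)
            (τ.arr 18 (τ''.var 32) + 1) := by
          simp [linkProg, Program.block, Program.run, Expr.eval, e1, hτ']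
        rw [e6, e7]
        refine hBe.congr fun w hw => Function.update_of_ne ?_ _ _
        rw [Finset.mem_erase] at hw
        rintro rfl
        rcases h32 with a | a
        · exact hyT (a ▸ hw.2)
        · exact hw.1 a
      have hcard : ((T.erase z).card : ℤ) = T.card - 1 := by
        have := Finset.card_pos.2 ⟨z, hz⟩
        rw [Finset.card_erase_of_mem hz]; omega
      have hend : ∀ {ρ}, HeapSt n S (-1) (-1) (T.erase z) ρ (d - 10 - 200 * T.card + 100) →
          HeapSt n S (-1) (-1) (T.erase z) ρ
            (d - ((Test.lt (Expr.const 0) (Expr.var 19)).cost : ℕ) - consolidateBody.flatCost - 10 -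
              200 * ((T.erase z).card : ℤ)) := by
        intro ρ hρ
        refine hρ.mono ?_
        rw [hcard]
        simp only [Test.cost, Expr.cost]; push_cast; omega
      set τ2 := ((τ'.setVar 30 z).setArr 23 (τ.arr 18 y) 0) with hτ2
      by_cases hk : τ.arr 15 y ≤ τ.arr 15 z
      · have hrun : consolidateBody.run τ = linkProg.run ((τ2.setVar 31 y).setVar 32 z) := by
          simp [consolidateBody, Program.block, Program.run, Expr.eval, ← hy, h0, hτ',
            ← hzdef, hk, hτ2]
        rw [hrun]
        obtain ⟨h4, h5⟩ := hfin ((τ2.setVar 31 y).setVar 32 z) (by simp [hτ2]; rfl)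
          (by simp [hτ2]) (by simp [hτ2]) (by simp [hτ2]) (by simpa [hτ2] using hk)
        exact ⟨T.erase z, hend h4, h5⟩
      · have hrun : consolidateBody.run τ = linkProg.run
            ((((τ2.setVar 31 y).setVar 32 z).setVar 31 z).setVar 32 y) := by
          simp [consolidateBody, Program.block, Program.run, Expr.eval, ← hy, h0, hτ',
            ← hzdef, hk, hτ2]
        rw [hrun]
        obtain ⟨h4, h5⟩ := hfin ((((τ2.setVar 31 y).setVar 32 z).setVar 31 z).setVar 32 y)
          (by simp [hτ2]; rfl) (by simp [hτ2]) (by simp [hτ2])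
          (by simp [hτ2, Finset.pair_comm]) (by simpa [hτ2] using (not_le.1 hk).le)
        exact ⟨T.erase z, hend h4, h5⟩
  · rintro τ d - ⟨T, h1, hB⟩ hb
    simp only [Test.holds_lt, Expr.eval] at hb
    have := h1.stack_nonneg
    refine ⟨T, h1.mono ?_, by omega, hB⟩
    simp only [Test.cost, Expr.cost]; push_cast; omega
  · exact ⟨∅, h.mono (by simp), by simp, fun d hd => absurd (hA d) hd⟩

/-- Takes the root out of bucket `d` (register `29`); register `27` holds the root with the greatest
key so far, the others are put on the stack. -/
def bucketBody : Program :=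
  .ite (.eq (.get 23 (.var 29)) (.const 0)) .skip (.block [
    .assign 30 (.sub (.get 23 (.var 29)) (.const 1)),
    .store 23 (.var 29) (.const 0),
    .ite (.lt (.var 27) (.const 0)) (.assign 27 (.var 30)) (.block [
      .assign 31 (.var 30),
      .ite (.le (.get 15 (.var 30)) (.get 15 (.var 27))) .skip
        (.block [.assign 31 (.var 27), .assign 27 (.var 30)]),
      .store 22 (.var 19) (.var 31),
      .assign 19 (.add (.var 19) (.const 1))])])

def scanBuckets : Program := .block [
  .assign 27 (.const (-1)),
  .assign 29 (.const 0),
  .forUp 29 12 bucketBody]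

/-- The roots not on the stack are those in `T` and the one in register `27`, whose key is at least
as great as the keys of the roots on the stack. -/
def BestRoot (S T U : Finset ℤ) (σ : Store) : Prop :=
  (σ.var 27 = -1 ∧ U = T ∧ ∀ x ∈ S, σ.arr 16 x = -1 → x ∈ T) ∨
    (σ.var 27 ∈ S ∧ σ.arr 16 (σ.var 27) = -1 ∧ σ.var 27 ∉ T ∧ U = insert (σ.var 27) T ∧
      ∀ x ∈ S, σ.arr 16 x = -1 → x ∈ T ∨ σ.arr 15 x ≤ σ.arr 15 (σ.var 27))

/-- Each of the `B` buckets is charged at most 300 for putting a root back on the stack, 100 for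
work and 8 for the loop. A maximal root suffices, as every key is at most the key of some root
(`HeapOK.exists_root`). -/
theorem scanBuckets_spec {n B : ℤ} {S T : Finset ℤ} {σ : Store} {c : ℤ}
    (h : HeapSt n S (-1) (-1) T σ c) (hrc : σ.var 19 = 0)
    (hB : Buckets (σ.arr 23) (σ.arr 18) T) (h12 : σ.var 12 = B)
    (hdeg : ∀ x ∈ S, σ.arr 18 x < B) (hB0 : 0 ≤ B) (hS : S.Nonempty) :
    Wp scanBuckets (fun τ d => HeapSt n S (-1) (-1) {τ.var 27} τ d ∧
      (∀ x ∈ S, τ.arr 15 x ≤ τ.arr 15 (τ.var 27)) ∧ τ.arr 23 = fun _ => 0) σ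
      (c + 408 * B + 20) := by
  apply Wp.seq
  apply Wp.flat rfl
  apply Wp.seq
  apply Wp.flat rfl
  refine Wp.forUp (i := 29) (hi := 12) 0 B 400 (fun j τ d => ∃ T U,
    HeapSt n S (-1) (-1) U τ d ∧ BestRoot S T U τ ∧ Buckets (τ.arr 23) (τ.arr 18) T ∧
    ∀ d, 0 ≤ d → d < j → τ.arr 23 d = 0) rfl rfl rfl (by norm_num) ?_ ?_ ?_ ?_ ?_ hB0 ?_
  · rintro j τ d - - ⟨T, U, h1, -⟩
    exact h1.nonneg
  · rintro j τ d hj0 hjB h29 - - ⟨T, U, h1, h2, h3, h4⟩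
    apply Wp.flat rfl
    have hcost : (bucketBody.flatCost : ℤ) ≤ 100 := by decide
    by_cases h0 : τ.arr 23 j = 0
    · have hrun : bucketBody.run τ = τ := by
        simp [bucketBody, Program.block, Program.run, Expr.eval, h29, h0]
      rw [hrun]
      refine ⟨T, U, HeapSt.congr (h1.mono (by omega)) (by simp) (by simp) (by simp),
        by simpa [BestRoot] using h2, by simpa using h3, ?_⟩
      intro d' hd hd'
      rcases eq_or_ne d' j with e | e
      · simpa [e] using h0
      · simpa using h4 d' hd (by omega)
    · obtain ⟨hz, hzd⟩ := h3.mem _ h0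
      set z := τ.arr 23 j - 1 with hzdef
      have hBe := h3.erase (d := j)
      rw [← hzdef] at hBe
      have hzU : z ∈ U := by
        rcases h2 with ⟨-, rfl, -⟩ | ⟨-, -, -, rfl, -⟩
        · exact hz
        · exact Finset.mem_insert_of_mem hz
      obtain ⟨hzS, hzr⟩ := h1.root_of_mem hzU
      have hA : ∀ d, 0 ≤ d → d < j + 1 → Function.update (τ.arr 23) j 0 d = 0 := by
        intro d' hd hd'
        rcases eq_or_ne d' j with e | e
        · simp [e]
        · rw [Function.update_of_ne e]; exact h4 d' hd (by omega)
      rcases h2 with ⟨hb, rfl, hr⟩ | ⟨hbS, hbr, hbT, rfl, hr⟩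
      · have hrun : bucketBody.run τ = ((τ.setVar 30 z).setArr 23 j 0).setVar 27 z := by
          simp [bucketBody, Program.block, Program.run, Expr.eval, h29, h0, hb, ← hzdef]
        rw [hrun]
        refine ⟨U.erase z, U, HeapSt.congr (h1.mono (by omega)) ?_ (by simp) (by simp),
          Or.inr ?_, by simpa using hBe, by simpa using hA⟩
        · intro a ha ha'
          have : a ≠ 23 := by omega
          simp [this]
        · simp only [Store.setVar_var, Store.setVar_arr, Store.setArr_arr]
          refine ⟨by simpa using hzS, by simpa using hzr, by simp, by simp [hzU], ?_⟩
          intro x hx hxr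
          rcases eq_or_ne x z with e | e
          · exact Or.inr (by simp [e])
          · exact Or.inl (Finset.mem_erase.2 ⟨e, hr x hx (by simpa using hxr)⟩)
      · have hb0 : ¬ τ.var 27 < 0 := not_lt.2 (h1.range hbS).1
        have hbz : τ.var 27 ≠ z := fun e => hbT (e ▸ hz)
        set τ2 := (τ.setVar 30 z).setArr 23 j 0 with hτ2
        have h1' : ∀ τ3 : Store, τ3.arr = τ2.arr → τ3.var 19 = τ.var 19 → τ3.var 20 = τ.var 20 →
            HeapSt n S (-1) (-1) (insert (τ.var 27) T) τ3 d := by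
          intro τ3 e1 e2 e3
          refine h1.congr ?_ e2 e3
          intro a ha ha'
          have : a ≠ 23 := by omega
          simp [e1, hτ2, this]
        by_cases hk : τ.arr 15 z ≤ τ.arr 15 (τ.var 27)
        · have hrun : bucketBody.run τ =
              ((τ2.setVar 31 z).setArr 22 (τ.var 19) z).setVar 19 (τ.var 19 + 1) := by
            simp [bucketBody, Program.block, Program.run, Expr.eval, h29, h0, hb0, ← hzdef, hk, hτ2]
          rw [hrun]
          have h5 := (h1' (τ2.setVar 31 z) rfl (by simp [hτ2]) (by simp [hτ2])).push hzU
          refine ⟨T.erase z, (insert (τ.var 27) T).erase z, ?_, Or.inr ?_,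
            by simpa [hτ2] using hBe, by simpa [hτ2] using hA⟩
          · refine HeapSt.congr (h5.mono (c' := d + 400 - bucketBody.flatCost) (by omega)) ?_ ?_ ?_ <;> simp [hτ2]
          · simp only [Store.setVar_var, Store.setVar_arr, Store.setArr_arr, Store.setArr_var, hτ2]
            refine ⟨by simpa using hbS, by simpa using hbr, ?_, ?_, ?_⟩
            · simp [hbT]
            · simp [Finset.erase_insert_of_ne hbz]
            · intro x hx hxr
              rcases eq_or_ne x z with e | e
              · exact Or.inr (by simpa [e] using hk)
              · rcases hr x hx (by simpa using hxr) with h | h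
                · exact Or.inl (Finset.mem_erase.2 ⟨e, h⟩)
                · exact Or.inr (by simpa using h)
        · have hrun : bucketBody.run τ =
              ((((τ2.setVar 31 z).setVar 31 (τ.var 27)).setVar 27 z).setArr 22 (τ.var 19)
                (τ.var 27)).setVar 19 (τ.var 19 + 1) := by
            simp [bucketBody, Program.block, Program.run, Expr.eval, h29, h0, hb0, ← hzdef, hk, hτ2]
          rw [hrun]
          have h5 := (h1' (((τ2.setVar 31 z).setVar 31 (τ.var 27)).setVar 27 z) rfl (by simp [hτ2])
            (by simp [hτ2])).push (Finset.mem_insert_self (τ.var 27) T)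
          rw [Finset.erase_insert hbT] at h5
          refine ⟨T.erase z, T, ?_, Or.inr ?_,
            by simpa [hτ2] using hBe, by simpa [hτ2] using hA⟩
          · refine HeapSt.congr (h5.mono (c' := d + 400 - bucketBody.flatCost) (by omega)) ?_ ?_ ?_ <;> simp [hτ2]
          · simp only [Store.setVar_var, Store.setVar_arr, Store.setArr_arr, Store.setArr_var, hτ2]
            refine ⟨by simpa using hzS, by simpa using hzr, by simp, by simp [hz], ?_⟩
            intro x hx hxr
            rcases eq_or_ne x z with e | e
            · exact Or.inr (by simp [e])
            · rcases hr x hx (by simpa using hxr) with h | h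
              · exact Or.inl (Finset.mem_erase.2 ⟨e, h⟩)
              · exact Or.inr (by simpa using h.trans (not_le.1 hk).le)
  · rintro τ d - - hU ⟨T', U, h1, h2, h3, h4⟩
    -- All degrees lie between 0 and `B - 1`, so the scan has emptied every bucket that could be in
    -- use.
    have hT : T' = ∅ := by
      rw [Finset.eq_empty_iff_forall_notMem]
      intro t ht
      have htU : t ∈ U := by
        rcases h2 with ⟨-, rfl, -⟩ | ⟨-, -, -, rfl, -⟩
        · exact ht
        · exact Finset.mem_insert_of_mem ht
      have htS := (h1.root_of_mem htU).1
      have e1 : τ.arr 18 = σ.arr 18 := (hU.2 18 rfl).trans (by simp [Program.run])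
      have h5 := h3.get t ht
      obtain ⟨ch, r, lvl, R, h6, -⟩ := h1
      have h7 := h6.deg_nonneg htS
      rw [h4 _ h7 (by rw [e1]; exact hdeg t htS)] at h5
      have := (h6.range t htS).1
      omega
    subst hT
    obtain ⟨z0, hz0⟩ := hS
    have hroot : ∀ z ∈ S, ∃ ρ ∈ S, τ.arr 16 ρ = -1 ∧ τ.arr 15 z ≤ τ.arr 15 ρ := by
      obtain ⟨ch, r, lvl, R, h6, -⟩ := h1
      exact fun z hz => h6.exists_root hz
    rcases h2 with ⟨-, -, hr⟩ | ⟨hbS, hbr, -, rfl, hr⟩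
    · obtain ⟨ρ, h5, h6, -⟩ := hroot z0 hz0
      exact absurd (hr ρ h5 h6) (by simp)
    · refine ⟨h1, ?_, ?_⟩
      · intro x hx
        obtain ⟨ρ, h5, h6, h7⟩ := hroot x hx
        rcases hr ρ h5 h6 with h | h
        · exact absurd h (by simp)
        · exact h7.trans h
      · funext d'
        by_contra hne
        exact absurd (h3.mem d' hne).1 (by simp)
  · simp [Program.run, Expr.eval]
  · simp [Program.run, Expr.eval, h12]
  · refine ⟨T, T, HeapSt.congr (h.mono ?_) (by simp [Program.run]) (by simp [Program.run])
      (by simp [Program.run]), Or.inl ⟨by simp [Program.run, Expr.eval], rfl, ?_⟩,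
      by simpa [Program.run] using hB, fun d' h1 h2 => by omega⟩
    · simp only [Program.flatCost, Expr.cost]
      push_cast
      omega
    · intro x hx hr
      exact h.mem_of_root hrc hx (by simpa [Program.run] using hr)

/-- List items may be outdated, so an item is cut only if it is still in the heap and still a child
of this root. A repeated item is harmless because the first cut changes its parent. -/
def childBody : Program := .block [
  .assign 25 (.get 21 (.var 22)),
  .assign 22 (.get 20 (.var 22)),
  .ite (.eq (.get 14 (.var 25)) (.const 1))
    (.ite (.eq (.get 16 (.var 25)) (.var 27)) (.block [.assign 26 (.var 27), cutProg]) .skip)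
    .skip]

/-- Makes the children of the root in register `27` roots and removes it from the heap. -/
def releaseChildren : Program := .block [
  .assign 22 (.get 19 (.var 27)),
  .loop (.lt (.const 0) (.var 22)) childBody,
  .store 14 (.var 27) (.const 0)]

/-- Moves an element with maximal key from the heap to register `27`. -/
def extractMax : Program := .block [consolidate, scanBuckets, releaseChildren]

/-- Array `14` holds the indicator function of `S`. -/
def MemberArray (S : Finset ℤ) (σ : Store) : Prop := ∀ y, σ.arr 14 y = 1 ↔ y ∈ S

theorem HeapStC.of_exd_root {n b : ℤ} {S U : Finset ℤ} {ch : ℤ → List ℤ} {σ : Store} {c : ℤ}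
    (h : HeapStC n S (-1) b U ch σ c) (hb : σ.arr 16 b = -1) :
    HeapStC n S (-1) (-1) U ch σ c := by
  obtain ⟨r, lvl, R, h1, h2⟩ := h
  refine ⟨r, lvl, R, { h1 with deg_ge := fun w hw hp _ => h1.deg_ge w hw hp fun e => ?_ }, h2⟩
  exact hp (e ▸ hb)

theorem HeapStC.erase {n b : ℤ} {S : Finset ℤ} {ch : ℤ → List ℤ} {σ : Store} {c : ℤ}
    (h : HeapStC n S (-1) (-1) {b} ch σ c) (hkids : ∀ y ∈ S, σ.arr 16 y ≠ b) :
    HeapStC n (S.erase b) (-1) (-1) ∅ ch σ (c - 100 * ((ch b).length : ℤ)) := by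
  obtain ⟨r, lvl, R, h1, h2, h3, h4, h5⟩ := h
  obtain ⟨hbS, hbr⟩ := (h4 b).2 (Or.inr (Finset.mem_singleton_self b))
  have hbR : b ∉ R := fun hh => Finset.disjoint_left.1 h3 hh (Finset.mem_singleton_self b)
  refine ⟨r, lvl, R, h1.erase hbr hkids, h2, by simp, ?_, ?_⟩
  · intro y
    have := h4 y
    rw [Finset.mem_erase]
    by_cases e : y = b
    · subst e; simp [hbR]
    · simpa [e] using this
  · have e1 := Finset.sum_erase_add S (σ.arr 17) hbS
    have e2 := Finset.sum_erase_add S (fun x => ((ch x).length : ℤ)) hbS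
    have := h1.mark_mem b hbS
    simp only [heapPot] at h5 ⊢
    omega

/-- Visiting a list cell is paid by the 100 credits stored for it, which become free as the root
leaves the heap. Only true children cost 300 more as new roots, and there are fewer than `B` of
them. -/
theorem releaseChildren_spec {n B : ℤ} {S : Finset ℤ} {σ : Store} {c : ℤ}
    (h : HeapSt n S (-1) (-1) {σ.var 27} σ c) (hst : MemberArray S σ)
    (hdeg : ∀ x ∈ S, σ.arr 18 x < B) :
    Wp releaseChildren (fun τ d => HeapSt n (S.erase (σ.var 27)) (-1) (-1) ∅ τ d ∧
      MemberArray (S.erase (σ.var 27)) τ) σ (c + 300 * B + 30) := by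
  set b := σ.var 27 with hb
  obtain ⟨ch, h⟩ := h
  have hbS : b ∈ S := by
    obtain ⟨r, lvl, R, h1, h2, h3, h4, h5⟩ := h
    exact ((h4 b).2 (Or.inr (Finset.mem_singleton_self b))).1
  have hb1 : b ≠ -1 := by
    obtain ⟨r, lvl, R, h1, -⟩ := h
    exact fun e => h1.neg_one_notMem (e ▸ hbS)
  apply Wp.seq
  apply Wp.flat rfl
  apply Wp.seq
  -- `l` is the unread rest of the list. The 300 credits still needed for each remaining child are
  -- measured by the current degree of `b`, which every cut decreases.
  refine Wp.loop (fun τ d => ∃ l, HeapStC n S (-1) (-1) {b} ch τ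
      (d + 100 * ((ch b).length : ℤ) - 100 * (l.length : ℤ) - 300 * τ.arr 18 b - 10) ∧
    ListAt (τ.arr 20) (τ.arr 21) (τ.var 20) (τ.var 22) l ∧
    ∀ y ∈ S, τ.arr 16 y = b → y ∈ l) ?_ ?_ ?_ ?_
  · rintro τ d ⟨l, ⟨r, lvl, R, h1, h2, h3, h4, h5⟩, -⟩
    have e1 := Finset.sum_erase_add S (τ.arr 17) hbS
    have e2 := Finset.sum_erase_add S (fun x => ((ch x).length : ℤ)) hbS
    have e3 : 0 ≤ ∑ v ∈ S, τ.arr 17 v := Finset.sum_nonneg fun v hv => by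
      rcases h1.mark_mem v hv with e | e <;> omega
    have e4 : 0 ≤ ∑ x ∈ S.erase b, ((ch x).length : ℤ) :=
      Finset.sum_nonneg fun v hv => by positivity
    have e5 := h2.nonneg
    have e6 := h1.deg_nonneg hbS
    simp only [heapPot] at h5
    omega
  · rintro τ d hU ⟨l, h1, hl, hkids⟩ hb'
    simp only [Test.holds_lt, Expr.eval] at hb'
    obtain ⟨l', rfl, hl'⟩ := hl.eq_cons (by omega)
    have h27 : τ.var 27 = b := (hU.1 27 rfl).trans (by simp [Program.run, ← hb])
    have h14 : ∀ y, τ.arr 14 y = 1 ↔ y ∈ S := by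
      rw [hU.2 14 rfl]; exact hst
    apply Wp.flat rfl
    have hcost : (childBody.flatCost : ℤ) ≤ 96 := by decide
    set y := τ.arr 21 (τ.var 22) with hy
    set τ' := (τ.setVar 25 y).setVar 22 (τ.arr 20 (τ.var 22)) with hτ'
    have hbr : τ.arr 16 b = -1 := by
      obtain ⟨r, lvl, R, h1, h2, h3, h4, h5⟩ := h1
      exact ((h4 b).2 (Or.inr (Finset.mem_singleton_self b))).2
    by_cases hc : y ∈ S ∧ τ.arr 16 y = b
    · obtain ⟨hyS, hyb⟩ := hc
      have hyb' : y ≠ b := fun e => by rw [e, hbr] at hyb; exact hb1 hyb.symm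
      have hrun : childBody.run τ = cutProg.run (τ'.setVar 26 b) := by
        simp [childBody, Program.block, Program.run, Expr.eval, ← hy, hyb, h27,
          (h14 y).2 hyS, hτ']
      rw [hrun]
      have h2 : HeapStC n S ((τ'.setVar 26 b).var 25) ((τ'.setVar 26 b).var 25) {b} ch
          (τ'.setVar 26 b)
          (d + 100 * ((ch b).length : ℤ) - 100 * ((y :: l').length : ℤ) - 300 * τ.arr 18 b - 10) := by
        obtain ⟨r, lvl, R, h1, h2⟩ := h1.congr (τ := τ'.setVar 26 b) (by simp [hτ'])
          (by simp [hτ']) (by simp [hτ'])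
        exact ⟨r, lvl, R, h1.weaken _ _, h2⟩
      have h3 := cutProg_heapStC h2 (by simpa [hτ'] using hyS) (by simpa [hτ', hyb] using hb1)
        (by simp [hτ', hyb])
      have e16 : (cutProg.run (τ'.setVar 26 b)).arr 16 = Function.update (τ.arr 16) y (-1) := by
        simp [cutProg, Program.block, Program.run, Expr.eval, hτ']
      have e18 : (cutProg.run (τ'.setVar 26 b)).arr 18 =
          Function.update (τ.arr 18) b (τ.arr 18 b - 1) := by
        simp [cutProg, Program.block, Program.run, Expr.eval, hτ']
      have hm : 0 ≤ τ.arr 17 y := by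
        obtain ⟨r, lvl, R, h1, -⟩ := h1
        have := h1.mark_mem y hyS
        omega
      refine ⟨l', ?_, ?_, ?_⟩
      · have h4 : HeapStC n S (-1) (-1) {b} ch (cutProg.run (τ'.setVar 26 b)) _ :=
          HeapStC.of_exd_root (b := b) (by simpa using h3) (by rw [e16]; simp [hyb'.symm, hbr])
        obtain ⟨r, lvl, R, a1, a2, a3, a4, a5⟩ := h4
        refine ⟨r, lvl, R, a1, a2, a3, a4, a5.trans ?_⟩
        rw [e18, Function.update_self]
        simp only [Test.cost, Expr.cost, hτ', Store.setVar_arr,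
          Store.setVar_var, Nat.reduceEqDiff, reduceIte]
        push_cast
        omega
      · have e := run_unchanged cutProg rfl (τ'.setVar 26 b)
        rw [e.2 20 rfl, e.2 21 rfl, e.1 20 rfl, e.1 22 rfl]
        simpa [hτ'] using hl'
      · intro w hw hwp
        rw [e16] at hwp
        by_cases e : w = y
        · rw [e, Function.update_self] at hwp; exact absurd hwp.symm hb1
        · rw [Function.update_of_ne e] at hwp
          exact (List.mem_cons.1 (hkids w hw hwp)).resolve_left e
    · have hrun : childBody.run τ = τ' := by
        rw [← h14] at hc
        by_cases e : τ.arr 14 y = 1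
        · have e' : τ.arr 16 y ≠ b := fun hh => hc ⟨e, hh⟩
          simp [childBody, Program.block, Program.run, Expr.eval, ← hy, e, e', h27, hτ']
        · simp [childBody, Program.block, Program.run, Expr.eval, ← hy, e, hτ']
      rw [hrun]
      refine ⟨l', ?_, by simpa [hτ'] using hl', ?_⟩
      · obtain ⟨r, lvl, R, a1, a2, a3, a4, a5⟩ := h1.congr (τ := τ') (by simp [hτ'])
          (by simp [hτ']) (by simp [hτ'])
        refine ⟨r, lvl, R, a1, a2, a3, a4, a5.trans ?_⟩
        simp only [Test.cost, Expr.cost, List.length_cons, hτ', Store.setVar_arr]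
        push_cast
        omega
      · intro w hw hwp
        refine (List.mem_cons.1 (hkids w hw (by simpa [hτ'] using hwp))).resolve_left ?_
        rintro rfl
        exact hc ⟨hw, by simpa [hτ'] using hwp⟩
  · rintro τ d hU ⟨l, h1, hl, hkids⟩ hb'
    simp only [Test.holds_lt, Expr.eval] at hb'
    have h0 := hl.nonneg
    have he : τ.var 22 = 0 := by omega
    rw [he] at hl
    have hl' := hl.eq_nil
    subst hl'
    have h27 : τ.var 27 = b := (hU.1 27 rfl).trans (by simp [Program.run, ← hb])
    have h14 : ∀ y, τ.arr 14 y = 1 ↔ y ∈ S := by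
      rw [hU.2 14 rfl]; exact hst
    have hd0 : 0 ≤ τ.arr 18 b := by
      obtain ⟨r, lvl, R, h1, -⟩ := h1
      exact h1.deg_nonneg hbS
    have h2 := h1.erase fun y hy hyb => by simpa using hkids y hy hyb
    apply Wp.flat rfl
    simp only [Program.block, Program.run, Expr.eval, h27]
    refine ⟨⟨ch, ?_⟩, ?_⟩
    · obtain ⟨r, lvl, R, a1, a2, a3, a4, a5⟩ := h2.congr (τ := τ.setArr 14 b 0)
        (fun a h h' => by have : a ≠ 14 := by omega
                          simp [this]) (by simp) (by simp)
      refine ⟨r, lvl, R, a1, a2, a3, a4, a5.trans ?_⟩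
      simp only [Test.cost, Expr.cost, List.length_nil, Program.flatCost]
      push_cast
      omega
    · intro y
      simp only [Store.setArr_arr, if_true, Finset.mem_erase]
      by_cases e : y = b
      · simp [e]
      · simp [e, h14]
  · obtain ⟨r, lvl, R, h1, h2, h3, h4, h5⟩ := h
    refine ⟨ch b, ?_, ?_, ?_⟩
    · refine ⟨r, lvl, R, by simpa [Program.run] using h1, by simpa [Program.run] using h2, h3,
        by simpa [Program.run] using h4, ?_⟩
      have := hdeg b hbS
      simp [Program.run, Program.flatCost, Expr.cost]
      omega
    · simpa [Program.run, Expr.eval, ← hb] using h1.list b hbS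
    · intro y hy hyb
      simp only [Program.run, Store.setVar_arr] at hyb
      have := h1.mem y hy (by rw [hyb]; exact hb1)
      rwa [hyb] at this

/-- With `B = 3 * j` buckets, scanning costs `408 * B` and releasing children `300 * B`, together at
most `2200 * j`. -/
theorem extractMax_spec {n : ℤ} {j : ℕ} {S : Finset ℤ} {σ : Store} {c : ℤ}
    (h : HeapSt n S (-1) (-1) ∅ σ c) (hst : MemberArray S σ) (hA : ∀ d, σ.arr 23 d = 0)
    (hS : S.Nonempty) (h12 : σ.var 12 = 3 * j) (hj : n < 2 ^ j) :
    Wp extractMax (fun τ d => τ.var 27 ∈ S ∧ (∀ x ∈ S, σ.arr 15 x ≤ σ.arr 15 (τ.var 27)) ∧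
      HeapSt n (S.erase (τ.var 27)) (-1) (-1) ∅ τ d ∧ MemberArray (S.erase (τ.var 27)) τ ∧
      ∀ d, τ.arr 23 d = 0) σ (c + (2200 * j + 60)) := by
  have hdeg : ∀ {U τ d}, HeapSt n S (-1) (-1) U τ d → ∀ x ∈ S, τ.arr 18 x < 3 * j := by
    rintro U τ d ⟨ch, r, lvl, R, h1, -⟩ x hx
    exact h1.deg_lt hj hx
  apply Wp.seq
  refine (consolidate_spec h hA).frame ?_
  rintro τ d ⟨T, h1, h2, h3⟩ hU
  apply Wp.seq
  have h12' : τ.var 12 = 3 * j := (hU.1 12 rfl).trans h12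
  refine Wp.frame (scanBuckets_spec h1 h2 h3 h12' (hdeg h1) (by positivity) hS) ?_
  rintro τ' d' ⟨h4, h5, h6⟩ hU'
  have hst' : MemberArray S τ' := by
    unfold MemberArray
    rw [hU'.2 14 rfl, hU.2 14 rfl]
    exact hst
  refine Wp.frame (releaseChildren_spec h4 hst' (hdeg h4)) ?_
  rintro τ'' d'' ⟨h7, h8⟩ hU''
  have h27 : τ''.var 27 = τ'.var 27 := hU''.1 27 rfl
  have e15 : τ'.arr 15 = σ.arr 15 := (hU'.2 15 rfl).trans (hU.2 15 rfl)
  rw [h27]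
  refine ⟨(h4.root_of_mem (Finset.mem_singleton_self _)).1, ?_, h7.mono ?_, h8, ?_⟩
  · rw [← e15]; exact h5
  · omega
  · rw [hU''.2 23 rfl, h6]; simp

/-! ### Maximum adjacency orderings -/

/-- The weight between `A ∩ X` and `A \ X`. -/
def weightCut (W : ℤ → ℤ → ℤ) (X A : Finset ℤ) : ℤ :=
  ∑ a ∈ A with a ∈ X, ∑ b ∈ A with b ∉ X, W a b

theorem weightCut_insert {W : ℤ → ℤ → ℤ} (hsymm : ∀ a b, W a b = W b a) (X : Finset ℤ)
    {A : Finset ℤ} {y : ℤ} (hy : y ∉ A) :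
    weightCut W X (insert y A) =
      weightCut W X A + ∑ a ∈ A with ¬ (a ∈ X ↔ y ∈ X), W y a := by
  unfold weightCut
  by_cases hX : y ∈ X
  · rw [Finset.filter_insert, if_pos hX, Finset.filter_insert, if_neg (not_not.2 hX),
      Finset.sum_insert (by simp [hy])]
    simp only [hX, iff_true]
    ring
  · rw [Finset.filter_insert, if_neg hX, Finset.filter_insert, if_pos hX]
    simp only [hX, iff_false, not_not]
    rw [Finset.sum_congr rfl fun a _ => Finset.sum_insert (show y ∉ A.filter (· ∉ X) by simp [hy]),
      Finset.sum_add_distrib, add_comm]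
    congr 1
    exact Finset.sum_congr rfl fun a _ => hsymm a y

theorem weightCut_nonneg {W : ℤ → ℤ → ℤ} (hnn : ∀ a b, 0 ≤ W a b) (X A : Finset ℤ) :
    0 ≤ weightCut W X A :=
  Finset.sum_nonneg fun _ _ => Finset.sum_nonneg fun _ _ => hnn _ _

/-- The invariant of a maximum adjacency ordering of which `A` is an initial segment with last
element `y`. -/
def AdjacencyOrder (W : ℤ → ℤ → ℤ) (A S : Finset ℤ) (y : ℤ) : Prop :=
  ∀ X : Finset ℤ, ∀ z ∈ S, (z ∈ X ↔ y ∉ X) →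
    ∑ a ∈ A with (a ∈ X ↔ z ∈ X), W z a ≤ weightCut W X A

/-- If `y'` and `y` are on different sides of `X`, the weight from `y'` to its own side is at most
the old cut by the invariant, and the weight to the other side is what `y'` adds to the cut. A later
`z` opposite to `y'` sees on its side at most its whole weight to `A`, which is at most that of `y'`
by maximality. If `y'` and `y` are on the same side, then `z` is opposite to `y` already, and the
cut only grows. -/
theorem AdjacencyOrder.step {W : ℤ → ℤ → ℤ} (hsymm : ∀ a b, W a b = W b a)
    (hnn : ∀ a b, 0 ≤ W a b) {A S : Finset ℤ} {y y' : ℤ} (h : AdjacencyOrder W A S y)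
    (hy' : y' ∈ S) (hyA : y' ∉ A)
    (hmax : ∀ z ∈ S, ∑ a ∈ A, W z a ≤ ∑ a ∈ A, W y' a) :
    AdjacencyOrder W (insert y' A) (S.erase y') y' ∧
      ∀ X : Finset ℤ, (y' ∈ X ↔ y ∉ X) → ∑ a ∈ A, W y' a ≤ weightCut W X (insert y' A) := by
  have hcut : ∀ X : Finset ℤ, (y' ∈ X ↔ y ∉ X) →
      ∑ a ∈ A, W y' a ≤ weightCut W X (insert y' A) := by
    intro X hX
    rw [weightCut_insert hsymm X hyA,
      ← Finset.sum_filter_add_sum_filter_not A (fun a => (a ∈ X ↔ y' ∈ X))]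
    exact add_le_add_left (h X y' hy' hX) _
  refine ⟨?_, hcut⟩
  intro X z hz hzy
  rw [Finset.mem_erase] at hz
  rw [Finset.filter_insert, if_neg (by rw [hzy]; tauto)]
  by_cases hyy : y' ∈ X ↔ y ∉ X
  · refine le_trans ?_ (hcut X hyy)
    refine le_trans ?_ (hmax z hz.2)
    exact Finset.sum_le_sum_of_subset_of_nonneg (Finset.filter_subset _ _) fun _ _ _ => hnn _ _
  · rw [weightCut_insert hsymm X hyA]
    have h1 := h X z hz.2 (by tauto)
    have h2 : 0 ≤ ∑ a ∈ A with ¬ (a ∈ X ↔ y' ∈ X), W y' a :=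
      Finset.sum_nonneg fun _ _ => hnn _ _
    omega

/-! ### Half-edges and contraction

The half-edges `0, …, M - 1` have sources, targets and capacities; `rep` maps every vertex to the
representative of the class into which it has been contracted. -/

/-- The half-edges below `M` whose source has representative `y`. -/
def halfEdgesAt (rep src : ℤ → ℤ) : ℕ → ℤ → List ℤ
  | 0, _ => []
  | M + 1, y => if rep (src M) = y then (M : ℤ) :: halfEdgesAt rep src M y
      else halfEdgesAt rep src M y

/-- The capacity between the classes `a` and `b`. -/
def classWeight (rep src dst cc : ℤ → ℤ) (M : ℕ) (a b : ℤ) : ℤ :=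
  ∑ h ∈ Finset.range M, if rep (src h) = a ∧ rep (dst h) = b then cc h else 0

theorem sum_halfEdgesAt (rep src dst cc : ℤ → ℤ) (M : ℕ) (y z : ℤ) :
    ((halfEdgesAt rep src M y).map fun h => if rep (dst h) = z then cc h else 0).sum =
      classWeight rep src dst cc M y z := by
  induction M with
  | zero => simp [halfEdgesAt, classWeight]
  | succ M ih =>
    rw [classWeight, Finset.sum_range_succ, ← classWeight, ← ih, halfEdgesAt]
    split_ifs with h1 h2 h2 <;> simp_all
    omega

theorem sum_length_halfEdgesAt (rep src : ℤ → ℤ) (M : ℕ) (F : Finset ℤ) :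
    ∑ y ∈ F, ((halfEdgesAt rep src M y).length : ℤ) ≤ M := by
  induction M with
  | zero => simp [halfEdgesAt]
  | succ M ih =>
    have : ∀ y ∈ F, ((halfEdgesAt rep src (M + 1) y).length : ℤ) =
        (halfEdgesAt rep src M y).length + if rep (src M) = y then 1 else 0 := by
      intro y _
      rw [halfEdgesAt]
      split_ifs <;> simp
    rw [Finset.sum_congr rfl this, Finset.sum_add_distrib, Finset.sum_ite_eq]
    push_cast
    split_ifs <;> omega

theorem classWeight_nonneg {rep src dst cc : ℤ → ℤ} (hc : ∀ h, 0 ≤ cc h) (M : ℕ) (a b : ℤ) :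
    0 ≤ classWeight rep src dst cc M a b :=
  Finset.sum_nonneg fun h _ => by split_ifs; exacts [hc h, le_rfl]

/-- Class weights in terms of the capacities between vertices. -/
theorem classWeight_eq {rep src dst cc : ℤ → ℤ} {M : ℕ} {n : ℤ}
    (hs : ∀ h : ℕ, h < M → 0 ≤ src h ∧ src h ≤ n) (hd : ∀ h : ℕ, h < M → 0 ≤ dst h ∧ dst h ≤ n)
    (a b : ℤ) :
    classWeight rep src dst cc M a b = ∑ i ∈ Finset.Icc 0 n with rep i = a,
      ∑ j ∈ Finset.Icc 0 n with rep j = b, classWeight id src dst cc M i j := by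
  unfold classWeight
  simp only [id]
  rw [Finset.sum_congr rfl fun i _ => Finset.sum_comm, Finset.sum_comm]
  refine Finset.sum_congr rfl fun h hh => ?_
  rw [Finset.mem_range] at hh
  have e1 := hs h hh
  have e2 := hd h hh
  simp only [ite_and]
  simp only [Finset.sum_ite_eq, Finset.sum_ite_irrel, Finset.sum_const_zero]
  simp [e1, e2]

theorem classWeight_symm {rep src dst cc : ℤ → ℤ} {M : ℕ} {n : ℤ}
    (hs : ∀ h : ℕ, h < M → 0 ≤ src h ∧ src h ≤ n) (hd : ∀ h : ℕ, h < M → 0 ≤ dst h ∧ dst h ≤ n)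
    (hsymm : ∀ i j, classWeight id src dst cc M i j = classWeight id src dst cc M j i) (a b : ℤ) :
    classWeight rep src dst cc M a b = classWeight rep src dst cc M b a := by
  rw [classWeight_eq hs hd, classWeight_eq hs hd, Finset.sum_comm]
  exact Finset.sum_congr rfl fun _ _ => Finset.sum_congr rfl fun _ _ => hsymm _ _

/-! ### One phase of the minimum cut algorithm: preparation -/

/-- The representatives of the contracted classes. -/
noncomputable def classes (rep : ℤ → ℤ) (n : ℤ) : Finset ℤ := (Finset.Ico 0 n).filter fun v => rep v = v

theorem mem_classes {rep : ℤ → ℤ} {n v : ℤ} :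
    v ∈ classes rep n ↔ (0 ≤ v ∧ v < n) ∧ rep v = v := by
  simp [classes]

def phaseInitBody : Program := .block [
  .store 15 (.var 29) (.const 0),
  .store 16 (.var 29) (.const (-1)),
  .store 17 (.var 29) (.const 0),
  .store 18 (.var 29) (.const 0),
  .store 19 (.var 29) (.const 0),
  .store 24 (.var 29) (.const 0),
  .ite (.lt (.var 29) (.var 0))
    (.ite (.eq (.get 13 (.var 29)) (.var 29))
      (.block [.store 14 (.var 29) (.const 1), .store 22 (.var 19) (.var 29),
        .assign 19 (.add (.var 19) (.const 1))])
      .skip) .skip]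

/-- Makes a heap of all classes, with keys `0`. -/
def phaseInit : Program := .block [
  .assign 19 (.const 0),
  .assign 20 (.const 0),
  .assign 29 (.const 0),
  -- Two cells more than there are vertices in `V`: the list heads for `s`, at `n`, and for the
  -- class `n + 1` of a removed vertex are cleared as well.
  .assign 33 (.add (.var 0) (.const 2)),
  .forUp 29 33 phaseInitBody]

theorem phaseInit_spec {n : ℤ} {σ : Store} (hn : σ.var 0 = n) (hn0 : 0 ≤ n)
    (hst : MemberArray ∅ σ) :
    Wp phaseInit (fun τ d => HeapSt n (classes (σ.arr 13) n) (-1) (-1) ∅ τ d ∧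
      MemberArray (classes (σ.arr 13) n) τ ∧ (∀ z ∈ classes (σ.arr 13) n, τ.arr 15 z = 0) ∧
      ∀ y, 0 ≤ y → y < n + 2 → τ.arr 24 y = 0) σ (400 * n + 300) := by
  iterate 4
    apply Wp.seq
    apply Wp.flat rfl
  set C := classes (σ.arr 13) n with hC
  have hcost : (phaseInitBody.flatCost : ℤ) ≤ 80 := by decide
  refine Wp.frame (Wp.forFlat 0 (n + 2) (fun j τ => (∀ v, 0 ≤ v → v < j → τ.arr 15 v = 0 ∧
    τ.arr 16 v = -1 ∧ τ.arr 17 v = 0 ∧ τ.arr 18 v = 0 ∧ τ.arr 19 v = 0 ∧ τ.arr 24 v = 0) ∧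
    MemberArray (C.filter (· < j)) τ ∧ StackIs (τ.arr 22) (τ.var 19) (C.filter (· < j)))
    rfl rfl rfl rfl ?_ ?_ ?_ (by omega) ⟨?_, ?_, ?_⟩) ?_
  · rintro j τ hj0 hjN h29 - hU ⟨h1, h2, h3⟩
    have h13 : τ.arr 13 = σ.arr 13 := (hU.2 13 rfl).trans (by simp [Program.run])
    have h0 : τ.var 0 = n := (hU.1 0 rfl).trans (by simpa [Program.run])
    have hall : ∀ {f g : ℤ → ℤ} {a : ℤ}, g = Function.update f j a → (∀ v, 0 ≤ v → v < j → f v = a) →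
        ∀ v, 0 ≤ v → v < j + 1 → g v = a := by
      rintro f g a rfl hf v hv hv'
      rcases eq_or_ne v j with e | e
      · simp [e]
      · rw [Function.update_of_ne e]; exact hf v hv (by omega)
    have harr : ∀ v, 0 ≤ v → v < j + 1 → (phaseInitBody.run τ).arr 15 v = 0 ∧
        (phaseInitBody.run τ).arr 16 v = -1 ∧ (phaseInitBody.run τ).arr 17 v = 0 ∧
        (phaseInitBody.run τ).arr 18 v = 0 ∧ (phaseInitBody.run τ).arr 19 v = 0 ∧
        (phaseInitBody.run τ).arr 24 v = 0 := by
      have e : ∀ a b : ℕ, ∀ z : ℤ, (a, b, z) ∈ [(15, 0, (0 : ℤ)), (16, 0, -1), (17, 0, 0), (18, 0, 0),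
          (19, 0, 0), (24, 0, 0)] →
          (phaseInitBody.run τ).arr a = Function.update (τ.arr a) j z := by
        intro a b z hab
        simp only [List.mem_cons, Prod.mk.injEq, List.not_mem_nil, or_false] at hab
        by_cases e1 : j < n
        · by_cases e2 : σ.arr 13 j = j <;> rcases hab with h | h | h | h | h | h <;>
            obtain ⟨rfl, rfl, rfl⟩ := h <;>
            simp [phaseInitBody, Program.block, Program.run, Expr.eval, h29, h0, h13, e1, e2]
        · rcases hab with h | h | h | h | h | h <;> obtain ⟨rfl, rfl, rfl⟩ := h <;>
            simp [phaseInitBody, Program.block, Program.run, Expr.eval, h29, h0, e1]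
      intro v hv hv'
      exact ⟨hall (e 15 0 0 (by simp)) (fun v a b => (h1 v a b).1) v hv hv',
        hall (e 16 0 (-1) (by simp)) (fun v a b => (h1 v a b).2.1) v hv hv',
        hall (e 17 0 0 (by simp)) (fun v a b => (h1 v a b).2.2.1) v hv hv',
        hall (e 18 0 0 (by simp)) (fun v a b => (h1 v a b).2.2.2.1) v hv hv',
        hall (e 19 0 0 (by simp)) (fun v a b => (h1 v a b).2.2.2.2.1) v hv hv',
        hall (e 24 0 0 (by simp)) (fun v a b => (h1 v a b).2.2.2.2.2) v hv hv'⟩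
    refine ⟨by simpa using harr, ?_⟩
    by_cases hj : j < n ∧ σ.arr 13 j = j
    · have hset : C.filter (· < j + 1) = insert j (C.filter (· < j)) := by
        ext v
        simp only [Finset.mem_filter, Finset.mem_insert, hC, mem_classes]
        constructor
        · rintro ⟨h, h'⟩
          rcases eq_or_ne v j with e | e
          · exact Or.inl e
          · exact Or.inr ⟨h, by omega⟩
        · rintro (rfl | ⟨h, h'⟩)
          · exact ⟨⟨⟨hj0, hj.1⟩, hj.2⟩, by omega⟩
          · exact ⟨h, by omega⟩
      rw [hset]
      constructor
      · intro y
        have := h2 y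
        simp [phaseInitBody, Program.block, Program.run, Expr.eval, h29, h0, hj, h13]
        rcases eq_or_ne y j with e | e
        · simp [e]
        · simpa [e] using this
      · simpa [phaseInitBody, Program.block, Program.run, Expr.eval, h29, h0, hj, h13] using
          h3.push (y := j) (by simp)
    · have hset : C.filter (· < j + 1) = C.filter (· < j) := by
        ext v
        simp only [Finset.mem_filter, hC, mem_classes]
        constructor
        · rintro ⟨h, h'⟩
          rcases eq_or_ne v j with e | e
          · subst e; exact absurd ⟨h.1.2, h.2⟩ hj
          · exact ⟨h, by omega⟩
        · rintro ⟨h, h'⟩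
          exact ⟨h, by omega⟩
      rw [hset]
      have e1 : (phaseInitBody.run τ).arr 14 = τ.arr 14 ∧ (phaseInitBody.run τ).arr 22 = τ.arr 22 ∧
          (phaseInitBody.run τ).var 19 = τ.var 19 := by
        by_cases e : j < n
        · have e' : σ.arr 13 j ≠ j := fun h => hj ⟨e, h⟩
          simp [phaseInitBody, Program.block, Program.run, Expr.eval, h29, h0, e, h13, e']
        · simp [phaseInitBody, Program.block, Program.run, Expr.eval, h29, h0, e]
      constructor
      · intro y
        simp [e1.1, h2 y]
      · simpa [e1] using h3
  · simp [Program.run, Expr.eval]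
  · simp [Program.run, Expr.eval, hn]
  · intro v h1 h2; omega
  · intro y
    have h1 : C.filter (· < 0) = ∅ := by
      ext v; simp [hC, mem_classes]; omega
    rw [h1]
    exact hst y
  · have h1 : C.filter (· < 0) = ∅ := by
      ext v; simp [hC, mem_classes]; omega
    rw [h1]
    exact ⟨fun i h1 h2 => by simp [Program.run, Expr.eval] at h2; omega,
      fun i j h1 h2 => by simp [Program.run, Expr.eval] at h2; omega, by simp [Program.run, Expr.eval]⟩
  · rintro τ d ⟨⟨h1, h2, h3⟩, h4⟩ hU
    have hset : C.filter (· < n + 2) = C := by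
      refine Finset.filter_true_of_mem fun v hv => ?_
      rw [hC, mem_classes] at hv; omega
    rw [hset] at h2 h3
    have hr : ∀ v ∈ C, 0 ≤ v ∧ v < n := fun v hv => (mem_classes.1 hv).1
    have h5 : ∀ v ∈ C, _ := fun v hv => h1 v (hr v hv).1 (by have := hr v hv; omega)
    have h20 : τ.var 20 = 0 := (hU.1 20 rfl).trans (by simp [Program.run, Expr.eval])
    refine ⟨⟨fun _ => [], fun _ => 0, fun _ => 0, C, ⟨hr, ?_, ?_, ?_, ?_, ?_, ?_, ?_, ?_, ?_, ?_, ?_⟩,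
      h3, by simp, ?_, ?_⟩, h2, fun z hz => (h5 z hz).1,
      fun y hy hy' => (h1 y hy hy').2.2.2.2.2⟩
    · exact fun y hy hp => absurd (h5 y hy).2.1 hp
    · intro x hx
      rw [(h5 x hx).2.2.2.1, Finset.filter_false_of_mem]
      · simp
      · intro y hy e
        rw [(h5 y hy).2.1] at e
        have := hr x hx; omega
    · exact fun y hy => Or.inl (h5 y hy).2.2.1
    · exact fun y hy hp => absurd (h5 y hy).2.1 hp
    · exact fun y hy hp => absurd (h5 y hy).2.1 hp
    · intro x hx t ht
      rw [Finset.filter_false_of_mem]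
      · simp; omega
      · rintro y hy ⟨e, -⟩
        rw [(h5 y hy).2.1] at e
        have := hr x hx; omega
    · exact fun y hy hp => absurd (h5 y hy).2.1 hp
    · exact fun y hy hp => absurd (h5 y hy).2.1 hp
    · exact fun x hx => (h5 x hx).2.2.2.2.1
    · exact fun y hy hp => absurd (h5 y hy).2.1 hp
    · exact h20.ge
    · intro y
      simp only [Finset.notMem_empty, or_false]
      exact ⟨fun h => h.1, fun h => ⟨h, (h5 y h).2.1⟩⟩
    · have h6 : (C.card : ℤ) ≤ n := by
        have : C.card ≤ (Finset.Ico 0 n).card := Finset.card_filter_le _ _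
        rw [Int.card_Ico] at this
        omega
      have h7 : ∑ v ∈ C, τ.arr 17 v = 0 := Finset.sum_eq_zero fun v hv => (h5 v hv).2.2.1
      have h8 := h3.card
      simp [heapPot, h7, Program.flatCost, Expr.cost]
      nlinarith

/-- The cell of the half-edge `h` is `h + 1`, because 0 is the null pointer. Hence the item of a
cell is given by `(· - 1)` and needs no array. -/
def buildAdjBody : Program := .block [
  .assign 28 (.get 13 (.get 10 (.var 29))),
  .store 25 (.add (.var 29) (.const 1)) (.get 24 (.var 28)),
  .store 24 (.var 28) (.add (.var 29) (.const 1))]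

/-- Makes the lists of the half-edges leaving the classes. -/
def buildAdj : Program := .block [.assign 29 (.const 0), .forUp 29 10 buildAdjBody]

theorem buildAdj_spec {n : ℤ} {M : ℕ} {σ : Store} (hM : σ.var 10 = M)
    (h0 : ∀ y, 0 ≤ y → y < n + 2 → σ.arr 24 y = 0) :
    Wp buildAdj (fun τ d => 0 ≤ d ∧ ∀ y, 0 ≤ y → y < n + 2 →
      ListAt (τ.arr 25) (· - 1) M (τ.arr 24 y) (halfEdgesAt (σ.arr 13) (σ.arr 10) M y)) σ
      (60 * M + 20) := by
  apply Wp.seq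
  apply Wp.flat rfl
  have hcost : (buildAdjBody.flatCost : ℤ) ≤ 40 := by decide
  refine Wp.frame (Wp.forFlat 0 M (fun j τ => ∀ y, 0 ≤ y → y < n + 2 →
      ListAt (τ.arr 25) (· - 1) j (τ.arr 24 y) (halfEdgesAt (σ.arr 13) (σ.arr 10) j.toNat y))
      rfl rfl rfl rfl ?_ ?_ ?_ (by omega) ?_) ?_
  · rintro j τ hj0 hjN h29 - hU h1 y hy hy'
    have h13 : τ.arr 13 = σ.arr 13 := (hU.2 13 rfl).trans (by simp [Program.run])
    have h10 : τ.arr 10 = σ.arr 10 := (hU.2 10 rfl).trans (by simp [Program.run])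
    have hj : (j + 1).toNat = j.toNat + 1 := by omega
    have hj' : ((j.toNat : ℕ) : ℤ) = j := by omega
    have hlist : ∀ {e l a}, ListAt (τ.arr 25) (· - 1) j e l →
        ListAt (Function.update (τ.arr 25) (j + 1) a) (· - 1) (j + 1) e l := by
      intro e l a hl
      exact hl.congr (by omega) (fun e' he' => Function.update_of_ne (by omega) _ _)
        fun e' he' => rfl
    rw [hj, halfEdgesAt, hj']
    simp only [buildAdjBody, Program.block, Program.run, Expr.eval, h29, h13, h10, Store.setVar_arr,
      Store.setArr_arr, Store.setVar_var, Store.setArr_var, Nat.reduceEqDiff, reduceIte]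
    split_ifs with e
    · rw [e, Function.update_self]
      refine ⟨by omega, le_rfl, add_sub_cancel_right j 1, ?_⟩
      rw [Function.update_self]
      exact hlist (h1 y hy hy')
    · rw [Function.update_of_ne (Ne.symm e)]
      exact hlist (h1 y hy hy')
  · simp [Program.run, Expr.eval]
  · simpa [Program.run, Expr.eval] using hM
  · intro y hy hy'
    simpa [Program.run, halfEdgesAt, ListAt] using h0 y hy hy'
  · rintro τ d ⟨h1, h2⟩ -
    refine ⟨?_, by simpa using h1⟩
    simp only [Program.flatCost, Expr.cost]
    push_cast
    nlinarith

/-! ### One phase of the minimum cut algorithm: the ordering -/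

/-- The membership test discards half-edges to classes already ordered, among them `s` and the
scanned class itself, and to a removed vertex. -/
def scanBody : Program := .block [
  .assign 23 (.get 13 (.get 11 (.sub (.var 22) (.const 1)))),
  .assign 24 (.get 12 (.sub (.var 22) (.const 1))),
  .assign 22 (.get 25 (.var 22)),
  .ite (.eq (.get 14 (.var 23)) (.const 1)) incKey .skip]

/-- Adds the capacities of the half-edges leaving the class in register `16` to the keys. -/
def scanClass : Program := .block [
  .assign 22 (.get 24 (.var 16)),
  .loop (.lt (.const 0) (.var 22)) scanBody]

/-- Each half-edge is charged 1000: 900 for a possible `incKey` and the rest for traversing the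
list. -/
theorem scanClass_spec {n M : ℤ} {S : Finset ℤ} {σ : Store} {c : ℤ} {l : List ℤ}
    (h : HeapSt n S (-1) (-1) ∅ σ c) (hst : MemberArray S σ) (hc : ∀ h, 0 ≤ σ.arr 12 h)
    (hl : ListAt (σ.arr 25) (· - 1) M (σ.arr 24 (σ.var 16)) l) :
    Wp scanClass (fun τ d => HeapSt n S (-1) (-1) ∅ τ d ∧ ∀ z ∈ S, τ.arr 15 z = σ.arr 15 z +
      (l.map fun h => if σ.arr 13 (σ.arr 11 h) = z then σ.arr 12 h else 0).sum) σ
      (c + 1000 * l.length + 20) := by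
  apply Wp.seq
  apply Wp.flat rfl
  refine Wp.loop (fun τ d => ∃ l', HeapSt n S (-1) (-1) ∅ τ (d - 1000 * (l'.length : ℤ) - 10) ∧
    ListAt (σ.arr 25) (· - 1) M (τ.var 22) l' ∧
    ∀ z ∈ S, τ.arr 15 z +
      (l'.map fun h => if σ.arr 13 (σ.arr 11 h) = z then σ.arr 12 h else 0).sum = σ.arr 15 z +
      (l.map fun h => if σ.arr 13 (σ.arr 11 h) = z then σ.arr 12 h else 0).sum) ?_ ?_ ?_ ?_
  · rintro τ d ⟨l', h1, -⟩
    have := h1.nonneg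
    have : (0 : ℤ) ≤ l'.length := by positivity
    omega
  · rintro τ d hU ⟨l', h1, h2, h3⟩ hb
    simp only [Test.holds_lt, Expr.eval] at hb
    obtain ⟨l'', rfl, h4⟩ := h2.eq_cons (by omega)
    have hr : ∀ a, a < 15 ∨ 22 < a → scanBody.writesArr a = false → τ.arr a = σ.arr a :=
      fun a _ ha => (hU.2 a ha).trans (by simp [Program.run])
    have h11 := hr 11 (by omega) rfl
    have h12 := hr 12 (by omega) rfl
    have h13 := hr 13 (by omega) rfl
    have h14 := hr 14 (by omega) rfl
    have h25 := hr 25 (by omega) rfl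
    set e := τ.var 22 with he
    set z := σ.arr 13 (σ.arr 11 (e - 1)) with hz
    set τ' := ((τ.setVar 23 z).setVar 24 (σ.arr 12 (e - 1))).setVar 22 (σ.arr 25 e) with hτ'
    have hrun : (Program.assign 22 (Expr.get 25 (Expr.var 22))).run
        ((Program.assign 24 (Expr.get 12 (Expr.sub (Expr.var 22) (Expr.const 1)))).run
        ((Program.assign 23 (Expr.get 13 (Expr.get 11 (Expr.sub (Expr.var 22)
          (Expr.const 1))))).run τ)) = τ' := by
      simp [Program.run, Expr.eval, h11, h12, h13, h25, ← he, hτ', hz]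
    iterate 3
      apply Wp.seq
      apply Wp.flat rfl
    rw [hrun]
    have h5 : HeapSt n S (-1) (-1) ∅ τ' (d - 1000 * (((e - 1) :: l'').length : ℤ) - 10) :=
      h1.congr (by simp [hτ']) (by simp [hτ']) (by simp [hτ'])
    simp only [Test.cost, Expr.cost, Program.flatCost]
    simp only [List.length_cons] at h5
    apply Wp.ite
    · intro hin
      have hzS : z ∈ S := by
        rw [← hst z, ← h14]
        simpa [Expr.eval, hτ'] using hin
      refine Wp.frame (incKey_spec h5 (by simpa [hτ'] using hzS) (by simpa [hτ'] using hc _)) ?_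
      rintro ρ d' ⟨h6, h7⟩ hU'
      have h22 : ρ.var 22 = σ.arr 25 e := (hU'.1 22 rfl).trans (by simp [hτ'])
      refine ⟨l'', h6.mono ?_, by rw [h22]; exact h4, ?_⟩
      · simp only [Test.cost, Expr.cost]
        push_cast
        omega
      · intro w hw
        rw [← h3 w hw, h7]
        simp only [hτ', Store.setVar_var, Store.setVar_arr, List.map_cons, List.sum_cons,
          Nat.reduceEqDiff, reduceIte, ← hz]
        by_cases ew : w = z
        · rw [ew, Function.update_self, if_pos rfl]; ring
        · rw [Function.update_of_ne ew, if_neg (Ne.symm ew)]; ring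
    · intro hin
      have hzS : z ∉ S := by
        rw [← hst z, ← h14]
        simpa [Expr.eval, hτ'] using hin
      apply Wp.flat rfl
      refine ⟨l'', HeapSt.mono (c := d - 1000 * ((l''.length + 1 : ℕ) : ℤ) - 10) ?_ ?_, ?_, ?_⟩
      · exact h5
      · simp only [Test.cost, Expr.cost, Program.flatCost]
        push_cast
        omega
      · simpa [Program.run, hτ'] using h4
      · intro w hw
        have ew : z ≠ w := fun e => hzS (e ▸ hw)
        rw [← h3 w hw]
        simp [Program.run, hτ', ← hz, ew]
  · rintro τ d hU ⟨l', h1, h2, h3⟩ hb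
    simp only [Test.holds_lt, Expr.eval] at hb
    have h0 := h2.nonneg
    have he : τ.var 22 = 0 := by omega
    rw [he] at h2
    have := h2.eq_nil
    subst this
    refine ⟨h1.mono ?_, fun z hz => by simpa using h3 z hz⟩
    simp only [Test.cost, Expr.cost, List.length_nil]
    push_cast
    omega
  · refine ⟨l, HeapSt.congr (h.mono ?_) (by simp [Program.run]) (by simp [Program.run])
      (by simp [Program.run]), by simpa [Program.run, Expr.eval] using hl,
      fun z hz => by simp [Program.run]⟩
    simp only [Program.flatCost, Expr.cost]
    push_cast
    omega

def orderBody : Program := .block [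
  scanClass,
  .assign 17 (.var 16),
  extractMax,
  .assign 16 (.var 27),
  .assign 18 (.sub (.var 18) (.const 1))]

/-- Orders the classes; registers `17` and `16` receive the last two. -/
def orderClasses : Program := .block [
  .assign 16 (.var 0),
  .assign 18 (.var 15),
  .loop (.lt (.const 0) (.var 18)) orderBody]

/-- What a phase needs to know about the half-edges and their contraction. -/
structure PhaseInput (n : ℤ) (M j : ℕ) (rep : ℤ → ℤ) (σ : Store) : Prop where
  n_eq : σ.var 0 = n
  M_eq : σ.var 10 = M
  log_eq : σ.var 12 = 3 * j
  cnt_eq : σ.var 15 = (classes rep n).card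
  rep_eq : σ.arr 13 = rep
  n_nonneg : 0 ≤ n
  lt_pow : n < 2 ^ j
  src_mem : ∀ h : ℕ, h < M → 0 ≤ σ.arr 10 h ∧ σ.arr 10 h ≤ n
  dst_mem : ∀ h : ℕ, h < M → 0 ≤ σ.arr 11 h ∧ σ.arr 11 h ≤ n
  cap_nonneg : ∀ h, 0 ≤ σ.arr 12 h
  symm : ∀ i j, classWeight id (σ.arr 10) (σ.arr 11) (σ.arr 12) M i j =
    classWeight id (σ.arr 10) (σ.arr 11) (σ.arr 12) M j i

/-- The ordering starts at `s`, so that with at least two classes the last two elements both lie in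
`V`. The key with which the last class leaves the heap is the capacity of the cut around it, and is
a lower bound for all cuts separating the last two. Each class is scanned at most once, so scanning
costs `1000 * M` altogether. -/
theorem orderClasses_spec {n : ℤ} {M j : ℕ} {rep : ℤ → ℤ} {σ : Store} {c : ℤ}
    (hin : PhaseInput n M j rep σ)
    (h : HeapSt n (classes rep n) (-1) (-1) ∅ σ c) (hst : MemberArray (classes rep n) σ)
    (hkey : ∀ z ∈ classes rep n, σ.arr 15 z = 0) (hA : ∀ d, σ.arr 23 d = 0)
    (hl : ∀ y, 0 ≤ y → y < n + 2 →
      ListAt (σ.arr 25) (· - 1) M (σ.arr 24 y) (halfEdgesAt rep (σ.arr 10) M y))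
    (h2 : 2 ≤ (classes rep n).card) :
    Wp orderClasses (fun τ d => 0 ≤ d ∧ MemberArray ∅ τ ∧ (∀ d, τ.arr 23 d = 0) ∧
      τ.var 16 ∈ classes rep n ∧ τ.var 17 ∈ classes rep n ∧ τ.var 16 ≠ τ.var 17 ∧
      τ.arr 15 (τ.var 16) = ∑ a ∈ (insert n (classes rep n)).erase (τ.var 16),
        classWeight rep (σ.arr 10) (σ.arr 11) (σ.arr 12) M (τ.var 16) a ∧
      ∀ X : Finset ℤ, (τ.var 16 ∈ X ↔ τ.var 17 ∉ X) → τ.arr 15 (τ.var 16) ≤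
        weightCut (classWeight rep (σ.arr 10) (σ.arr 11) (σ.arr 12) M) X
          (insert n (classes rep n))) σ
      (c + 1000 * M + (2200 * j + 200) * (classes rep n).card + 20) := by
  set C := classes rep n with hC
  set W := classWeight rep (σ.arr 10) (σ.arr 11) (σ.arr 12) M with hW
  have hCn : ∀ v ∈ C, 0 ≤ v ∧ v < n := fun v hv => (mem_classes.1 hv).1
  have hnC : n ∉ C := fun hh => by have := hCn n hh; omega
  have hsymm : ∀ a b, W a b = W b a := classWeight_symm hin.src_mem hin.dst_mem hin.symm
  have hnn : ∀ a b, 0 ≤ W a b := classWeight_nonneg hin.cap_nonneg M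
  apply Wp.seq
  apply Wp.flat rfl
  apply Wp.seq
  apply Wp.flat rfl
  -- `A` is ordered, `S` is in the heap. The newest element, in register `16`, is not scanned yet:
  -- therefore its half-edges are still to be paid, and keys count only `A.erase (τ.var 16)`.
  refine Wp.loop (fun τ d => ∃ A S, A ∪ S = insert n C ∧ Disjoint A S ∧ n ∈ A ∧ τ.var 16 ∈ A ∧
    τ.var 18 = S.card ∧ S ⊆ C ∧
    HeapSt n S (-1) (-1) ∅ τ (d - 1000 * ∑ y ∈ insert (τ.var 16) S,
      ((halfEdgesAt rep (σ.arr 10) M y).length : ℤ) - (2200 * j + 200) * S.card - 10) ∧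
    MemberArray S τ ∧ (∀ d, τ.arr 23 d = 0) ∧
    (∀ z ∈ S, τ.arr 15 z = ∑ a ∈ A.erase (τ.var 16), W z a) ∧
    AdjacencyOrder W A S (τ.var 16) ∧
    -- Either nothing but `s` is ordered, or there is a predecessor in register `17`. It may be `s`
    -- only right after the first extraction, when `S.card + 1 = C.card`; at the end this is
    -- excluded by `h2`.
    (A = {n} ∧ τ.var 16 = n ∨ τ.var 16 ∈ C ∧ τ.var 17 ∈ A ∧ τ.var 17 ≠ τ.var 16 ∧
      (τ.var 17 ∈ C ∨ S.card + 1 = C.card) ∧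
      τ.arr 15 (τ.var 16) = ∑ a ∈ A.erase (τ.var 16), W (τ.var 16) a ∧
      ∀ X : Finset ℤ, (τ.var 16 ∈ X ↔ τ.var 17 ∉ X) →
        τ.arr 15 (τ.var 16) ≤ weightCut W X A)) ?_ ?_ ?_ ?_
  · rintro τ d ⟨A, S, -, -, -, -, -, -, hheap, -⟩
    have := hheap.nonneg
    have : (0 : ℤ) ≤ ∑ y ∈ insert (τ.var 16) S, ((halfEdgesAt rep (σ.arr 10) M y).length : ℤ) :=
      Finset.sum_nonneg fun _ _ => by positivity
    have : (0 : ℤ) ≤ (2200 * j + 200) * S.card := by positivity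
    omega
  · rintro τ d hU ⟨A, S, hAS, hdis, hnA, h16, h18, hSC, hheap, hmem, hA0, hkeys, hord, hlast⟩ hb
    simp only [Test.holds_lt, Expr.eval, h18] at hb
    have hr : ∀ a, orderBody.writesArr a = false → τ.arr a = σ.arr a :=
      fun a ha => (hU.2 a ha).trans (by simp [Program.run])
    have hSne : S.Nonempty := Finset.card_pos.1 (by omega)
    have hAC : ∀ a ∈ A, a = n ∨ a ∈ C := fun a ha =>
      Finset.mem_insert.1 (hAS ▸ Finset.mem_union_left S ha)
    set y := τ.var 16 with hy
    have hyS : y ∉ S := Finset.disjoint_left.1 hdis h16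
    have hyr : 0 ≤ y ∧ y < n + 2 := by
      have := hin.n_nonneg
      rcases hAC y h16 with e | e
      · omega
      · have := hCn y e; omega
    rw [Finset.sum_insert hyS] at hheap
    apply Wp.seq
    refine Wp.frame (scanClass_spec (M := M) (l := halfEdgesAt rep (σ.arr 10) M y) hheap hmem
      (by rw [hr 12 rfl]; exact hin.cap_nonneg)
      (by rw [hr 25 rfl, hr 24 rfl]; exact hl y hyr.1 hyr.2)) ?_
    rintro ρ d1 ⟨h1, h3⟩ hU1
    simp only [hr 11 rfl, hr 12 rfl, hr 13 rfl, hin.rep_eq, sum_halfEdgesAt] at h3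
    have hkey1 : ∀ z ∈ S, ρ.arr 15 z = ∑ a ∈ A, W z a := by
      intro z hz
      rw [h3 z hz, hkeys z hz, ← hW, hsymm y z, Finset.sum_erase_add _ _ h16]
    apply Wp.seq
    apply Wp.flat rfl
    have h16' : ρ.var 16 = y := hU1.1 16 rfl
    have h18' : ρ.var 18 = S.card := (hU1.1 18 rfl).trans h18
    have hrun : (Program.assign 17 (Expr.var 16)).run ρ = ρ.setVar 17 y := by
      simp [Program.run, Expr.eval, h16']
    rw [hrun]
    apply Wp.seq
    refine Wp.frame (extractMax_spec (j := j)
      (h1.congr (τ := ρ.setVar 17 y) (by simp) (by simp) (by simp)) ?_ ?_ hSne ?_ hin.lt_pow) ?_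
    · intro w
      rw [Store.setVar_arr, hU1.2 14 rfl]; exact hmem w
    · rw [Store.setVar_arr, hU1.2 23 rfl]; exact hA0
    · have e1 : τ.var 12 = σ.var 12 := (hU.1 12 rfl).trans (by simp [Program.run])
      simp only [Store.setVar_var, Nat.reduceEqDiff, reduceIte]
      rw [hU1.1 12 rfl, e1]; exact hin.log_eq
    rintro ρ2 d2 ⟨hbS, hbmax, h4, h5, h6⟩ hU2
    set b := ρ2.var 27 with hb27
    have hbA : b ∉ A := Finset.disjoint_right.1 hdis hbS
    have hk2 : ρ2.arr 15 = ρ.arr 15 := hU2.2 15 rfl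
    have h17 : ρ2.var 17 = y := (hU2.1 17 rfl).trans (by simp)
    have h18'' : ρ2.var 18 = S.card := (hU2.1 18 rfl).trans (by simpa using h18')
    apply Wp.seq
    apply Wp.flat rfl
    apply Wp.flat rfl
    have hrun2 : (Program.block [Program.assign 18 (Expr.sub (Expr.var 18) (Expr.const 1))]).run
        ((Program.assign 16 (Expr.var 27)).run ρ2) =
        (ρ2.setVar 16 b).setVar 18 (S.card - 1) := by
      simp [Program.block, Program.run, Expr.eval, ← hb27, h18'']
    rw [hrun2]
    have hcard : ((S.erase b).card : ℤ) = S.card - 1 := by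
      have := Finset.card_pos.2 hSne
      rw [Finset.card_erase_of_mem hbS]; omega
    obtain ⟨hord', hcut⟩ := hord.step hsymm hnn hbS hbA fun z hz => by
      rw [← hkey1 z hz, ← hkey1 b hbS]
      simpa using hbmax z hz
    refine ⟨insert b A, S.erase b, ?_, ?_, Finset.mem_insert_of_mem hnA, by simp, by simp [hcard],
      (Finset.erase_subset _ _).trans hSC, ?_, fun w => by simpa using h5 w, by simpa using h6,
      ?_, by simpa using hord', Or.inr ?_⟩
    · rw [← hAS]
      ext w
      simp only [Finset.mem_union, Finset.mem_insert, Finset.mem_erase]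
      rcases eq_or_ne w b with e | e
      · simp [e, hbS]
      · simp [e]
    · rw [Finset.disjoint_left]
      intro w hw hw'
      rw [Finset.mem_erase] at hw'
      rcases Finset.mem_insert.1 hw with e | e
      · exact hw'.1 e
      · exact Finset.disjoint_left.1 hdis e hw'.2
    · refine HeapSt.congr (h4.mono ?_) (by simp) (by simp) (by simp)
      have e1 : ((ρ2.setVar 16 b).setVar 18 (S.card - 1)).var 16 = b := by simp
      have e2 : ((2200 * j + 200 : ℤ)) * S.card =
        (2200 * j + 200) * ((S.erase b).card : ℤ) + (2200 * j + 200) := by rw [hcard]; ring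
      rw [e1, Finset.insert_erase hbS]
      simp only [Test.cost, Expr.cost, Program.flatCost, Program.block]
      push_cast
      omega
    · intro z hz
      rw [Finset.mem_erase] at hz
      simp only [Store.setVar_var, Store.setVar_arr, Nat.reduceEqDiff, reduceIte]
      rw [Finset.erase_insert hbA, hk2]
      exact hkey1 z hz.2
    · have e16 : ((ρ2.setVar 16 b).setVar 18 (S.card - 1)).var 16 = b := by simp
      have e17 : ((ρ2.setVar 16 b).setVar 18 (S.card - 1)).var 17 = y := by simp [h17]
      have e15 : ((ρ2.setVar 16 b).setVar 18 (S.card - 1)).arr 15 = ρ.arr 15 := by simp [hk2]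
      rw [e16, e17, e15, Finset.erase_insert hbA]
      refine ⟨hSC hbS, Finset.mem_insert_of_mem h16, fun e => hyS (e ▸ hbS), ?_, hkey1 b hbS, ?_⟩
      · rcases hlast with ⟨h7, h8⟩ | h7
        · right
          have : S = C := by
            rw [h7] at hAS hdis
            ext w
            constructor
            · exact fun hw => hSC hw
            · intro hw
              have : w ∈ ({n} : Finset ℤ) ∪ S := hAS ▸ Finset.mem_insert_of_mem hw
              rcases Finset.mem_union.1 this with e | e
              · rw [Finset.mem_singleton] at e; exact absurd (e ▸ hw) hnC
              · exact e
          rw [← this]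
          omega
        · exact Or.inl h7.1
      · intro X hX
        rw [hkey1 b hbS]
        exact hcut X hX
  · rintro τ d hU ⟨A, S, hAS, hdis, hnA, h16, h18, hSC, hheap, hmem, hA0, hkeys, hord, hlast⟩ hb
    simp only [Test.holds_lt, Expr.eval, h18] at hb
    have hS : S = ∅ := Finset.card_eq_zero.1 (by omega)
    subst hS
    rw [Finset.union_empty] at hAS
    subst hAS
    have hd : 0 ≤ d - 10 := by
      have := hheap.nonneg
      have : (0 : ℤ) ≤ ∑ y ∈ insert (τ.var 16) (∅ : Finset ℤ),
          ((halfEdgesAt rep (σ.arr 10) M y).length : ℤ) :=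
        Finset.sum_nonneg fun _ _ => by positivity
      have e : (2200 * j + 200 : ℤ) * (∅ : Finset ℤ).card = 0 := by simp
      omega
    rcases hlast with ⟨h7, -⟩ | ⟨h7, h8, h9, h10, h11, h12⟩
    · obtain ⟨v, hv⟩ := Finset.card_pos.1 (show 0 < C.card by omega)
      have : v ∈ ({n} : Finset ℤ) := h7 ▸ Finset.mem_insert_of_mem hv
      rw [Finset.mem_singleton] at this
      exact absurd (this ▸ hv) hnC
    · refine ⟨?_, hmem, hA0, h7, h10.resolve_right ?_, h9.symm, h11, h12⟩
      · simp only [Test.cost, Expr.cost]; push_cast; omega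
      · rw [Finset.card_empty]; omega
  · have h16 : ((Program.assign 18 (Expr.var 15)).run
        ((Program.assign 16 (Expr.var 0)).run σ)).var 16 = n := by
      simp [Program.run, Expr.eval, hin.n_eq]
    rw [h16]
    refine ⟨{n}, C, rfl, by simpa using hnC, by simp, by simp, ?_, subset_rfl, ?_,
      fun w => by simpa [Program.run] using hst w, by simpa [Program.run] using hA, ?_, ?_,
      Or.inl ⟨rfl, rfl⟩⟩
    · simp [Program.run, Expr.eval, hin.cnt_eq, hC]
    · refine HeapSt.congr (h.mono ?_) (by simp [Program.run]) (by simp [Program.run])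
        (by simp [Program.run])
      have := sum_length_halfEdgesAt rep (σ.arr 10) M (insert n C)
      simp only [Expr.cost, Program.flatCost]
      push_cast
      omega
    · intro z hz
      simpa [Program.run] using hkey z hz
    · intro X z hz hzn
      -- Initially `A` consists of `s` alone, which is on the side opposite to `z`, so the sum is
      -- empty.
      refine le_trans (le_of_eq ?_) (weightCut_nonneg hnn X {n})
      rw [Finset.filter_singleton, if_neg (by tauto), Finset.sum_empty]

/-! ### Cuts and contraction -/

/-- The capacity of the cut between `X` and the other vertices, after the removal of `w`. -/
noncomputable def cutValue (bw : ℤ → ℤ → ℤ) (n w : ℤ) (X : Finset ℤ) : ℤ :=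
  ∑ i ∈ X, ∑ j ∈ (Finset.Icc 0 n).erase w \ X, bw i j

/-- `rep` describes a partition of the vertices other than `s` (which is `n`) and the removed
vertex `w` (no vertex is removed if `w` is negative). -/
structure RepOK (n w : ℤ) (rep : ℤ → ℤ) : Prop where
  rep_n : rep n = n
  rep_mem : ∀ j, 0 ≤ j → j < n → j ≠ w → rep j ∈ classes rep n
  rep_wall : 0 ≤ w → rep w = n + 1
  wall_lt : w < n

/-- A cut of the contracted graph is the cut of the preimages of its sides. A removed vertex has the
representative `n + 1`, which is not among the classes, and drops out of both sides. -/
theorem weightCut_classes {n w : ℤ} {rep src dst cc : ℤ → ℤ} {M : ℕ} (hr : RepOK n w rep)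
    (hn : 0 ≤ n)
    (hs : ∀ h : ℕ, h < M → 0 ≤ src h ∧ src h ≤ n) (hd : ∀ h : ℕ, h < M → 0 ≤ dst h ∧ dst h ≤ n)
    {X : Finset ℤ} (hX : n ∉ X) :
    weightCut (classWeight rep src dst cc M) X (insert n (classes rep n)) =
      cutValue (classWeight id src dst cc M) n w
        (((Finset.Ico 0 n).erase w).filter (rep · ∈ X)) := by
  have hCn : ∀ v ∈ classes rep n, 0 ≤ v ∧ v < n := fun v hv => (mem_classes.1 hv).1
  have hmem : ∀ i, 0 ≤ i → i ≤ n → (rep i ∈ insert n (classes rep n) ↔ i ≠ w) := by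
    intro i h0 hin
    constructor
    · rintro h rfl
      rw [hr.rep_wall h0] at h
      rcases Finset.mem_insert.1 h with e | e
      · omega
      · have := hCn _ e; omega
    · intro hw
      rcases eq_or_ne i n with e | e
      · rw [e, hr.rep_n]; exact Finset.mem_insert_self _ _
      · exact Finset.mem_insert_of_mem (hr.rep_mem i h0 (by omega) hw)
  unfold weightCut cutValue
  set C' := insert n (classes rep n)
  have h1 : ∀ a, ∑ b ∈ C' with b ∉ X, classWeight rep src dst cc M a b =
      ∑ i ∈ Finset.Icc 0 n with rep i = a, ∑ j ∈ Finset.Icc 0 n with rep j ∈ C'.filter (· ∉ X),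
        classWeight id src dst cc M i j := by
    intro a
    rw [Finset.sum_congr rfl fun b _ => classWeight_eq hs hd a b, Finset.sum_comm]
    refine Finset.sum_congr rfl fun i _ => ?_
    rw [Finset.sum_fiberwise_eq_sum_filter]
  rw [Finset.sum_congr rfl fun a _ => h1 a, Finset.sum_fiberwise_eq_sum_filter]
  refine Finset.sum_congr ?_ fun i _ => Finset.sum_congr ?_ fun _ _ => rfl
  · ext i
    simp only [Finset.mem_filter, Finset.mem_Icc, Finset.mem_erase, Finset.mem_Ico]
    constructor
    · rintro ⟨⟨h2, h3⟩, h4, h5⟩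
      refine ⟨⟨(hmem i h2 h3).1 h4, h2, lt_of_le_of_ne h3 ?_⟩, h5⟩
      rintro rfl
      exact hX (hr.rep_n ▸ h5)
    · rintro ⟨⟨h2, h3, h4⟩, h5⟩
      exact ⟨⟨h3, h4.le⟩, (hmem i h3 h4.le).2 h2, h5⟩
  · ext i
    simp only [Finset.mem_filter, Finset.mem_Icc, Finset.mem_erase, Finset.mem_Ico,
      Finset.mem_sdiff]
    constructor
    · rintro ⟨⟨h2, h3⟩, h4, h5⟩
      exact ⟨⟨(hmem i h2 h3).1 h4, h2, h3⟩, fun h => h5 h.2⟩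
    · rintro ⟨⟨h2, h3, h4⟩, h5⟩
      refine ⟨⟨h3, h4⟩, (hmem i h3 h4).2 h2, fun h => ?_⟩
      rcases eq_or_ne i n with e | e
      · rw [e, hr.rep_n] at h; exact hX h
      · exact h5 ⟨⟨h2, h3, by omega⟩, h⟩

theorem weightCut_singleton (W : ℤ → ℤ → ℤ) {y : ℤ} {A : Finset ℤ} (hy : y ∈ A) :
    weightCut W {y} A = ∑ a ∈ A.erase y, W y a := by
  unfold weightCut
  have h1 : A.filter (· ∈ ({y} : Finset ℤ)) = {y} := by
    ext a; simp only [Finset.mem_filter, Finset.mem_singleton]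
    exact ⟨fun h => h.2, fun h => ⟨h ▸ hy, h⟩⟩
  have h2 : A.filter (· ∉ ({y} : Finset ℤ)) = A.erase y := by
    ext a; simp only [Finset.mem_filter, Finset.mem_singleton, Finset.mem_erase]; tauto
  rw [h1, h2, Finset.sum_singleton]

/-- The vertices other than `s` and `w`. -/
noncomputable def others (n w : ℤ) : Finset ℤ := (Finset.Ico 0 n).erase w

theorem mem_others {n w i : ℤ} : i ∈ others n w ↔ i ≠ w ∧ 0 ≤ i ∧ i < n := by
  simp [others]

/-- `X` separates two vertices with the same representative. -/
def Splits (n w : ℤ) (rep : ℤ → ℤ) (X : Finset ℤ) : Prop :=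
  ∃ i ∈ others n w, ∃ j ∈ others n w, rep i = rep j ∧ i ∈ X ∧ j ∉ X

/-- A set that splits no class contains a vertex exactly if it contains its representative, so it is
the preimage of a set of classes. -/
theorem cutValue_of_not_splits {n w : ℤ} {rep src dst cc : ℤ → ℤ} {M : ℕ} (hr : RepOK n w rep)
    (hn : 0 ≤ n)
    (hs : ∀ h : ℕ, h < M → 0 ≤ src h ∧ src h ≤ n) (hd : ∀ h : ℕ, h < M → 0 ≤ dst h ∧ dst h ≤ n)
    {X : Finset ℤ} (hX : X ⊆ others n w) (hsp : ¬ Splits n w rep X) :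
    cutValue (classWeight id src dst cc M) n w X =
      weightCut (classWeight rep src dst cc M) X (insert n (classes rep n)) := by
  rw [weightCut_classes hr hn hs hd fun h => by have := mem_others.1 (hX h); omega]
  congr 1
  ext i
  simp only [Finset.mem_filter]
  have hrep : ∀ i ∈ others n w, rep i ∈ others n w ∧ rep (rep i) = rep i := by
    intro i hi
    rw [mem_others] at hi
    have h1 := mem_classes.1 (hr.rep_mem i hi.2.1 hi.2.2 hi.1)
    refine ⟨mem_others.2 ⟨?_, h1.1⟩, h1.2⟩
    intro e
    have h2 := hr.rep_wall (e ▸ h1.1.1)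
    have h3 := h1.2
    rw [e, h2] at h3
    omega
  constructor
  · intro hi
    obtain ⟨h1, h2⟩ := hrep i (hX hi)
    refine ⟨hX hi, ?_⟩
    by_contra h
    exact hsp ⟨i, hX hi, rep i, h1, h2.symm, hi, h⟩
  · rintro ⟨hi, h⟩
    obtain ⟨h1, h2⟩ := hrep i hi
    by_contra h'
    exact hsp ⟨rep i, h1, i, hi, h2, h, h'⟩

theorem RepOK.merge {n w y p : ℤ} {rep : ℤ → ℤ} (hr : RepOK n w rep) (hy : y ∈ classes rep n)
    (hp : p ∈ classes rep n) (hyp : y ≠ p) :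
    RepOK n w (fun x => if (0 ≤ x ∧ x < n) ∧ rep x = y then p else rep x) ∧
      classes (fun x => if (0 ≤ x ∧ x < n) ∧ rep x = y then p else rep x) n =
        (classes rep n).erase y := by
  have hc : classes (fun x => if (0 ≤ x ∧ x < n) ∧ rep x = y then p else rep x) n =
      (classes rep n).erase y := by
    rw [mem_classes] at hy hp
    ext x
    rw [mem_classes, Finset.mem_erase, mem_classes]
    constructor
    · rintro ⟨h1, h2⟩
      split_ifs at h2 with h3
      · rw [← h2, hp.2] at h3; exact absurd h3.2.symm hyp
      · refine ⟨fun e => h3 ⟨h1, ?_⟩, h1, h2⟩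
        rw [h2, e]
    · rintro ⟨h1, h2, h3⟩
      refine ⟨h2, ?_⟩
      rw [if_neg (fun h => h1 (h3.symm.trans h.2)), h3]
  refine ⟨⟨?_, ?_, ?_, hr.wall_lt⟩, hc⟩
  · rw [if_neg (by omega)]; exact hr.rep_n
  · intro j h0 h1 hw
    rw [hc]
    split_ifs with h
    · exact Finset.mem_erase.2 ⟨hyp.symm, hp⟩
    · exact Finset.mem_erase.2 ⟨fun e => h ⟨⟨h0, h1⟩, e⟩, hr.rep_mem j h0 h1 hw⟩
  · intro h0
    rw [if_neg]
    · exact hr.rep_wall h0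
    · rintro ⟨h1, h2⟩
      rw [hr.rep_wall h0] at h2
      have := (mem_classes.1 hy).1
      omega

/-- A set that is first split by merging `y` and `p` contained all or nothing of each old class, so
it separates these two representatives. The bound for cuts separating `y` and `p` therefore applies
to it. -/
theorem Splits.of_merge {n w y p : ℤ} {rep : ℤ → ℤ} (hr : RepOK n w rep)
    (hy : y ∈ classes rep n) (hp : p ∈ classes rep n) {X : Finset ℤ}
    (h : Splits n w (fun x => if (0 ≤ x ∧ x < n) ∧ rep x = y then p else rep x) X)
    (h' : ¬ Splits n w rep X) : y ∈ X ↔ p ∉ X := by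
  have hw : ∀ z ∈ classes rep n, z ∈ others n w := by
    intro z hz
    rw [mem_classes] at hz
    refine mem_others.2 ⟨?_, hz.1⟩
    intro e
    have h2 := hr.rep_wall (e ▸ hz.1.1)
    have h3 := hz.2
    rw [e, h2] at h3
    omega
  have hcl : ∀ i ∈ others n w, ∀ j ∈ others n w, rep i = rep j → (i ∈ X ↔ j ∈ X) := by
    intro i hi j hj e
    by_contra hne
    rcases iff_iff_and_or_not_and_not.not.1 hne with hne
    by_cases h1 : i ∈ X
    · exact h' ⟨i, hi, j, hj, e, h1, fun h2 => hne (Or.inl ⟨h1, h2⟩)⟩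
    · exact h' ⟨j, hj, i, hi, e.symm, by_contra fun h2 => hne (Or.inr ⟨h1, h2⟩), h1⟩
  obtain ⟨i, hi, j, hj, hij, hiX, hjX⟩ := h
  have h1 := (mem_classes.1 hy).2
  have h2 := (mem_classes.1 hp).2
  have hi' := (mem_others.1 hi).2
  have hj' := (mem_others.1 hj).2
  simp only [hi', hj', true_and] at hij
  split_ifs at hij with h3 h4 h4
  · exact absurd ((hcl i hi j hj (h3.trans h4.symm)).1 hiX) hjX
  · have a1 := hcl i hi y (hw y hy) (h3.trans h1.symm)
    have a2 := hcl j hj p (hw p hp) (hij.symm.trans h2.symm)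
    tauto
  · have a1 := hcl i hi p (hw p hp) (hij.trans h2.symm)
    have a2 := hcl j hj y (hw y hy) (h4.trans h1.symm)
    tauto
  · exact absurd ((hcl i hi j hj hij).1 hiX) hjX

/-- By how much the multiplicity of the splitting off has to be reduced because of a cut of
capacity `c` after the removal of `w`. -/
def defect (k u v w c : ℤ) : ℤ :=
  if w < 0 then (k + k - c + 1) / 2 else if w = u ∨ w = v then k - c else (k - c + 1) / 2

/-- For a fixed wall, a cut of least capacity thus has greatest defect. The cases of `defect` come
from the value `k * |wall| + c` of the corresponding biset. -/
theorem defect_anti {k u v w c c' : ℤ} (h : c ≤ c') : defect k u v w c' ≤ defect k u v w c := by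
  unfold defect
  split_ifs <;> omega

/-! ### One phase of the minimum cut algorithm: evaluation -/

/-- A graph on the vertices `0, …, n`, given by half-edges, together with the numbers that
determine the defects of its cuts. -/
structure CutData where
  (n k u v : ℤ)
  (M j : ℕ)
  (src dst cc : ℤ → ℤ)
  n_nonneg : 0 ≤ n
  lt_pow : n < 2 ^ j
  src_mem : ∀ h : ℕ, h < M → 0 ≤ src h ∧ src h ≤ n
  dst_mem : ∀ h : ℕ, h < M → 0 ≤ dst h ∧ dst h ≤ n
  cap_nonneg : ∀ h, 0 ≤ cc h
  symm : ∀ a b, classWeight id src dst cc M a b = classWeight id src dst cc M b a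

namespace CutData

variable (D : CutData)

/-- The defect of the cut `X` after the removal of `w`. -/
noncomputable def cutDefect (w : ℤ) (X : Finset ℤ) : ℤ :=
  defect D.k D.u D.v w (cutValue (classWeight id D.src D.dst D.cc D.M) D.n w X)

/-- The data are in the memory. -/
structure Stored (σ : Store) : Prop where
  n_eq : σ.var 0 = D.n
  k_eq : σ.var 2 = D.k
  u_eq : σ.var 3 = D.u
  v_eq : σ.var 4 = D.v
  M_eq : σ.var 10 = D.M
  log_eq : σ.var 12 = 3 * D.j
  src_eq : σ.arr 10 = D.src
  dst_eq : σ.arr 11 = D.dst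
  cc_eq : σ.arr 12 = D.cc

/-- Register `14` is zero, or the defect of the cut in arrays `6` and `7`. -/
def BestFound (σ : Store) : Prop :=
  σ.var 14 = 0 ∨ ∃ w X, -1 ≤ w ∧ w < D.n ∧ X.Nonempty ∧ X ⊂ others D.n w ∧
    D.cutDefect w X = σ.var 14 ∧ ∀ x, 0 ≤ x → x < D.n →
      σ.arr 6 x = (if x ∈ X then 1 else 0) ∧ σ.arr 7 x = if x ∈ X ∨ x = w then 1 else 0

/-- The invariant of the search for a cut of greatest defect. -/
structure SearchInv (w : ℤ) (σ : Store) : Prop where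
  stored : D.Stored σ
  mem : MemberArray ∅ σ
  buckets : ∀ d, σ.arr 23 d = 0
  best_nonneg : 0 ≤ σ.var 14
  best : D.BestFound σ
  done : ∀ w', -1 ≤ w' → w' < w → ∀ X, X.Nonempty → X ⊂ others D.n w' →
    D.cutDefect w' X ≤ σ.var 14

/-- The invariant of the search among the cuts after the removal of `w`. -/
structure PhaseInv (w : ℤ) (σ : Store) : Prop extends D.SearchInv w σ where
  wall_eq : σ.var 13 = w
  wall_ge : -1 ≤ w
  rep_ok : RepOK D.n w (σ.arr 13)
  cnt_eq : σ.var 15 = (classes (σ.arr 13) D.n).card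
  split_le : ∀ X ⊆ others D.n w, Splits D.n w (σ.arr 13) X → D.cutDefect w X ≤ σ.var 14

variable {D} {w : ℤ} {σ τ : Store}

theorem Stored.congr (h : D.Stored σ)
    (hv : ∀ x, x = 0 ∨ x = 2 ∨ x = 3 ∨ x = 4 ∨ x = 10 ∨ x = 12 → τ.var x = σ.var x)
    (ha : ∀ a, a = 10 ∨ a = 11 ∨ a = 12 → τ.arr a = σ.arr a) : D.Stored τ where
  n_eq := (hv 0 (by simp)).trans h.n_eq
  k_eq := (hv 2 (by simp)).trans h.k_eq
  u_eq := (hv 3 (by simp)).trans h.u_eq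
  v_eq := (hv 4 (by simp)).trans h.v_eq
  M_eq := (hv 10 (by simp)).trans h.M_eq
  log_eq := (hv 12 (by simp)).trans h.log_eq
  src_eq := (ha 10 (by simp)).trans h.src_eq
  dst_eq := (ha 11 (by simp)).trans h.dst_eq
  cc_eq := (ha 12 (by simp)).trans h.cc_eq

theorem BestFound.congr (h : D.BestFound σ) (h14 : τ.var 14 = σ.var 14) (h6 : τ.arr 6 = σ.arr 6)
    (h7 : τ.arr 7 = σ.arr 7) : D.BestFound τ := by
  unfold BestFound
  rw [h14, h6, h7]
  exact h

theorem SearchInv.congr (h : D.SearchInv w σ)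
    (hv : ∀ x, x = 0 ∨ x = 2 ∨ x = 3 ∨ x = 4 ∨ x = 10 ∨ x = 12 ∨ x = 14 → τ.var x = σ.var x)
    (ha : ∀ a, a = 6 ∨ a = 7 ∨ a = 10 ∨ a = 11 ∨ a = 12 → τ.arr a = σ.arr a)
    (hm : MemberArray ∅ τ) (hb : ∀ d, τ.arr 23 d = 0) : D.SearchInv w τ where
  stored := h.stored.congr (fun x hx => hv x (by omega)) fun a h' => ha a (by omega)
  mem := hm
  buckets := hb
  best_nonneg := by rw [hv 14 (by simp)]; exact h.best_nonneg
  best := h.best.congr (hv 14 (by simp)) (ha 6 (by simp)) (ha 7 (by simp))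
  done := by rw [hv 14 (by simp)]; exact h.done

theorem PhaseInv.congr (h : D.PhaseInv w σ)
    (hv : ∀ x, x = 0 ∨ x = 2 ∨ x = 3 ∨ x = 4 ∨ x = 10 ∨ x = 12 ∨ x = 13 ∨ x = 14 ∨ x = 15 →
      τ.var x = σ.var x)
    (ha : ∀ a, a = 6 ∨ a = 7 ∨ a = 10 ∨ a = 11 ∨ a = 12 ∨ a = 13 → τ.arr a = σ.arr a)
    (hm : MemberArray ∅ τ) (hb : ∀ d, τ.arr 23 d = 0) : D.PhaseInv w τ where
  toSearchInv := h.toSearchInv.congr (fun x hx => hv x (by omega)) (fun a h' => ha a (by omega))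
    hm hb
  wall_eq := (hv 13 (by simp)).trans h.wall_eq
  wall_ge := h.wall_ge
  rep_ok := by rw [ha 13 (by simp)]; exact h.rep_ok
  cnt_eq := by rw [ha 13 (by simp), hv 15 (by simp)]; exact h.cnt_eq
  split_le := by rw [ha 13 (by simp), hv 14 (by simp)]; exact h.split_le

theorem PhaseInv.phaseInput (h : D.PhaseInv w σ) : PhaseInput D.n D.M D.j (σ.arr 13) σ where
  n_eq := h.stored.n_eq
  M_eq := h.stored.M_eq
  log_eq := h.stored.log_eq
  cnt_eq := h.cnt_eq
  rep_eq := rfl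
  n_nonneg := D.n_nonneg
  lt_pow := D.lt_pow
  src_mem := by rw [h.stored.src_eq]; exact D.src_mem
  dst_mem := by rw [h.stored.dst_eq]; exact D.dst_mem
  cap_nonneg := by rw [h.stored.cc_eq]; exact D.cap_nonneg
  symm := by rw [h.stored.src_eq, h.stored.dst_eq, h.stored.cc_eq]; exact D.symm

end CutData

/-- Register `34` receives the defect of the cut that separates the last class. -/
def evalDefect : Program :=
  .ite (.lt (.var 13) (.const 0))
    (.assign 34 (.half (.add (.sub (.add (.var 2) (.var 2)) (.get 15 (.var 16))) (.const 1))))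
    (.ite (.eq (.var 13) (.var 3))
      (.assign 34 (.sub (.var 2) (.get 15 (.var 16))))
      (.ite (.eq (.var 13) (.var 4))
        (.assign 34 (.sub (.var 2) (.get 15 (.var 16))))
        (.assign 34 (.half (.add (.sub (.var 2) (.get 15 (.var 16))) (.const 1))))))

def recordBody : Program :=
  .ite (.eq (.get 13 (.var 29)) (.var 16))
    (.seq (.store 6 (.var 29) (.const 1)) (.store 7 (.var 29) (.const 1)))
    (.seq (.store 6 (.var 29) (.const 0))
      (.ite (.eq (.var 29) (.var 13)) (.store 7 (.var 29) (.const 1))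
        (.store 7 (.var 29) (.const 0))))

/-- Records the cut that separates the last class if its defect is greater than all before. -/
def recordCut : Program :=
  .ite (.lt (.var 14) (.var 34))
    (.block [.assign 14 (.var 34), .assign 29 (.const 0), .forUp 29 0 recordBody])
    .skip

def mergeBody : Program :=
  .ite (.eq (.get 13 (.var 29)) (.var 16)) (.store 13 (.var 29) (.var 17)) .skip

/-- Merges the last two classes. -/
def mergeLast : Program := .block [
  .assign 29 (.const 0),
  .forUp 29 0 mergeBody,
  .assign 15 (.sub (.var 15) (.const 1))]

theorem evalDefect_spec {k u v w : ℤ} {σ : Store} (hk : σ.var 2 = k) (hu : σ.var 3 = u)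
    (hv : σ.var 4 = v) (hw : σ.var 13 = w) :
    Wp evalDefect (fun τ d => τ.var 34 = defect k u v w (σ.arr 15 (σ.var 16)) ∧ 0 ≤ d) σ 100 := by
  apply Wp.flat rfl
  refine ⟨?_, by decide⟩
  unfold defect evalDefect
  simp only [Program.run, Test.holds_lt, Test.holds_eq, Expr.eval, hk, hu, hv, hw]
  split_ifs <;> simp_all

theorem recordCut_spec {D : CutData} {w y p : ℤ} {σ : Store} (h : D.PhaseInv w σ)
    (hy : σ.var 16 = y) (hyC : y ∈ classes (σ.arr 13) D.n) (hpC : p ∈ classes (σ.arr 13) D.n)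
    (hyp : y ≠ p) {W : ℤ → ℤ → ℤ}
    (hW : W = classWeight (σ.arr 13) D.src D.dst D.cc D.M)
    (hdef : σ.var 34 = defect D.k D.u D.v w
      (∑ a ∈ (insert D.n (classes (σ.arr 13) D.n)).erase y, W y a)) :
    Wp recordCut (fun τ d => D.PhaseInv w τ ∧ σ.var 34 ≤ τ.var 14 ∧ 0 ≤ d) σ
      (60 * D.n + 60) := by
  have hn := D.n_nonneg
  refine Wp.ite ?_ ?_
  · intro hb
    simp only [Test.holds_lt, Expr.eval] at hb
    apply Wp.seq
    apply Wp.flat rfl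
    apply Wp.seq
    apply Wp.flat rfl
    have hcost : (recordBody.flatCost : ℤ) ≤ 50 := by decide
    have e0 := h.stored.n_eq
    refine Wp.frame (Wp.forFlat 0 D.n (fun j τ => ∀ x, 0 ≤ x → x < j →
      τ.arr 6 x = (if σ.arr 13 x = y then 1 else 0) ∧
      τ.arr 7 x = if σ.arr 13 x = y ∨ x = w then 1 else 0)
      rfl rfl rfl rfl ?_ ?_ ?_ hn ?_) ?_
    · rintro j τ hj0 hjN h29 - hU h1 x hx hx'
      have h13 : τ.arr 13 = σ.arr 13 := (hU.2 13 rfl).trans (by simp [Program.run])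
      have h16 : τ.var 16 = y := (hU.1 16 rfl).trans (by simpa [Program.run] using hy)
      have hw : τ.var 13 = w := (hU.1 13 rfl).trans (by simpa [Program.run] using h.wall_eq)
      have h2 := h1 x hx
      rcases eq_or_ne x j with e | e
      · subst e
        unfold recordBody
        simp only [Program.run, Test.holds_eq, Expr.eval, h29, h13, h16]
        split_ifs with c1 c2 c3 <;> simp_all
      · have h3 := h2 (by omega)
        unfold recordBody
        simp only [Program.run, Test.holds_eq, Expr.eval, h29, h13, h16]
        rw [← h3.1, ← h3.2]
        split_ifs with c1 c2 <;> simp [e, h29]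
    · simp [Program.run, Expr.eval]
    · simpa [Program.run] using e0
    · intro x hx hx'; omega
    · rintro τ d ⟨h1, h2⟩ hU
      have hv : ∀ x, x ≠ 14 → x ≠ 29 → τ.var x = σ.var x := fun x hx hx' => by
        rw [hU.1 x (by simp [Program.block, Program.forUp, Program.writesVar, recordBody, hx'])]
        simp [Program.run, hx, hx']
      have ha : ∀ a, a ≠ 6 → a ≠ 7 → τ.arr a = σ.arr a := fun a hx hx' => by
        rw [hU.2 a (by simp [Program.block, Program.forUp, Program.writesArr, recordBody, hx, hx'])]
        simp [Program.run]
      have h14 : τ.var 14 = σ.var 34 := (hU.1 14 rfl).trans (by simp [Program.run, Expr.eval])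
      have hbn := h.best_nonneg
      have hyr := mem_classes.1 hyC
      have hpr := mem_classes.1 hpC
      have hwy : ∀ z ∈ classes (σ.arr 13) D.n, z ≠ w := by
        intro z hz e
        have hz := mem_classes.1 hz
        have := h.rep_ok.rep_wall (e ▸ hz.1.1)
        rw [← e, hz.2] at this
        omega
      refine ⟨{
        stored := h.stored.congr (fun x hx => hv x (by omega) (by omega))
          fun a hx => ha a (by omega) (by omega)
        mem := fun y => by rw [ha 14 (by omega) (by omega)]; exact h.mem y
        buckets := fun y => by rw [ha 23 (by omega) (by omega)]; exact h.buckets y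
        best_nonneg := by rw [h14]; omega
        -- The recorded cut is the whole class represented by `y`, that is, the preimage of a single
        -- vertex of the contracted graph.
        best := Or.inr ⟨w, (others D.n w).filter (σ.arr 13 · ∈ ({y} : Finset ℤ)), h.wall_ge,
          h.rep_ok.wall_lt, ?_, ?_, ?_, ?_⟩
        done := fun w' h3 h4 X h5 h6 => by have := h.done w' h3 h4 X h5 h6; rw [h14]; omega
        wall_eq := (hv 13 (by omega) (by omega)).trans h.wall_eq
        wall_ge := h.wall_ge
        rep_ok := by rw [ha 13 (by omega) (by omega)]; exact h.rep_ok
        cnt_eq := by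
          rw [ha 13 (by omega) (by omega), hv 15 (by omega) (by omega)]; exact h.cnt_eq
        split_le := fun X hX h3 => by
          rw [ha 13 (by omega) (by omega)] at h3
          have := h.split_le X hX h3
          rw [h14]; omega }, h14.ge, ?_⟩
      · exact ⟨y, Finset.mem_filter.2 ⟨mem_others.2 ⟨hwy y hyC, hyr.1⟩, by simp [hyr.2]⟩⟩
      · refine Finset.filter_ssubset.2 ⟨p, mem_others.2 ⟨hwy p hpC, hpr.1⟩, ?_⟩
        simp [hpr.2, hyp.symm]
      · rw [h14, hdef]
        unfold CutData.cutDefect others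
        rw [← weightCut_classes h.rep_ok hn D.src_mem D.dst_mem, ← hW, weightCut_singleton]
        · exact Finset.mem_insert_of_mem hyC
        · rw [Finset.mem_singleton]; omega
      · intro x hx hx'
        obtain ⟨h3, h4⟩ := h1 x hx hx'
        rw [h3, h4]
        simp only [Finset.mem_filter, mem_others, Finset.mem_singleton, hx, hx', and_true]
        have : x = w → σ.arr 13 x ≠ y := by
          rintro rfl e
          rw [h.rep_ok.rep_wall hx] at e
          omega
        constructor
        · congr 1
          rw [eq_iff_iff]
          exact ⟨fun e => ⟨fun h => this h e, e⟩, fun e => e.2⟩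
        · congr 1
          rw [eq_iff_iff]
          by_cases hxw : x = w <;> simp [hxw]
      · simp only [Test.cost, Expr.cost, Program.flatCost]
        push_cast
        nlinarith
  · intro hb
    simp only [Test.holds_lt, Expr.eval] at hb
    apply Wp.flat rfl
    refine ⟨h, by simp only [Program.run]; omega, ?_⟩
    simp only [Test.cost, Expr.cost, Program.flatCost]
    push_cast
    omega

/-- Merging enlarges the family of split sets, for which the invariant promises a bound; `hcut`
supplies it for the newcomers. -/
theorem mergeLast_spec {D : CutData} {w y p : ℤ} {σ : Store} (h : D.PhaseInv w σ)
    (hy : σ.var 16 = y) (hp : σ.var 17 = p) (hyC : y ∈ classes (σ.arr 13) D.n)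
    (hpC : p ∈ classes (σ.arr 13) D.n) (hyp : y ≠ p)
    (hcut : ∀ X ⊆ others D.n w, ¬ Splits D.n w (σ.arr 13) X → (y ∈ X ↔ p ∉ X) →
      D.cutDefect w X ≤ σ.var 14) :
    Wp mergeLast (fun τ d => D.PhaseInv w τ ∧ τ.var 15 = σ.var 15 - 1 ∧ 0 ≤ d) σ
      (40 * D.n + 30) := by
  have hn := D.n_nonneg
  apply Wp.seq
  apply Wp.flat rfl
  apply Wp.seq
  have hcost : (mergeBody.flatCost : ℤ) ≤ 32 := by decide
  refine Wp.frame (Wp.forFlat 0 D.n (fun j τ => τ.arr 13 =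
    fun x => if (0 ≤ x ∧ x < j) ∧ σ.arr 13 x = y then p else σ.arr 13 x)
    rfl rfl rfl rfl ?_ ?_ ?_ hn ?_) ?_
  · rintro j τ hj0 hjN h29 - hU h1
    have h16 : τ.var 16 = y := (hU.1 16 rfl).trans (by simpa [Program.run] using hy)
    have h17 : τ.var 17 = p := (hU.1 17 rfl).trans (by simpa [Program.run] using hp)
    funext x
    unfold mergeBody
    have e : τ.arr 13 j = σ.arr 13 j := by rw [h1]; simp
    simp only [Program.run, Test.holds_eq, Expr.eval, h29, e, h16, h17]
    split_ifs with c1 c2 c2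
    · rcases eq_or_ne x j with e | e
      · simp [e]
      · simp only [Store.setVar_arr, Store.setArr_arr, if_true, Function.update_of_ne e, h1]
        rw [if_pos ⟨⟨c2.1.1, by omega⟩, c2.2⟩]
    · rcases eq_or_ne x j with e | e
      · subst e; exact absurd ⟨⟨hj0, by omega⟩, c1⟩ c2
      · simp only [Store.setVar_arr, Store.setArr_arr, if_true, Function.update_of_ne e, h1]
        rw [if_neg fun h' => c2 ⟨⟨h'.1.1, by omega⟩, h'.2⟩]
    · rcases eq_or_ne x j with e | e
      · subst e; exact absurd c2.2 c1
      · simp only [Store.setVar_arr, h1]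
        rw [if_pos ⟨⟨c2.1.1, by omega⟩, c2.2⟩]
    · simp only [Store.setVar_arr, h1]
      rw [if_neg fun h' => c2 ⟨⟨h'.1.1, by omega⟩, h'.2⟩]
  · simp [Program.run, Expr.eval]
  · simpa [Program.run] using h.stored.n_eq
  · funext x
    rw [if_neg (by omega)]
    simp [Program.run]
  · rintro τ d ⟨h1, h2⟩ hU
    apply Wp.flat rfl
    have hv : ∀ x, x ≠ 29 → τ.var x = σ.var x := fun x hx => by
      rw [hU.1 x (by simp [Program.writesVar, mergeBody, hx])]
      simp [Program.run, hx]
    have ha : ∀ a, a ≠ 13 → τ.arr a = σ.arr a := fun a hx => by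
      rw [hU.2 a (by simp [Program.writesArr, mergeBody, hx])]
      simp [Program.run]
    have hrun : (Program.block [Program.assign 15 (Expr.sub (Expr.var 15) (Expr.const 1))]).run τ =
        τ.setVar 15 (σ.var 15 - 1) := by
      simp [Program.block, Program.run, Expr.eval, hv 15]
    rw [hrun]
    obtain ⟨h3, h4⟩ := h.rep_ok.merge hyC hpC hyp
    rw [← h1] at h3 h4
    refine ⟨{
      toSearchInv := h.toSearchInv.congr (fun x hx => ?_) (fun a hx => ha a (by omega))
        (fun y => by rw [Store.setVar_arr, ha 14 (by omega)]; exact h.mem y)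
        (fun y => by rw [Store.setVar_arr, ha 23 (by omega)]; exact h.buckets y)
      wall_eq := by simp [hv 13, h.wall_eq]
      wall_ge := h.wall_ge
      rep_ok := by simpa using h3
      cnt_eq := ?_
      split_le := ?_ }, by simp, ?_⟩
    · rw [Store.setVar_var, if_neg (by omega), hv x (by omega)]
    · simp only [Store.setVar_var, Store.setVar_arr, if_true]
      rw [h4, h.cnt_eq, Finset.card_erase_of_mem hyC]
      have := Finset.card_pos.2 ⟨y, hyC⟩
      omega
    · intro X hX hs
      simp only [Store.setVar_var, Store.setVar_arr, Nat.reduceEqDiff, reduceIte] at hs ⊢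
      rw [hv 14 (by omega)]
      by_cases hs' : Splits D.n w (σ.arr 13) X
      · exact h.split_le X hX hs'
      · rw [h1] at hs
        exact hcut X hX hs' (Splits.of_merge h.rep_ok hyC hpC hs hs')
    · simp only [Expr.cost, Program.flatCost, Program.block]
      push_cast
      nlinarith

/-- One phase: finds the best cut separating two classes and merges them. -/
def phase : Program := .block [phaseInit, buildAdj, orderClasses, evalDefect, recordCut, mergeLast]

/-- A set not split so far that separates the last two classes is a cut of the contracted graph,
with capacity at least the last key. Its defect is at most that of the cut around the last class,
hence at most the recorded maximum. -/
theorem phase_spec {D : CutData} {w : ℤ} {σ : Store} (h : D.PhaseInv w σ) (h2 : 2 ≤ σ.var 15) :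
    Wp phase (fun τ d => D.PhaseInv w τ ∧ τ.var 15 = σ.var 15 - 1 ∧ 0 ≤ d) σ
      (1060 * D.M + (2200 * D.j + 700) * D.n + 600) := by
  have hn := D.n_nonneg
  have hcnt := h.cnt_eq
  have hcard : ((classes (σ.arr 13) D.n).card : ℤ) ≤ D.n := by
    have : (classes (σ.arr 13) D.n).card ≤ (Finset.Ico 0 D.n).card := Finset.card_filter_le _ _
    rw [Int.card_Ico] at this
    omega
  apply Wp.seq
  refine Wp.frame (phaseInit_spec h.stored.n_eq hn h.mem) ?_
  rintro τ1 d1 ⟨h1, h3, h4, h5⟩ hU1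
  apply Wp.seq
  refine Wp.frame (buildAdj_spec (M := D.M) ((hU1.1 10 rfl).trans h.stored.M_eq) h5) ?_
  rintro τ2 d2 ⟨h6, h7⟩ hU2
  apply Wp.seq
  have hv2 : ∀ x, phaseInit.writesVar x = false → buildAdj.writesVar x = false →
    τ2.var x = σ.var x := fun x e1 e2 => (hU2.1 x e2).trans (hU1.1 x e1)
  have ha2 : ∀ x, phaseInit.writesArr x = false → buildAdj.writesArr x = false →
    τ2.arr x = σ.arr x := fun x e1 e2 => (hU2.2 x e2).trans (hU1.2 x e1)
  have e13 : τ2.arr 13 = σ.arr 13 := ha2 13 rfl rfl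
  have hin : PhaseInput D.n D.M D.j (σ.arr 13) τ2 := by
    have hp := h.phaseInput
    exact {
      n_eq := (hv2 0 rfl rfl).trans hp.n_eq
      M_eq := (hv2 10 rfl rfl).trans hp.M_eq
      log_eq := (hv2 12 rfl rfl).trans hp.log_eq
      cnt_eq := (hv2 15 rfl rfl).trans hp.cnt_eq
      rep_eq := e13
      n_nonneg := hn
      lt_pow := hp.lt_pow
      src_mem := by rw [ha2 10 rfl rfl]; exact hp.src_mem
      dst_mem := by rw [ha2 11 rfl rfl]; exact hp.dst_mem
      cap_nonneg := by rw [ha2 12 rfl rfl]; exact hp.cap_nonneg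
      symm := by rw [ha2 10 rfl rfl, ha2 11 rfl rfl, ha2 12 rfl rfl]; exact hp.symm }
  rw [hU1.2 13 rfl, hU1.2 10 rfl] at h7
  refine Wp.frame (orderClasses_spec (c := d1) hin ?_ ?_ ?_ ?_ ?_ ?_) ?_
  · refine h1.congr (fun a ha ha' => ?_) (hU2.1 19 rfl) (hU2.1 20 rfl)
    interval_cases a <;> exact hU2.2 _ rfl
  · intro y; rw [hU2.2 14 rfl]; exact h3 y
  · intro z hz; rw [hU2.2 15 rfl]; exact h4 z hz
  · intro d; rw [ha2 23 rfl rfl]; exact h.buckets d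
  · rw [ha2 10 rfl rfl]; exact h7
  · omega
  rintro τ3 d3 ⟨g0, g1, g2, gy, gp, gyp, gkey, gcut⟩ hU3
  rw [ha2 10 rfl rfl, ha2 11 rfl rfl, ha2 12 rfl rfl, h.stored.src_eq, h.stored.dst_eq,
    h.stored.cc_eq] at gkey gcut
  have hv3 : ∀ x, x = 0 ∨ x = 2 ∨ x = 3 ∨ x = 4 ∨ x = 10 ∨ x = 12 ∨ x = 13 ∨ x = 14 ∨ x = 15 →
      τ3.var x = σ.var x := by
    rintro x (rfl | rfl | rfl | rfl | rfl | rfl | rfl | rfl | rfl) <;>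
      exact (hU3.1 _ rfl).trans (hv2 _ rfl rfl)
  have ha3 : ∀ a, a = 6 ∨ a = 7 ∨ a = 10 ∨ a = 11 ∨ a = 12 ∨ a = 13 → τ3.arr a = σ.arr a := by
    rintro x (rfl | rfl | rfl | rfl | rfl | rfl) <;>
      exact (hU3.2 _ rfl).trans (ha2 _ rfl rfl)
  have hI3 := h.congr hv3 ha3 g1 g2
  apply Wp.seq
  refine Wp.frame (evalDefect_spec hI3.stored.k_eq hI3.stored.u_eq hI3.stored.v_eq
    hI3.wall_eq) ?_
  rintro τ4 d4 ⟨h34, hd4⟩ hU4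
  have hI4 : D.PhaseInv w τ4 := by
    refine hI3.congr ?_ ?_ ?_ ?_
    · rintro x (rfl | rfl | rfl | rfl | rfl | rfl | rfl | rfl | rfl) <;> exact hU4.1 _ rfl
    · exact fun a _ => hU4.2 a rfl
    · exact fun y => by rw [hU4.2 14 rfl]; exact g1 y
    · exact fun y => by rw [hU4.2 23 rfl]; exact g2 y
  have e4 : τ4.arr 13 = σ.arr 13 := (hU4.2 13 rfl).trans (ha3 13 (by simp))
  have e4' : τ4.var 16 = τ3.var 16 := hU4.1 16 rfl
  have e4'' : τ4.var 17 = τ3.var 17 := hU4.1 17 rfl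
  apply Wp.seq
  refine Wp.frame (recordCut_spec (p := τ3.var 17) hI4 e4' (by rw [e4]; exact gy)
    (by rw [e4]; exact gp) gyp rfl (by rw [e4, h34, gkey])) ?_
  rintro τ5 d5 ⟨hI5, h14, hd5⟩ hU5
  have e5 : τ5.arr 13 = σ.arr 13 := (hU5.2 13 rfl).trans e4
  have e5' : τ5.var 16 = τ3.var 16 := (hU5.1 16 rfl).trans e4'
  have e5'' : τ5.var 17 = τ3.var 17 := (hU5.1 17 rfl).trans e4''
  refine Wp.frame (mergeLast_spec (y := τ3.var 16) (p := τ3.var 17) hI5 e5' e5''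
    (by rw [e5]; exact gy) (by rw [e5]; exact gp) gyp ?_) ?_
  · intro X hX hs hX'
    rw [e5] at hs
    refine le_trans ?_ (h34 ▸ h14)
    unfold CutData.cutDefect
    apply defect_anti
    rw [cutValue_of_not_splits h.rep_ok hn D.src_mem D.dst_mem hX hs]
    exact gcut X hX'
  · rintro τ d ⟨hI, h15, hd⟩ -
    refine ⟨hI, ?_, ?_⟩
    · rw [h15, hU5.1 15 rfl, hU4.1 15 rfl, hv3 15 (by simp)]
    · have : (2200 * D.j + 200 : ℤ) * (classes (σ.arr 13) D.n).card ≤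
        (2200 * D.j + 200) * D.n := mul_le_mul_of_nonneg_left hcard (by positivity)
      nlinarith

/-! ### The search for a cut of greatest defect -/

/-- Removes the vertex in register `13` and puts every other vertex into a class of its own. -/
def wallInit : Program := .block [
  .assign 29 (.const 0),
  .assign 33 (.add (.var 0) (.const 1)),
  .forUp 29 33 (.store 13 (.var 29) (.var 29)),
  .ite (.lt (.var 13) (.const 0)) (.assign 15 (.var 0))
    (.seq (.store 13 (.var 13) (.add (.var 0) (.const 1)))
      (.assign 15 (.sub (.var 0) (.const 1))))]

/-- Examines the cuts after the removal of the vertex in register `13`. -/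
def wallSearch : Program := .seq wallInit (.loop (.lt (.const 1) (.var 15)) phase)

/-- Examines the cuts after the removal of no or one vertex. -/
def search : Program := .block [.assign 13 (.const (-1)), .forUp 13 0 wallSearch]

namespace CutData

variable {D : CutData} {w : ℤ} {σ : Store}

theorem wallInit_spec (h : D.SearchInv w σ) (hw : σ.var 13 = w) (hw1 : -1 ≤ w) (hwn : w < D.n) :
    Wp wallInit (fun τ d => D.PhaseInv w τ ∧ τ.var 15 ≤ D.n ∧ 0 ≤ d) σ (20 * D.n + 60) := by
  have hn := D.n_nonneg
  have h0 := h.stored.n_eq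
  apply Wp.seq
  apply Wp.flat rfl
  apply Wp.seq
  apply Wp.flat rfl
  apply Wp.seq
  refine Wp.frame (Wp.forFlat 0 (D.n + 1) (fun j τ => ∀ x, 0 ≤ x → x < j → τ.arr 13 x = x)
    rfl rfl rfl rfl ?_ ?_ ?_ (by omega) ?_) ?_
  · rintro j τ hj0 hjN h29 - hU h1 x hx hx'
    simp only [Program.run, Expr.eval, h29, Store.setVar_arr, Store.setArr_arr, if_true]
    rcases eq_or_ne x j with e | e
    · simp [e]
    · rw [Function.update_of_ne e]; exact h1 x hx (by omega)
  · simp [Program.run, Expr.eval]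
  · simp [Program.run, Expr.eval, h0]
  · intro x hx hx'; omega
  rintro τ d ⟨h1, h2⟩ hU
  have hv : ∀ x, x ≠ 29 → x ≠ 33 → τ.var x = σ.var x := fun x hx hx' => by
    rw [hU.1 x (by simp [Program.writesVar, hx])]
    simp [Program.run, hx, hx']
  have ha : ∀ a, a ≠ 13 → τ.arr a = σ.arr a := fun a hx => by
    rw [hU.2 a (by simp [Program.writesArr, hx])]
    simp [Program.run]
  -- With and without a removed vertex the conclusion is the same; only the representatives `f` and
  -- the number `c` of classes differ.
  have hlast : ∀ (f : ℤ → ℤ) (c : ℤ), RepOK D.n w f → c = (classes f D.n).card →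
      (∀ X ⊆ others D.n w, ¬ Splits D.n w f X) → ∀ ρ : Store, ρ.arr 13 = f → ρ.var 15 = c →
      (∀ x, x ≠ 15 → ρ.var x = τ.var x) → (∀ a, a ≠ 13 → ρ.arr a = τ.arr a) →
      D.PhaseInv w ρ := by
    intro f c hr hc hs ρ e13 e15 e1 e2
    exact {
      toSearchInv := h.congr
        (fun x hx => (e1 x (by omega)).trans (hv x (by omega) (by omega)))
        (fun a hx => (e2 a (by omega)).trans (ha a (by omega)))
        (fun y => by rw [e2 14 (by omega), ha 14 (by omega)]; exact h.mem y)
        (fun y => by rw [e2 23 (by omega), ha 23 (by omega)]; exact h.buckets y)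
      wall_eq := ((e1 13 (by omega)).trans (hv 13 (by omega) (by omega))).trans hw
      wall_ge := hw1
      rep_ok := e13 ▸ hr
      cnt_eq := by rw [e13, e15, hc]
      split_le := fun X hX h' => absurd (e13 ▸ h') (hs X hX) }
  apply Wp.flat rfl
  simp only [Program.block, Program.run, Test.holds_lt, Expr.eval, hv 13 (by omega) (by omega), hw,
    hv 0 (by omega) (by omega), h0]
  split_ifs with hw0
  · refine ⟨hlast (τ.arr 13) D.n ⟨h1 _ hn (by omega), ?_, fun h' => by omega, hwn⟩ ?_ ?_ _ (by simp)
      (by simp) (fun x hx => by simp [hx]) (fun a hx => by simp), by simp, ?_⟩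
    · intro j hj hj' _
      have e := h1 j hj (by omega)
      rw [mem_classes, e, e]
      exact ⟨⟨hj, hj'⟩, rfl⟩
    · have : classes (τ.arr 13) D.n = Finset.Ico 0 D.n := by
        ext x
        rw [mem_classes, Finset.mem_Ico]
        exact ⟨fun h => h.1, fun h => ⟨h, h1 x h.1 (by omega)⟩⟩
      rw [this, Int.card_Ico]
      omega
    · rintro X hX ⟨i, hi, j, hj, hij, hiX, hjX⟩
      rw [mem_others] at hi hj
      rw [h1 i hi.2.1 (by omega), h1 j hj.2.1 (by omega)] at hij
      exact hjX (hij ▸ hiX)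
    · simp only [Test.cost, Expr.cost, Program.flatCost]
      push_cast
      nlinarith
  · refine ⟨hlast (Function.update (τ.arr 13) w (D.n + 1)) (D.n - 1) ⟨?_, ?_, ?_, hwn⟩ ?_ ?_ _
      ?_ (by simp [hv, h0]) (fun x hx => by simp [hx]) (fun a hx => by simp [hx]),
      by simp [hv, h0], ?_⟩
    · rw [Function.update_of_ne (by omega)]; exact h1 _ hn (by omega)
    · intro j hj hj' hjw
      refine mem_classes.2 ⟨?_, ?_⟩ <;> simp only [Function.update_of_ne hjw, h1 j hj (by omega)]
      exact ⟨hj, hj'⟩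
    · intro _; simp
    · have : classes (Function.update (τ.arr 13) w (D.n + 1)) D.n = (Finset.Ico 0 D.n).erase w := by
        ext x
        rw [mem_classes, Finset.mem_erase, Finset.mem_Ico]
        constructor
        · rintro ⟨h3, h4⟩
          refine ⟨?_, h3⟩
          rintro rfl
          rw [Function.update_self] at h4
          omega
        · rintro ⟨h3, h4⟩
          refine ⟨h4, ?_⟩
          rw [Function.update_of_ne h3]; exact h1 x h4.1 (by omega)
      rw [this, Finset.card_erase_of_mem (Finset.mem_Ico.2 ⟨by omega, hwn⟩), Int.card_Ico]
      omega
    · rintro X hX ⟨i, hi, j, hj, hij, hiX, hjX⟩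
      rw [mem_others] at hi hj
      rw [Function.update_of_ne hi.1, Function.update_of_ne hj.1, h1 i hi.2.1 (by omega),
        h1 j hj.2.1 (by omega)] at hij
      exact hjX (hij ▸ hiX)
    · simp [hv, h0]
    · simp only [Test.cost, Expr.cost, Program.flatCost]
      push_cast
      nlinarith

/-- When at most one class is left, every nonempty proper subset of `others D.n w` splits it, so the
bound for split sets covers all cuts belonging to `w`. -/
theorem wallSearch_spec (h : D.SearchInv w σ) (hw : σ.var 13 = w) (hw1 : -1 ≤ w)
    (hwn : w < D.n) :
    Wp wallSearch (fun τ d => D.SearchInv (w + 1) τ ∧ 0 ≤ d) σ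
      ((1060 * D.M + (2200 * D.j + 700) * D.n + 610) * D.n + 20 * D.n + 70) := by
  have hn := D.n_nonneg
  set P : ℤ := 1060 * D.M + (2200 * D.j + 700) * D.n + 600 with hP
  have hP0 : 0 ≤ P := by positivity
  have e : (1060 * D.M + (2200 * D.j + 700) * D.n + 610 : ℤ) = P + 10 := by rw [hP]; ring
  rw [e]
  apply Wp.seq
  refine Wp.frame (wallInit_spec h hw hw1 hwn) ?_
  rintro τ d ⟨h1, h2, h3⟩ -
  -- Each phase lowers the number of classes by one, so that number measures the remaining cost; `P`
  -- bounds a phase and 10 the test of the loop.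
  refine Wp.loop (fun τ d => D.PhaseInv w τ ∧ (P + 10) * τ.var 15 + 5 ≤ d) ?_ ?_ ?_ ?_
  · rintro τ d ⟨h4, h5⟩
    have : 0 ≤ (P + 10) * τ.var 15 := by rw [h4.cnt_eq]; positivity
    omega
  · rintro τ d - ⟨h4, h5⟩ hb
    simp only [Test.holds_lt, Expr.eval] at hb
    refine Wp.frame (phase_spec h4 hb) ?_
    rintro ρ d' ⟨h6, h7, h8⟩ -
    refine ⟨h6, ?_⟩
    rw [h7]
    simp only [Test.cost, Expr.cost]
    push_cast
    nlinarith
  · rintro τ d - ⟨h4, h5⟩ hb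
    simp only [Test.holds_lt, Expr.eval, not_lt] at hb
    have h15 := h4.cnt_eq
    have h6 : 0 ≤ (P + 10) * τ.var 15 := by rw [h15]; positivity
    refine ⟨{ h4.toSearchInv with done := ?_ }, ?_⟩
    · intro w' hw' hw'' X hne hX
      rcases lt_or_eq_of_le (show w' ≤ w by omega) with h7 | rfl
      · exact h4.done w' hw' h7 X hne hX
      · obtain ⟨i, hi⟩ := hne
        obtain ⟨j, hj, hjX⟩ := Finset.exists_of_ssubset hX
        refine h4.split_le X hX.1 ⟨i, hX.1 hi, j, hj, ?_, hi, hjX⟩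
        have h8 : (classes (τ.arr 13) D.n).card ≤ 1 := by omega
        rw [Finset.card_le_one] at h8
        have hi' := mem_others.1 (hX.1 hi)
        have hj' := mem_others.1 hj
        exact h8 _ (h4.rep_ok.rep_mem i hi'.2.1 hi'.2.2 hi'.1) _
          (h4.rep_ok.rep_mem j hj'.2.1 hj'.2.2 hj'.1)
    · simp only [Test.cost, Expr.cost]
      push_cast
      omega
  · refine ⟨h1, ?_⟩
    nlinarith

/-- The loop runs from `-1`, which stands for an empty wall, to `n - 1`: this is the factor `n + 1`.
-/
theorem search_spec (h : D.SearchInv (-1) σ) :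
    Wp search (fun τ d => D.SearchInv D.n τ ∧ 0 ≤ d) σ
      (((1060 * D.M + (2200 * D.j + 700) * D.n + 630) * D.n + 80) * (D.n + 1) + 10) := by
  have hn := D.n_nonneg
  apply Wp.seq
  apply Wp.flat rfl
  refine Wp.forUp (-1) D.n
    ((1060 * D.M + (2200 * D.j + 700) * D.n + 610) * D.n + 20 * D.n + 70)
    (fun j τ d => D.SearchInv j τ ∧ 0 ≤ d) rfl rfl rfl (by positivity) (fun _ _ _ _ _ h => h.2) ?_
    ?_ ?_ ?_ (by omega) ⟨?_, ?_⟩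
  · rintro j τ d hj hj' h13 - - ⟨h1, h2⟩
    refine Wp.frame (wallSearch_spec h1 h13 hj hj') ?_
    rintro ρ d' ⟨h3, h4⟩ -
    refine ⟨h3.congr (fun x hx => ?_) (fun a ha => by simp) (fun y => by simpa using h3.mem y)
      (by simpa using h3.buckets), by omega⟩
    rw [Store.setVar_var, if_neg (by omega)]
  · exact fun _ _ _ _ _ h => h
  · simp [Program.run, Expr.eval]
  · simpa [Program.run] using h.stored.n_eq
  · refine h.congr (fun x hx => ?_) (fun a ha => by simp [Program.run])
      (fun y => by simpa [Program.run] using h.mem y) (by simpa [Program.run] using h.buckets)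
    simp only [Program.run, Store.setVar_var]
    rw [if_neg (by omega)]
  · simp only [Expr.cost, Program.flatCost]
    push_cast
    nlinarith

end CutData

/-! ### Splitting off and the values of bisets -/

theorem CapGraph.splitDefined_iff {V : Type*} [DecidableEq V] {H : CapGraph (Option V)} {u v : V} {β : ℕ} :
    H.SplitDefined u v β ↔ β ≤ H.cap none (some u) ∧ β ≤ H.cap none (some v) ∧
      (u = v → 2 * β ≤ H.cap none (some u)) := by
  constructor
  · intro h
    have h1 := h none (some u)
    have h2 := h none (some v)
    simp [splitLoss] at h1 h2
    refine ⟨by omega, by omega, ?_⟩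
    rintro rfl
    simp at h1
    omega
  · rintro ⟨h1, h2, h3⟩ x y
    unfold splitLoss
    have e : ∀ w, s(x, y) = s(none, some w) → H.cap x y = H.cap none (some w) := by
      intro w hw
      rcases Sym2.eq_iff.1 hw with ⟨rfl, rfl⟩ | ⟨rfl, rfl⟩
      · rfl
      · exact H.symm _ _
    split_ifs with c1 c2 c2
    · have huv : u = v := by rw [c1] at c2; simpa using c2
      have := h3 huv
      rw [e u c1]; omega
    · rw [e u c1]; omega
    · rw [e v c2]; omega
    · omega

section

variable {V : Type*} [Fintype V] [DecidableEq V]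

/-- How often a biset counts against a splitting off of `(su, sv)`. -/
def Biset.loss (X : Biset V) (u v : V) : ℕ :=
  if u ∈ X.inner ∧ v ∈ X.inner then 2
  else if (u ∈ X.inner ∧ v ∈ X.outer) ∨ (v ∈ X.inner ∧ u ∈ X.outer) then 1 else 0

theorem sum_splitLoss (u v : V) (α : ℕ) (X : Biset V) :
    ∑ x ∈ X.inner, (splitLoss u v α (some x) none + ∑ y ∈ X.outerᶜ,
      splitLoss u v α (some x) (some y)) =
      α * ((if u ∈ X.inner then 1 else 0) + if v ∈ X.inner then 1 else 0) := by
  have h1 : ∀ x : V, splitLoss u v α (some x) none =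
      (if x = u then α else 0) + if x = v then α else 0 := by
    intro x; simp [splitLoss]
  have h2 : ∀ x y : V, splitLoss u v α (some x) (some y) = 0 := by
    intro x y; simp [splitLoss]
  simp only [h1, h2, Finset.sum_const_zero, add_zero, Finset.sum_add_distrib, Finset.sum_ite_eq']
  split_ifs <;> ring

theorem sum_splitGain (u v : V) (α : ℕ) (X : Biset V) :
    ∑ x ∈ X.inner, (splitGain u v α (some x) none + ∑ y ∈ X.outerᶜ,
      splitGain u v α (some x) (some y)) =
      α * (if u ≠ v then (if u ∈ X.inner ∧ v ∉ X.outer then 1 else 0) +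
        if v ∈ X.inner ∧ u ∉ X.outer then 1 else 0 else 0) := by
  have h1 : ∀ x : V, splitGain u v α (some x) none = 0 := by
    intro x; simp [splitGain]
  by_cases huv : u = v
  · simp [splitGain, huv]
  have h2 : ∀ x y : V, splitGain u v α (some x) (some y) =
      (if x = u then if y = v then α else 0 else 0) +
        if x = v then if y = u then α else 0 else 0 := by
    intro x y
    simp only [splitGain, Sym2.eq_iff, Option.some.injEq]
    by_cases hxu : x = u
    · subst hxu; simp [huv]
    · by_cases hxv : x = v
      · subst hxv; simp [huv, Ne.symm huv]
      · simp [hxu, hxv]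
  simp only [h1, h2, zero_add, Finset.sum_add_distrib, Finset.sum_ite_irrel, Finset.sum_ite_eq',
    Finset.sum_const_zero, Finset.mem_compl, if_pos (show u ≠ v from huv)]
  split_ifs <;> (simp_all; try ring)

/-- Each of `u`, `v` in the inner set costs the biset `α`, but the new edge `uv` gives `α` back if
it runs from the inner set to the complement of the outer set. What remains is `α` times the loss.
-/
theorem CapGraph.bisetValue_split {H : CapGraph (Option V)} {u v : V} {α : ℕ}
    (h : H.SplitDefined u v α) (k : ℕ) (X : Biset V) :
    (H.split u v α).bisetValue k X + α * X.loss u v = H.bisetValue k X := by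
  -- Stated with sums on both sides to avoid truncated subtraction.
  have h1 : ∀ x y, (H.split u v α).cap x y + splitLoss u v α x y =
      H.cap x y + splitGain u v α x y := by
    intro x y
    have := h x y
    simp only [CapGraph.split]
    omega
  have h2 : (H.split u v α).bisetValue k X + α * ((if u ∈ X.inner then 1 else 0) +
      if v ∈ X.inner then 1 else 0) = H.bisetValue k X +
      α * (if u ≠ v then (if u ∈ X.inner ∧ v ∉ X.outer then 1 else 0) +
        if v ∈ X.inner ∧ u ∉ X.outer then 1 else 0 else 0) := by
    rw [← sum_splitLoss, ← sum_splitGain]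
    unfold CapGraph.bisetValue
    rw [add_assoc, add_assoc, ← Finset.sum_add_distrib, ← Finset.sum_add_distrib]
    congr 1
    refine Finset.sum_congr rfl fun x _ => ?_
    rw [add_add_add_comm, h1, ← Finset.sum_add_distrib, add_add_add_comm,
      ← Finset.sum_add_distrib, Finset.sum_congr rfl fun y _ => h1 (some x) (some y)]
  have hu := @X.inner_subset u
  have hv := @X.inner_subset v
  unfold Biset.loss
  by_cases huv : u = v
  · subst huv
    by_cases c1 : u ∈ X.inner
    · simp [c1] at h2 ⊢; omega
    · simp [c1] at h2 ⊢; omega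
  · by_cases c1 : u ∈ X.inner <;> by_cases c2 : v ∈ X.inner <;>
      by_cases c3 : u ∈ X.outer <;> by_cases c4 : v ∈ X.outer <;>
      simp [huv, c1, c2, c3, c4] at h2 hu hv ⊢ <;> omega

/-- By how much a biset of value `h` obliges to reduce the multiplicity of a splitting off. -/
def Biset.defect (X : Biset V) (k : ℤ) (u v : V) (h : ℤ) : ℤ :=
  if u ∈ X.wall ∨ v ∈ X.wall then k + k - h else (k + k - h + 1) / 2

/-- A greatest defect at the greatest well-defined multiplicity determines the maximal
splitting off. -/
theorem CapGraph.isMaxSplit_of_defect {H : CapGraph (Option V)} {k : ℕ} {u v : V} {α₀ : ℕ}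
    (hH : H.TwoConnectedIn k) (hα : ∀ β, H.SplitDefined u v β ↔ β ≤ α₀) {b : ℤ} (hb : 0 ≤ b)
    (hle : ∀ X : Biset V, X.Nontrivial → X.wall.card ≤ 1 →
      X.defect k u v ((H.split u v α₀).bisetValue k X) ≤ b) {P : Biset V → Prop}
    (hex : b = 0 ∨ ∃ X : Biset V, X.Nontrivial ∧ X.wall.card ≤ 1 ∧
      X.defect k u v ((H.split u v α₀).bisetValue k X) = b ∧ P X) :
    ∃ α : ℕ, (α : ℤ) = α₀ - b ∧ H.IsMaxSplit k u v α ∧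
      ((H.split u v α).cap none (some u) ≠ 0 → (H.split u v α).cap none (some v) ≠ 0 →
        (u = v → 2 ≤ (H.split u v α).cap none (some u)) →
        ∃ X : Biset V, (H.split u v α).Blocks k X u v ∧ P X) := by
  have hval : ∀ β ≤ α₀, ∀ X : Biset V, (((H.split u v β).bisetValue k X : ℕ) : ℤ) =
      (H.split u v α₀).bisetValue k X + ((α₀ : ℤ) - β) * X.loss u v := by
    intro β hβ X
    have h1 := bisetValue_split ((hα β).2 hβ) k X
    have h2 := bisetValue_split ((hα α₀).2 le_rfl) k X
    zify at h1 h2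
    linarith
  have hval0 : ∀ X : Biset V, X.Nontrivial →
      (2 * k : ℤ) ≤ (H.split u v α₀).bisetValue k X + (α₀ : ℤ) * X.loss u v := by
    intro X hX
    have h1 := hH.2 X hX
    have h2 := bisetValue_split ((hα α₀).2 le_rfl) k X
    zify at h1 h2
    linarith
  -- A positive loss determines the case of the defect: loss 2 means that the wall avoids `u` and
  -- `v`, loss 1 that it meets them. Loss 2 is why half of the missing value, rounded up, suffices
  -- in the first case.
  have hloss : ∀ X : Biset V, (X.loss u v = 2 ∧ u ∈ X.inner ∧ v ∈ X.inner ∧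
        ¬ (u ∈ X.wall ∨ v ∈ X.wall)) ∨
      (X.loss u v = 1 ∧ u ∈ X.outer ∧ v ∈ X.outer ∧ (u ∈ X.inner ∨ v ∈ X.inner) ∧
        (u ∈ X.wall ∨ v ∈ X.wall)) ∨ X.loss u v = 0 := by
    intro X
    have hu := @X.inner_subset u
    have hv := @X.inner_subset v
    unfold Biset.loss Biset.wall
    simp only [Finset.mem_sdiff]
    split_ifs with c1 c2
    · left; tauto
    · right; left; tauto
    · right; right; rfl
  -- Taking back all of `α₀` restores `H`, in which nothing is missing; so no defect exceeds `α₀`.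
  have hbα : b ≤ α₀ := by
    rcases hex with rfl | ⟨X, hX, -, h1, -⟩
    · positivity
    · have h2 := hval0 X hX
      unfold Biset.defect at h1
      rcases hloss X with ⟨h3, -, -, h4⟩ | ⟨h3, -, -, -, h4⟩ | h3
      · rw [if_neg h4] at h1; rw [h3] at h2; push_cast at h2; omega
      · rw [if_pos h4] at h1; rw [h3] at h2; push_cast at h2; omega
      · rw [h3] at h2; push_cast at h2
        split_ifs at h1 <;> omega
  obtain ⟨α, hαb⟩ : ∃ α : ℕ, (α : ℤ) = α₀ - b := ⟨((α₀ : ℤ) - b).toNat, by omega⟩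
  have hαα : α ≤ α₀ := by omega
  have heq : (α₀ : ℤ) - α = b := by omega
  refine ⟨α, hαb, ⟨⟨(hα α).2 hαα, hH.1, ?_⟩, ?_⟩, ?_⟩
  · intro X hX
    zify
    rcases le_or_gt X.wall.card 1 with hc | hc
    · have h1 := hle X hX hc
      have h2 := hval0 X hX
      rw [hval α hαα X, heq]
      unfold Biset.defect at h1
      rcases hloss X with ⟨h3, -, -, h4⟩ | ⟨h3, -, -, -, h4⟩ | h3
      · rw [if_neg h4] at h1; rw [h3]; push_cast; omega
      · rw [if_pos h4] at h1; rw [h3]; push_cast; omega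
      · rw [h3] at h2 ⊢; push_cast at h2 ⊢; omega
    -- Two wall vertices already contribute `2 * k`.
    · unfold CapGraph.bisetValue
      push_cast
      have : (k : ℤ) * 2 ≤ k * X.wall.card :=
        mul_le_mul_of_nonneg_left (by omega) (by positivity)
      have h0 : (0 : ℤ) ≤ ∑ x ∈ X.inner, (((H.split u v α).cap (some x) none : ℤ) +
          ∑ y ∈ X.outerᶜ, ((H.split u v α).cap (some x) (some y) : ℤ)) := by positivity
      linarith
  · rintro β ⟨h1, h2⟩
    have hβ := (hα β).1 h1
    -- With a greater multiplicity, a biset attaining `b > 0` would keep a value below `2 * k`; for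
    -- `b = 0` well-definedness already sets the limit.
    by_contra hlt
    rcases hex with rfl | ⟨X, hX, -, h3, -⟩
    · omega
    · have h4 := h2.2 X hX
      have h5 := hval0 X hX
      zify at h4
      rw [hval β hβ X] at h4
      unfold Biset.defect at h3
      rcases hloss X with ⟨h6, -, -, h7⟩ | ⟨h6, -, -, -, h7⟩ | h6
      · rw [if_neg h7] at h3; rw [h6] at h4; push_cast at h4; omega
      · rw [if_pos h7] at h3; rw [h6] at h4; push_cast at h4; omega
      · rw [h6] at h5; push_cast at h5
        split_ifs at h3 <;> omega
  · intro hu hv huv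
    rcases eq_or_ne b 0 with rfl | hb0
    -- If nothing is taken back, `α₀` is limited by well-definedness alone, and the assumptions on
    -- the remaining capacities would permit one more unit.
    · exfalso
      have hα' : α = α₀ := by omega
      subst hα'
      have h1 := (hα (α + 1)).not.2 (by omega)
      have h2 := (hα α).2 le_rfl
      rw [splitDefined_iff] at h1
      have e1 : splitLoss u v α none (some u) = if u = v then 2 * α else α := by
        by_cases c : u = v
        · simp [splitLoss, c, two_mul]
        · simp [splitLoss, c]
      have e2 : splitLoss u v α none (some v) = if u = v then 2 * α else α := by
        by_cases c : u = v
        · simp [splitLoss, c, two_mul]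
        · simp [splitLoss, c, Ne.symm c]
      have e3 : ∀ y, splitGain u v α none y = 0 := by intro y; simp [splitGain]
      simp only [CapGraph.split, e1, e2, e3, add_zero] at hu hv huv
      apply h1
      by_cases c : u = v
      · subst c
        simp at hu huv
        omega
      · rw [if_neg c] at hu hv
        exact ⟨by omega, by omega, fun h => absurd h c⟩
    -- A biset whose defect is exactly `b > 0` ends with the value `2 * k` for loss 1, and with `2 *
    -- k` or `2 * k + 1` for loss 2, owing to the rounding. These are the two ways to block.
    · obtain ⟨X, hX, -, h3, hP⟩ := hex.resolve_left hb0
      refine ⟨X, ⟨hX, ?_⟩, hP⟩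
      have h5 := hval0 X hX
      have h4 := hval α hαα X
      rw [heq] at h4
      unfold Biset.defect at h3
      rcases hloss X with ⟨h6, h7, h8, h9⟩ | ⟨h6, h7, h8, h10, h9⟩ | h6
      · rw [if_neg h9] at h3; rw [h6] at h4; push_cast at h4
        exact Or.inl ⟨by omega, h7, h8⟩
      · rw [if_pos h9] at h3; rw [h6] at h4; push_cast at h4
        exact Or.inr ⟨by omega, h7, h8, h10⟩
      · rw [h6] at h5 h4; push_cast at h5 h4
        split_ifs at h3 <;> omega

end

/-! ### Bisets and cuts of the numbered graph -/

/-- The numbered graph has the capacities of `G`. -/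
structure CutData.Represents (D : CutData) {n : ℕ} (G : CapGraph (Option (Fin n))) (k : ℕ)
    (u v : Fin n) : Prop where
  n_eq : D.n = n
  k_eq : D.k = k
  u_eq : D.u = (u : ℕ)
  v_eq : D.v = (v : ℕ)
  cap_eq : ∀ x y, classWeight id D.src D.dst D.cc D.M (vertexCode x) (vertexCode y) = G.cap x y

/-- The numbers of a set of vertices. -/
def vertexCodes {n : ℕ} (S : Finset (Fin n)) : Finset ℤ := S.image fun x : Fin n => ((x : ℕ) : ℤ)

theorem mem_vertexCodes {n : ℕ} {S : Finset (Fin n)} {x : Fin n} :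
    ((x : ℕ) : ℤ) ∈ vertexCodes S ↔ x ∈ S := by
  simp only [vertexCodes, Finset.mem_image, Nat.cast_inj]
  exact ⟨fun ⟨y, hy, e⟩ => Fin.ext e ▸ hy, fun h => ⟨x, h, rfl⟩⟩

theorem sum_vertexCodes {n : ℕ} (S : Finset (Fin n)) (f : ℤ → ℤ) :
    ∑ i ∈ vertexCodes S, f i = ∑ x ∈ S, f (x : ℕ) :=
  Finset.sum_image fun _ _ _ _ e => Fin.ext (Nat.cast_injective (R := ℤ) e)

theorem exists_fin_cast {n : ℕ} {i : ℤ} (h : 0 ≤ i) (h' : i < n) :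
    ∃ x : Fin n, ((x : ℕ) : ℤ) = i :=
  ⟨⟨i.toNat, by omega⟩, by simp [h]⟩

/-- The side of the cut opposite to the inner set consists of `s` and the complement of the outer
set; the wall is the removed vertex. -/
theorem CutData.Represents.cutDefect_eq {D : CutData} {n : ℕ} {G : CapGraph (Option (Fin n))}
    {k : ℕ} {u v : Fin n} (h : D.Represents G k u v) {w : ℤ} (hw : w < n) {B : Biset (Fin n)}
    (hB : ∀ x : Fin n, x ∈ B.wall ↔ ((x : ℕ) : ℤ) = w) :
    D.cutDefect w (vertexCodes B.inner) = B.defect k u v (G.bisetValue k B) := by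
  have hset : (Finset.Icc 0 D.n).erase w \ vertexCodes B.inner =
      insert (n : ℤ) (vertexCodes B.outerᶜ) := by
    ext i
    rw [h.n_eq]
    simp only [Finset.mem_sdiff, Finset.mem_erase, Finset.mem_Icc, Finset.mem_insert]
    by_cases hi : 0 ≤ i ∧ i < n
    · obtain ⟨x, rfl⟩ := exists_fin_cast hi.1 hi.2
      have h1 := hB x
      have h2 := @B.inner_subset x
      simp only [Biset.wall, Finset.mem_sdiff] at h1
      rw [mem_vertexCodes, mem_vertexCodes, Finset.mem_compl]
      have h3 : ((x : ℕ) : ℤ) ≠ n := by omega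
      have h4 : ((x : ℕ) : ℤ) ≤ n := by omega
      simp only [h3, h4, hi.1, Ne, ← h1]
      tauto
    · have h1 : ∀ S : Finset (Fin n), i ∉ vertexCodes S := by
        intro S hS
        obtain ⟨x, -, rfl⟩ := Finset.mem_image.1 hS
        omega
      simp only [h1]
      constructor
      · rintro ⟨⟨-, h2, h3⟩, -⟩; left; omega
      · rintro (rfl | h2)
        · exact ⟨⟨by omega, by omega, le_rfl⟩, not_false⟩
        · exact absurd h2 not_false
  have hn : (n : ℤ) ∉ vertexCodes B.outerᶜ := by
    intro hS
    obtain ⟨x, -, e⟩ := Finset.mem_image.1 hS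
    omega
  have hcut : cutValue (classWeight id D.src D.dst D.cc D.M) D.n w (vertexCodes B.inner) =
      ∑ x ∈ B.inner, ((G.cap (some x) none : ℤ) + ∑ y ∈ B.outerᶜ, (G.cap (some x) (some y) : ℤ)) := by
    unfold cutValue
    rw [hset, sum_vertexCodes]
    refine Finset.sum_congr rfl fun x _ => ?_
    rw [Finset.sum_insert hn, sum_vertexCodes]
    congr 1
    · exact h.cap_eq (some x) none
    · exact Finset.sum_congr rfl fun y _ => h.cap_eq (some x) (some y)
  unfold CutData.cutDefect
  rw [hcut]
  unfold CapGraph.bisetValue Biset.defect defect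
  push_cast
  have e : (u ∈ B.wall ∨ v ∈ B.wall) ↔ (w = D.u ∨ w = D.v) := by
    rw [hB, hB, h.u_eq, h.v_eq, eq_comm, eq_comm (b := w)]
  simp only [e, h.k_eq]
  generalize (∑ x ∈ B.inner, ((G.cap (some x) none : ℤ) +
    ∑ y ∈ B.outerᶜ, (G.cap (some x) (some y) : ℤ))) = c
  by_cases hw0 : w < 0
  · have : B.wall = ∅ := by
      ext x; rw [hB]; simp; omega
    rw [if_pos hw0, if_neg (by rw [h.u_eq, h.v_eq]; omega), this]
    simp
  · obtain ⟨x, rfl⟩ := exists_fin_cast (not_lt.1 hw0) hw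
    have : B.wall = {x} := by
      ext y; rw [hB, Finset.mem_singleton, Nat.cast_inj, Fin.ext_iff]
    rw [if_neg hw0, this, Finset.card_singleton]
    push_cast
    split_ifs
    · ring
    · congr 1; ring

/-- From the search among the cuts of the numbered graph to bisets. -/
theorem CutData.SearchInv.isMaxSplit {D : CutData} {n : ℕ} {H : CapGraph (Option (Fin n))}
    {k : ℕ} {u v : Fin n} {α₀ : ℕ} {σ : Store} (hs : D.SearchInv n σ)
    (h : D.Represents (H.split u v α₀) k u v) (hH : H.TwoConnectedIn k)
    (hα : ∀ β, H.SplitDefined u v β ↔ β ≤ α₀) :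
    ∃ α : ℕ, (α : ℤ) = α₀ - σ.var 14 ∧ H.IsMaxSplit k u v α ∧
      ((H.split u v α).cap none (some u) ≠ 0 → (H.split u v α).cap none (some v) ≠ 0 →
        (u = v → 2 ≤ (H.split u v α).cap none (some u)) →
        ∃ X : Biset (Fin n), (H.split u v α).Blocks k X u v ∧ σ.OutputsBiset X) := by
  refine CapGraph.isMaxSplit_of_defect hH hα hs.best_nonneg ?_ ?_
  · intro X hX hc
    -- A wall with at most one vertex is encoded by the number of that vertex, an empty one by `-1`.
    obtain ⟨w, hw1, hwn, hw⟩ : ∃ w : ℤ, -1 ≤ w ∧ w < n ∧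
        ∀ x : Fin n, x ∈ X.wall ↔ ((x : ℕ) : ℤ) = w := by
      rcases X.wall.eq_empty_or_nonempty with e | ⟨x, hx⟩
      · refine ⟨-1, le_rfl, by omega, fun x => ?_⟩
        rw [e]; simp
      · refine ⟨(x : ℕ), by omega, by omega, fun y => ?_⟩
        rw [Nat.cast_inj, ← Fin.ext_iff]
        exact ⟨fun hy => Finset.card_le_one.1 hc y hy x hx, fun e => e ▸ hx⟩
    rw [← h.cutDefect_eq hwn hw]
    refine hs.done w hw1 hwn _ ((Finset.nonempty_iff_ne_empty.2 hX.1).image _) ?_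
    rw [h.n_eq, Finset.ssubset_iff_of_subset]
    · obtain ⟨x, hx⟩ : ∃ x, x ∉ X.outer := by
        by_contra! hcon
        exact hX.2 (Finset.eq_univ_iff_forall.2 hcon)
      refine ⟨((x : ℕ) : ℤ), mem_others.2 ⟨fun e => ?_, by omega, by omega⟩, ?_⟩
      · exact hx (Finset.mem_sdiff.1 ((hw x).2 e)).1
      · rw [mem_vertexCodes]; exact fun hx' => hx (X.inner_subset hx')
    · intro i hi
      obtain ⟨x, hx, rfl⟩ := Finset.mem_image.1 hi
      exact mem_others.2 ⟨fun e => (Finset.mem_sdiff.1 ((hw x).2 e)).2 hx, by omega, by omega⟩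
  · rcases hs.best with hb | ⟨w, X, hw1, hwn, hne, hX, hdef, harr⟩
    · exact Or.inl hb
    · right
      rw [h.n_eq] at hwn hX harr
      have hXo : ∀ i ∈ X, i ≠ w ∧ 0 ≤ i ∧ i < n := fun i hi => mem_others.1 (hX.1 hi)
      -- Conversely, the recorded cut becomes a biset by adding `w` to the outer set; for `w = -1`
      -- this adds nothing.
      set B : Biset (Fin n) := ⟨Finset.univ.filter fun x => ((x : ℕ) : ℤ) ∈ X ∨ ((x : ℕ) : ℤ) = w,
        Finset.univ.filter fun x => ((x : ℕ) : ℤ) ∈ X, fun x hx => by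
          rw [Finset.mem_filter] at hx ⊢; exact ⟨hx.1, Or.inl hx.2⟩⟩ with hB
      have hwall : ∀ x : Fin n, x ∈ B.wall ↔ ((x : ℕ) : ℤ) = w := by
        intro x
        simp only [Biset.wall, hB, Finset.mem_sdiff, Finset.mem_filter, Finset.mem_univ, true_and]
        constructor
        · rintro ⟨h1, h2⟩; exact h1.resolve_left h2
        · exact fun e => ⟨Or.inr e, fun hx => (hXo _ hx).1 e⟩
      have hin : vertexCodes B.inner = X := by
        ext i
        constructor
        · intro hi
          obtain ⟨x, hx, rfl⟩ := Finset.mem_image.1 hi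
          exact (Finset.mem_filter.1 hx).2
        · intro hi
          obtain ⟨x, rfl⟩ := exists_fin_cast (hXo i hi).2.1 (hXo i hi).2.2
          rw [mem_vertexCodes]
          exact Finset.mem_filter.2 ⟨Finset.mem_univ _, hi⟩
      refine ⟨B, ⟨?_, ?_⟩, ?_, ?_, ?_⟩
      · intro e
        rw [e] at hin
        rw [← hin] at hne
        simp [vertexCodes] at hne
      · intro e
        obtain ⟨j, hj, hjX⟩ := Finset.exists_of_ssubset hX
        rw [mem_others] at hj
        obtain ⟨x, rfl⟩ := exists_fin_cast hj.2.1 hj.2.2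
        have hx : x ∈ B.outer := e ▸ Finset.mem_univ x
        rcases (Finset.mem_filter.1 hx).2 with h1 | h1
        · exact hjX h1
        · exact hj.1 h1
      · refine Finset.card_le_one.2 fun x hx y hy => ?_
        rw [hwall] at hx hy
        exact Fin.ext (by omega)
      · rw [← h.cutDefect_eq hwn hwall, hin, hdef]
      · intro x
        obtain ⟨h6, h7⟩ := harr (x : ℕ) (by omega) (by omega)
        rw [h6, h7]
        simp [hB]

/-! ### The edge table -/

section

variable {n : ℕ}

/-- The edge table of `H` in arrays `0`, `1`, `2`. -/
structure EdgeTable (H : CapGraph (Option (Fin n))) (L : List (Option (Fin n) × Option (Fin n)))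
    (σ : Store) : Prop where
  len_eq : σ.var 1 = L.length
  entry : ∀ (j : ℕ) (hj : j < L.length), σ.arr 0 j = vertexCode (L[j]).1 ∧
    σ.arr 1 j = vertexCode (L[j]).2 ∧ σ.arr 2 j = H.cap (L[j]).1 (L[j]).2

/-- The list consists of different pairs, among them all edges and `uv`. -/
structure CoversEdges (H : CapGraph (Option (Fin n))) (u v : Fin n)
    (L : List (Option (Fin n) × Option (Fin n))) : Prop where
  nodup : (L.map fun e => s(e.1, e.2)).Nodup
  ne : ∀ e ∈ L, e.1 ≠ e.2
  mem_of_cap : ∀ x y, H.cap x y ≠ 0 → s(x, y) ∈ L.map fun e => s(e.1, e.2)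
  mem_pair : u ≠ v → s(some u, some v) ∈ L.map fun e => s(e.1, e.2)

theorem vertexCode_inj {x y : Option (Fin n)} : vertexCode x = vertexCode y ↔ x = y := by
  rcases x with _ | x <;> rcases y with _ | y <;> simp [vertexCode, Fin.ext_iff] <;> omega

theorem vertexCode_nonneg (x : Option (Fin n)) : 0 ≤ vertexCode x := by
  rcases x with _ | x <;> simp [vertexCode]

theorem vertexCode_le (x : Option (Fin n)) : vertexCode x ≤ n := by
  rcases x with _ | x
  · simp [vertexCode]
  · have := x.2; simp only [vertexCode]; omega

theorem mem_map_take_succ {L : List (Option (Fin n) × Option (Fin n))} {j : ℕ}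
    (hj : j < L.length) (p : Sym2 (Option (Fin n))) :
    p ∈ (L.take (j + 1)).map (fun e => s(e.1, e.2)) ↔
      p ∈ (L.take j).map (fun e => s(e.1, e.2)) ∨ p = s((L[j]).1, (L[j]).2) := by
  rw [List.take_add_one, List.getElem?_eq_getElem hj]
  simp only [Option.toList_some, List.map_append, List.mem_append, List.map_cons, List.map_nil,
    List.mem_singleton]

/-- The registers hold the number of vertices and the vertices `u` and `v`. -/
structure HoldsPair (u v : Fin n) (σ : Store) : Prop where
  n_eq : σ.var 0 = vertexCode (none : Option (Fin n))
  u_eq : σ.var 3 = vertexCode (some u)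
  v_eq : σ.var 4 = vertexCode (some v)

end

/-! ### Recognising `su`, `sv` and `uv` in the edge table -/

/-- `if the edge in register 29 is su then p; if it is sv then q; if it is uv then r`. -/
def edgeCase (p q r : Program) : Program :=
  .ite (.eq (.get 0 (.var 29)) (.var 0))
    (.seq (.ite (.eq (.get 1 (.var 29)) (.var 3)) p .skip)
      (.ite (.eq (.get 1 (.var 29)) (.var 4)) q .skip))
    (.ite (.eq (.get 1 (.var 29)) (.var 0))
      (.seq (.ite (.eq (.get 0 (.var 29)) (.var 3)) p .skip)
        (.ite (.eq (.get 0 (.var 29)) (.var 4)) q .skip))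
      (.ite (.eq (.get 0 (.var 29)) (.var 3))
        (.ite (.eq (.get 1 (.var 29)) (.var 4)) r .skip)
        (.ite (.eq (.get 0 (.var 29)) (.var 4))
          (.ite (.eq (.get 1 (.var 29)) (.var 3)) r .skip) .skip)))

-- The first two actions are run in sequence, not as alternatives, because both apply if `u = v`.
-- The second test reads registers `4` and `29` after the first action, which therefore must not
-- write to them.
open Classical in
theorem run_edgeCase {n : ℕ} {u v : Fin n} {x y : Option (Fin n)} {σ : Store}
    {a : ℕ} {e : Expr} {q r : Program} (hp : HoldsPair u v σ) (hxy : x ≠ y)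
    (ha : a ≠ 4 ∧ a ≠ 29)
    (hx : σ.arr 0 (σ.var 29) = vertexCode x) (hy : σ.arr 1 (σ.var 29) = vertexCode y) :
    (edgeCase (.assign a e) q r).run σ =
      if s(x, y) = s(some u, some v) then r.run σ else
        if s(x, y) = s(none, some v) then
          q.run (if s(x, y) = s(none, some u) then σ.setVar a (e.eval σ) else σ)
        else if s(x, y) = s(none, some u) then σ.setVar a (e.eval σ) else σ := by
  obtain ⟨h0, h3, h4⟩ := hp
  obtain ⟨a4, a29⟩ := ha
  unfold edgeCase
  simp only [Program.run, Test.holds_eq, Expr.eval, h0, h3, h4, hx, hy, vertexCode_inj]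
  rcases x with _ | x <;> rcases y with _ | y
  · exact absurd rfl hxy
  · by_cases c : y = u
    · simp [c, Ne.symm a4, Ne.symm a29, h4, hy, vertexCode_inj]
    · simp [c, hy, h4, vertexCode_inj]
  · by_cases c : x = u
    · simp [c, Ne.symm a4, Ne.symm a29, h4, hx, vertexCode_inj]
    · simp [c, hx, h4, vertexCode_inj]
  · have hne : x ≠ y := fun h => hxy (congrArg some h)
    by_cases c1 : x = u <;> by_cases c2 : x = v <;> by_cases c3 : y = u <;>
      by_cases c4 : y = v <;> simp_all

/-- Register `28` receives the capacity of the edge in register `29` after the splitting off of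
multiplicity given by register `11`. -/
def splitCap : Program :=
  .seq (.assign 28 (.get 2 (.var 29)))
    (edgeCase (.assign 28 (.sub (.var 28) (.var 11))) (.assign 28 (.sub (.var 28) (.var 11)))
      (.assign 28 (.add (.var 28) (.var 11))))

theorem run_splitCap {n : ℕ} {H : CapGraph (Option (Fin n))} {u v : Fin n} {α : ℕ}
    {x y : Option (Fin n)} {σ : Store} (hp : HoldsPair u v σ) (hα : H.SplitDefined u v α)
    (h11 : σ.var 11 = α) (hxy : x ≠ y) (hx : σ.arr 0 (σ.var 29) = vertexCode x)
    (hy : σ.arr 1 (σ.var 29) = vertexCode y) (hc : σ.arr 2 (σ.var 29) = H.cap x y) :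
    (splitCap.run σ).var 28 = (H.split u v α).cap x y := by
  have h := hα x y
  unfold splitCap
  rw [Program.run, run_edgeCase ⟨by simpa [Program.run] using hp.n_eq,
    by simpa [Program.run] using hp.u_eq, by simpa [Program.run] using hp.v_eq⟩ hxy (by decide)
    (by simpa [Program.run] using hx) (by simpa [Program.run] using hy)]
  unfold CapGraph.split
  simp only
  zify [h]
  unfold splitLoss splitGain
  by_cases c1 : s(x, y) = s(some u, some v)
  · have huv : u ≠ v := by
      rintro rfl
      apply hxy
      rcases Sym2.eq_iff.1 c1 with ⟨rfl, rfl⟩ | ⟨rfl, rfl⟩ <;> rfl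
    have c2 : s(x, y) ≠ s(none, some u) := by rw [c1]; simp
    have c3 : s(x, y) ≠ s(none, some v) := by rw [c1]; simp
    simp [c1, huv, Program.run, Expr.eval, hc, h11]
  · by_cases c2 : s(x, y) = s(none, some u) <;> by_cases c3 : s(x, y) = s(none, some v) <;>
      simp [c1, c2, c3, Program.run, Expr.eval, hc, h11] <;>
      split_ifs <;> simp [h11] <;> try ring

/-! ### Preparation of the search -/

/-- Registers `30`, `31` receive the capacities of `su` and `sv`; register `32` becomes `1` if `uv`
is in the edge table. -/
def scanEdges : Program := .block [
  .assign 29 (.const 0),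
  .forUp 29 1 (edgeCase (.assign 30 (.get 2 (.var 29))) (.assign 31 (.get 2 (.var 29)))
    (.assign 32 (.const 1)))]

/-- Register `11` receives the greatest multiplicity of a well-defined splitting off. -/
def setMultiplicity : Program :=
  .ite (.eq (.var 3) (.var 4)) (.assign 11 (.half (.var 30)))
    (.ite (.le (.var 30) (.var 31)) (.assign 11 (.var 30)) (.assign 11 (.var 31)))

/-- Appends `uv` to the edge table if it is missing. -/
def appendPair : Program :=
  .ite (.eq (.var 3) (.var 4)) .skip
    (.ite (.eq (.var 32) (.const 1)) .skip
      (.seq (.store 0 (.var 1) (.var 3)) (.seq (.store 1 (.var 1) (.var 4))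
        (.seq (.store 2 (.var 1) (.const 0)) (.assign 1 (.add (.var 1) (.const 1)))))))

/-- Register `12` receives three times the number of binary digits of `n`. -/
def setLog : Program := .block [
  .assign 28 (.var 0),
  .assign 12 (.const 0),
  .loop (.lt (.const 0) (.var 28))
    (.seq (.assign 28 (.half (.var 28))) (.assign 12 (.add (.var 12) (.const 3))))]

/-- A half-edge from array `a` to array `b`. -/
def pushHalfEdge (a b : ℕ) : Program :=
  .seq (.store 10 (.var 10) (.get a (.var 29))) (.seq (.store 11 (.var 10) (.get b (.var 29)))
    (.seq (.store 12 (.var 10) (.var 28)) (.assign 10 (.add (.var 10) (.const 1)))))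

/-- Makes the half-edges of the graph after the splitting off. -/
def makeHalfEdges : Program := .block [
  .assign 29 (.const 0),
  .forUp 29 1 (.seq splitCap (.seq (pushHalfEdge 0 1) (pushHalfEdge 1 0)))]

theorem EdgeTable.congr {n : ℕ} {H : CapGraph (Option (Fin n))}
    {L : List (Option (Fin n) × Option (Fin n))} {σ τ : Store} (h : EdgeTable H L σ)
    (h1 : τ.var 1 = σ.var 1) (ha : ∀ a, a = 0 ∨ a = 1 ∨ a = 2 → τ.arr a = σ.arr a) :
    EdgeTable H L τ := by
  refine ⟨h1.trans h.len_eq, ?_⟩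
  rw [ha 0 (by simp), ha 1 (by simp), ha 2 (by simp)]
  exact h.entry

theorem HoldsPair.congr {n : ℕ} {u v : Fin n} {σ τ : Store} (h : HoldsPair u v σ)
    (hv : ∀ x, x = 0 ∨ x = 3 ∨ x = 4 → τ.var x = σ.var x) : HoldsPair u v τ :=
  ⟨(hv 0 (by simp)).trans h.n_eq, (hv 3 (by simp)).trans h.u_eq, (hv 4 (by simp)).trans h.v_eq⟩

theorem scanEdges_spec {n : ℕ} {H : CapGraph (Option (Fin n))} {u v : Fin n}
    {L : List (Option (Fin n) × Option (Fin n))} {σ : Store} (hL : EdgeTable H L σ)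
    (hp : HoldsPair u v σ) (hne : ∀ e ∈ L, e.1 ≠ e.2) (h32 : σ.var 32 = 0) :
    Wp scanEdges (fun τ d =>
      (s(none, some u) ∈ L.map (fun e => s(e.1, e.2)) → τ.var 30 = H.cap none (some u)) ∧
      (s(none, some v) ∈ L.map (fun e => s(e.1, e.2)) → τ.var 31 = H.cap none (some v)) ∧
      (s(some u, some v) ∈ L.map (fun e => s(e.1, e.2)) ↔ τ.var 32 = 1) ∧ 0 ≤ d) σ
      (200 * L.length + 20) := by
  apply Wp.seq
  apply Wp.flat rfl
  have hcost : ((edgeCase (.assign 30 (.get 2 (.var 29))) (.assign 31 (.get 2 (.var 29)))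
    (.assign 32 (.const 1))).flatCost : ℤ) ≤ 180 := by decide
  refine Wp.frame (Wp.forFlat 0 L.length (fun j τ =>
      (s(none, some u) ∈ (L.take j.toNat).map (fun e => s(e.1, e.2)) →
        τ.var 30 = H.cap none (some u)) ∧
      (s(none, some v) ∈ (L.take j.toNat).map (fun e => s(e.1, e.2)) →
        τ.var 31 = H.cap none (some v)) ∧
      (s(some u, some v) ∈ (L.take j.toNat).map (fun e => s(e.1, e.2)) ↔ τ.var 32 = 1))
      rfl rfl rfl rfl ?_ ?_ ?_ (by omega) ?_) ?_
  · rintro j τ hj0 hjN h29 - hU ⟨h1, h2, h3⟩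
    obtain ⟨i, rfl⟩ : ∃ i : ℕ, (i : ℤ) = j := ⟨j.toNat, by omega⟩
    have hi : i < L.length := by omega
    have hp' : HoldsPair u v τ := hp.congr (by
      rintro x (rfl | rfl | rfl) <;> exact (hU.1 _ rfl).trans (by simp [Program.run]))
    have hL' : EdgeTable H L τ := hL.congr ((hU.1 1 rfl).trans (by simp [Program.run])) (by
      rintro x (rfl | rfl | rfl) <;> exact (hU.2 _ rfl).trans (by simp [Program.run]))
    obtain ⟨e1, e2, e3⟩ := hL'.entry i hi
    have hxy := hne _ (List.getElem_mem hi)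
    have ej : ((i : ℤ) + 1).toNat = i + 1 := by omega
    rw [ej, Int.toNat_natCast] at *
    rw [mem_map_take_succ hi, mem_map_take_succ hi, mem_map_take_succ hi]
    have hcap : ∀ w, s((L[i]).1, (L[i]).2) = s(none, some w) →
        (H.cap (L[i]).1 (L[i]).2 : ℤ) = H.cap none (some w) := by
      intro w hw
      rcases Sym2.eq_iff.1 hw with ⟨a, b⟩ | ⟨a, b⟩
      · rw [a, b]
      · rw [a, b, H.symm]
    rw [run_edgeCase hp' hxy (by decide) (by rw [h29]; exact e1) (by rw [h29]; exact e2)]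
    generalize (L[i]).1 = x at *
    generalize (L[i]).2 = y at *
    have hu := hcap u
    have hv := hcap v
    have d1 : s(none, some u) ≠ s(some u, some v) := by simp
    have d2 : s(none, some v) ≠ s(some u, some v) := by simp
    -- From here on only equalities among the unordered pairs matter, so these are replaced by
    -- variables.
    clear hcap hU
    generalize s(x, y) = p at *
    generalize s(none, some u) = pu at *
    generalize s(none, some v) = pv at *
    generalize s(some u, some v) = q at *
    generalize (L.take i).map (fun e => s(e.1, e.2)) = l at *
    rw [← e3, ← h29] at hu hv
    simp only [Program.run, Expr.eval]
    by_cases c1 : p = q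
    · subst c1
      simpa [d1, d2] using ⟨h1, h2⟩
    · rw [if_neg c1]
      by_cases c2 : p = pu <;> by_cases c3 : p = pv
      · subst c2
        simpa [c3, Ne.symm d2, hu, ← hv c3] using h3
      · subst c2
        simpa [c3, Ne.symm c3, Ne.symm c1, hu] using ⟨h2, h3⟩
      · subst c3
        simpa [c2, Ne.symm c2, Ne.symm c1, hv] using ⟨h1, h3⟩
      · simpa [c2, Ne.symm c2, c3, Ne.symm c3, Ne.symm c1] using ⟨h1, h2, h3⟩
  · simp [Program.run, Expr.eval]
  · simpa [Program.run] using hL.len_eq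
  · simp [Program.run, h32]
  · rintro τ d ⟨⟨h1, h2, h3⟩, h4⟩ -
    simp only [Int.toNat_natCast, List.take_length] at h1 h2 h3
    refine ⟨h1, h2, h3, ?_⟩
    simp only [Expr.cost, Program.flatCost]
    push_cast
    nlinarith

theorem setLog_spec {n : ℕ} {σ : Store} (h0 : σ.var 0 = n) :
    Wp setLog (fun τ d => (∃ j : ℕ, τ.var 12 = 3 * j ∧ (n : ℤ) < 2 ^ j ∧ (j = 0 ∨ 2 ^ (j - 1) ≤ n)) ∧
      0 ≤ d) σ (30 * n + 30) := by
  apply Wp.seq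
  apply Wp.flat rfl
  apply Wp.seq
  apply Wp.flat rfl
  -- The number of halvings is logarithmic, but a charge proportional to the current quotient is
  -- easier to state and cheap enough for the final bound.
  refine Wp.loop (fun τ d => ∃ j : ℕ, τ.var 12 = 3 * j ∧ τ.var 28 = ((n / 2 ^ j : ℕ) : ℤ) ∧
    (j = 0 ∨ 2 ^ (j - 1) ≤ n) ∧ 20 * τ.var 28 + 5 ≤ d) ?_ ?_ ?_ ?_
  · rintro τ d ⟨j, -, h1, -, h2⟩
    have : 0 ≤ τ.var 28 := h1 ▸ Int.natCast_nonneg _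
    omega
  · rintro τ d - ⟨j, h1, h2, h3, h4⟩ hb
    simp only [Test.holds_lt, Expr.eval] at hb
    apply Wp.flat rfl
    refine ⟨j + 1, ?_, ?_, ?_, ?_⟩
    · simp [Program.run, Expr.eval, h1]; ring
    · simp only [Program.run, Expr.eval, h2, Store.setVar_var, if_true, Nat.reduceEqDiff, if_false]
      rw [pow_succ, ← Nat.div_div_eq_div_mul]
      push_cast
      rfl
    · right
      rw [Nat.add_sub_cancel]
      rw [h2] at hb
      by_contra hlt
      rw [Nat.div_eq_of_lt (not_le.1 hlt)] at hb
      simp at hb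
    · simp only [Program.run, Expr.eval, Store.setVar_var, if_true, Nat.reduceEqDiff, if_false,
        Program.flatCost, Test.cost, Expr.cost]
      push_cast
      omega
  · rintro τ d - ⟨j, h1, h2, h3, h4⟩ hb
    simp only [Test.holds_lt, Expr.eval] at hb
    have h28 : 0 ≤ τ.var 28 := h2 ▸ Int.natCast_nonneg _
    refine ⟨⟨j, h1, ?_, h3⟩, ?_⟩
    · have : n / 2 ^ j = 0 := by omega
      rw [Nat.div_eq_zero_iff] at this
      have h5 : n < 2 ^ j := this.resolve_left (by positivity)
      exact_mod_cast h5
    · simp only [Test.cost, Expr.cost]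
      push_cast
      omega
  · refine ⟨0, by simp [Program.run, Expr.eval], by simp [Program.run, Expr.eval, h0], Or.inl rfl, ?_⟩
    simp only [Program.run, Expr.eval, h0, Store.setVar_var, if_true, Nat.reduceEqDiff, if_false,
      Program.flatCost, Expr.cost]
    push_cast
    omega

theorem classWeight_succ (rep src dst cc : ℤ → ℤ) (M : ℕ) (a b : ℤ) :
    classWeight rep src dst cc (M + 1) a b = classWeight rep src dst cc M a b +
      if rep (src M) = a ∧ rep (dst M) = b then cc M else 0 :=
  Finset.sum_range_succ _ _

theorem classWeight_update {rep src dst cc : ℤ → ℤ} {M : ℕ} {i x y z : ℤ} (hi : (M : ℤ) ≤ i)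
    (a b : ℤ) :
    classWeight rep (Function.update src i x) (Function.update dst i y) (Function.update cc i z)
      M a b = classWeight rep src dst cc M a b := by
  refine Finset.sum_congr rfl fun h hh => ?_
  have : (h : ℤ) ≠ i := by have := Finset.mem_range.1 hh; omega
  simp only [Function.update_of_ne this]

/-- The half-edges made from the pairs in `L`. -/
structure HalfEdges {n : ℕ} (G : CapGraph (Option (Fin n)))
    (L : List (Option (Fin n) × Option (Fin n))) (src dst cc : ℤ → ℤ) : Prop where
  src_mem : ∀ h : ℕ, h < 2 * L.length → 0 ≤ src h ∧ src h ≤ n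
  dst_mem : ∀ h : ℕ, h < 2 * L.length → 0 ≤ dst h ∧ dst h ≤ n
  cap_nonneg : ∀ h, 0 ≤ cc h
  symm : ∀ a b, classWeight id src dst cc (2 * L.length) a b =
    classWeight id src dst cc (2 * L.length) b a
  mem : ∀ x y, s(x, y) ∈ L.map (fun e => s(e.1, e.2)) →
    classWeight id src dst cc (2 * L.length) (vertexCode x) (vertexCode y) = G.cap x y
  notMem : ∀ x y, s(x, y) ∉ L.map (fun e => s(e.1, e.2)) →
    classWeight id src dst cc (2 * L.length) (vertexCode x) (vertexCode y) = 0

/-- A new pair is entered in both orientations, which preserves symmetry. As it has not occurred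
before, no capacity is counted twice. -/
theorem HalfEdges.push {n : ℕ} {G : CapGraph (Option (Fin n))}
    {L : List (Option (Fin n) × Option (Fin n))} {src dst cc : ℤ → ℤ}
    (h : HalfEdges G L src dst cc) {x y : Option (Fin n)} (hxy : x ≠ y)
    (hL : s(x, y) ∉ L.map fun e => s(e.1, e.2)) {i i' : ℤ} (hi : i = 2 * L.length)
    (hi' : i' = 2 * L.length + 1) :
    HalfEdges G (L ++ [(x, y)])
      (Function.update (Function.update src i (vertexCode x)) i' (vertexCode y))
      (Function.update (Function.update dst i (vertexCode y)) i' (vertexCode x))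
      (Function.update (Function.update cc i (G.cap x y)) i' (G.cap x y)) := by
  have hlen : 2 * (L ++ [(x, y)]).length = 2 * L.length + 1 + 1 := by simp; ring
  have e1 : ((2 * L.length : ℕ) : ℤ) = i := by rw [hi]; push_cast; ring
  have e2 : ((2 * L.length + 1 : ℕ) : ℤ) = i' := by rw [hi']; push_cast; ring
  have hii : i ≠ i' := by omega
  have key : ∀ a b, classWeight id
      (Function.update (Function.update src i (vertexCode x)) i' (vertexCode y))
      (Function.update (Function.update dst i (vertexCode y)) i' (vertexCode x))
      (Function.update (Function.update cc i (G.cap x y)) i' (G.cap x y))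
      (2 * (L ++ [(x, y)]).length) a b = classWeight id src dst cc (2 * L.length) a b +
      ((if vertexCode x = a ∧ vertexCode y = b then (G.cap x y : ℤ) else 0) +
        if vertexCode y = a ∧ vertexCode x = b then (G.cap x y : ℤ) else 0) := by
    intro a b
    rw [hlen, classWeight_succ, classWeight_succ, e1, e2, classWeight_update (by omega),
      classWeight_update (by omega), add_assoc]
    simp [Function.update_of_ne hii]
  have hmem : ∀ p : Sym2 (Option (Fin n)), p ∈ (L ++ [(x, y)]).map (fun e => s(e.1, e.2)) ↔
      p ∈ L.map (fun e => s(e.1, e.2)) ∨ p = s(x, y) := by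
    intro p; rw [List.map_append, List.mem_append, List.map_singleton, List.mem_singleton]
  have hrange : ∀ (f : ℤ → ℤ) (a b : Option (Fin n)),
      (∀ h : ℕ, h < 2 * L.length → 0 ≤ f h ∧ f h ≤ n) → ∀ h : ℕ, h < 2 * (L ++ [(x, y)]).length →
      0 ≤ Function.update (Function.update f i (vertexCode a)) i' (vertexCode b) h ∧
        Function.update (Function.update f i (vertexCode a)) i' (vertexCode b) h ≤ n := by
    intro f a b hf h hh
    simp only [Function.update_apply]
    split_ifs
    · exact ⟨vertexCode_nonneg _, vertexCode_le _⟩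
    · exact ⟨vertexCode_nonneg _, vertexCode_le _⟩
    · exact hf h (by omega)
  refine ⟨hrange src x y h.src_mem, hrange dst y x h.dst_mem, ?_, ?_, ?_, ?_⟩
  · intro j
    simp only [Function.update_apply]
    have := h.cap_nonneg j
    split_ifs <;> positivity
  · intro a b
    rw [key, key, h.symm a b, add_comm (ite (vertexCode x = a ∧ _) _ _)]
    simp only [and_comm]
  · intro a b hab
    rw [key]
    simp only [vertexCode_inj]
    rcases (hmem _).1 hab with h1 | h1
    · rw [h.mem a b h1, if_neg, if_neg]
      · simp
      · rintro ⟨rfl, rfl⟩; exact hL (Sym2.eq_swap ▸ h1)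
      · rintro ⟨rfl, rfl⟩; exact hL h1
    · rw [h.notMem a b (h1 ▸ hL)]
      rcases Sym2.eq_iff.1 h1 with ⟨rfl, rfl⟩ | ⟨rfl, rfl⟩
      · simp [hxy, hxy.symm]
      · simp [hxy, hxy.symm, G.symm a b]
  · intro a b hab
    rw [hmem, not_or] at hab
    rw [key, h.notMem a b hab.1]
    simp only [vertexCode_inj]
    rw [if_neg, if_neg]
    · simp
    · rintro ⟨rfl, rfl⟩; exact hab.2 Sym2.eq_swap
    · rintro ⟨rfl, rfl⟩; exact hab.2 rfl

/-- Pairs whose capacity has become 0 are kept: they do not affect any class weight. -/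
theorem makeHalfEdges_spec {n : ℕ} {H : CapGraph (Option (Fin n))} {u v : Fin n} {α : ℕ}
    {L : List (Option (Fin n) × Option (Fin n))} {σ : Store} (hL : EdgeTable H L σ)
    (hp : HoldsPair u v σ) (hc : CoversEdges H u v L) (hα : H.SplitDefined u v α)
    (h11 : σ.var 11 = α) (h10 : σ.var 10 = 0) (h12 : ∀ h, σ.arr 12 h = 0) :
    Wp makeHalfEdges (fun τ d => τ.var 10 = 2 * L.length ∧
      HalfEdges (H.split u v α) L (τ.arr 10) (τ.arr 11) (τ.arr 12) ∧ 0 ≤ d) σ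
      (300 * L.length + 20) := by
  apply Wp.seq
  apply Wp.flat rfl
  have hcost : ((Program.seq splitCap (.seq (pushHalfEdge 0 1) (pushHalfEdge 1 0))).flatCost : ℤ)
    ≤ 280 := by decide
  refine Wp.frame (Wp.forFlat 0 L.length (fun j τ => τ.var 10 = 2 * j ∧
      HalfEdges (H.split u v α) (L.take j.toNat) (τ.arr 10) (τ.arr 11) (τ.arr 12))
      rfl rfl rfl rfl ?_ ?_ ?_ (by omega) ?_) ?_
  · rintro j τ hj0 hjN h29 - hU ⟨h1, h2⟩
    obtain ⟨i, rfl⟩ : ∃ i : ℕ, (i : ℤ) = j := ⟨j.toNat, by omega⟩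
    have hi : i < L.length := by omega
    have hp' : HoldsPair u v τ := hp.congr (by
      rintro x (rfl | rfl | rfl) <;> exact (hU.1 _ rfl).trans (by simp [Program.run]))
    have hL' : EdgeTable H L τ := hL.congr ((hU.1 1 rfl).trans (by simp [Program.run])) (by
      rintro x (rfl | rfl | rfl) <;> exact (hU.2 _ rfl).trans (by simp [Program.run]))
    obtain ⟨e1, e2, e3⟩ := hL'.entry i hi
    have hxy := hc.ne _ (List.getElem_mem hi)
    have ej : ((i : ℤ) + 1).toNat = i + 1 := by omega
    rw [ej, Int.toNat_natCast] at *
    have h11' : τ.var 11 = α := (hU.1 11 rfl).trans (by simpa [Program.run] using h11)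
    have h28 := run_splitCap hp' hα h11' hxy (by rw [h29]; exact e1) (by rw [h29]; exact e2)
      (by rw [h29]; exact e3)
    have hU' := run_unchanged splitCap rfl τ
    rw [Program.run]
    set ρ := splitCap.run τ with hρ
    have hnot : s((L[i]).1, (L[i]).2) ∉ (L.take i).map fun e => s(e.1, e.2) := by
      intro hmem
      have := hc.nodup
      rw [← List.take_append_drop i L, List.map_append, List.drop_eq_getElem_cons hi] at this
      exact (List.nodup_append.1 this).2.2 _ hmem _ (List.mem_map.2 ⟨_, List.mem_cons_self, rfl⟩) rfl
    have hlen : (L.take i).length = i := by rw [List.length_take]; omega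
    have h3 := h2.push hxy hnot (i := 2 * i) (i' := 2 * i + 1) (by rw [hlen]) (by rw [hlen])
    have etake : L.take (i + 1) = L.take i ++ [((L[i]).1, (L[i]).2)] := by
      rw [List.take_add_one, List.getElem?_eq_getElem hi]; rfl
    have r10 : ρ.var 10 = 2 * i := (hU'.1 10 rfl).trans h1
    have r29 : ρ.var 29 = i := (hU'.1 29 rfl).trans h29
    rw [etake]
    rw [← e1, ← e2, ← h28, ← hU'.2 0 rfl, ← hU'.2 1 rfl, ← hU'.2 10 rfl, ← hU'.2 11 rfl,
      ← hU'.2 12 rfl] at h3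
    refine ⟨?_, ?_⟩
    · simp [pushHalfEdge, Program.run, Expr.eval, r10]; ring
    · convert h3 using 1 <;> simp [pushHalfEdge, Program.run, Expr.eval, r10, r29]
  · simp [Program.run, Expr.eval]
  · simpa [Program.run] using hL.len_eq
  · refine ⟨by simpa [Program.run] using h10, ?_, ?_, ?_, ?_, ?_, ?_⟩ <;>
      simp [Program.run, h12, classWeight]
  · rintro τ d ⟨⟨h1, h2⟩, h4⟩ -
    simp only [Int.toNat_natCast, List.take_length] at h1 h2
    refine ⟨h1, h2, ?_⟩
    simp only [Expr.cost, Program.flatCost] at hcost ⊢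
    push_cast at hcost ⊢
    nlinarith

/-- Splitting off creates no edge other than `uv`, which the list contains by `mem_pair`. -/
theorem CoversEdges.split_cap_eq_zero {n : ℕ} {H : CapGraph (Option (Fin n))} {u v : Fin n}
    {L : List (Option (Fin n) × Option (Fin n))} (hc : CoversEdges H u v L) (α : ℕ)
    {x y : Option (Fin n)} (h : s(x, y) ∉ L.map fun e => s(e.1, e.2)) :
    (H.split u v α).cap x y = 0 := by
  have h1 : H.cap x y = 0 := by_contra fun h' => h (hc.mem_of_cap x y h')
  have h2 : splitGain u v α x y = 0 := by
    unfold splitGain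
    rw [if_neg]
    rintro ⟨huv, e⟩
    exact h (e ▸ hc.mem_pair huv)
  simp [CapGraph.split, h1, h2]

theorem setMultiplicity_spec {n : ℕ} {H : CapGraph (Option (Fin n))} {u v : Fin n} {σ : Store}
    (hp : HoldsPair u v σ) (h30 : σ.var 30 = H.cap none (some u))
    (h31 : σ.var 31 = H.cap none (some v)) :
    Wp setMultiplicity (fun τ d => (∃ α : ℕ, τ.var 11 = α ∧ ∀ β, H.SplitDefined u v β ↔ β ≤ α) ∧
      0 ≤ d) σ 30 := by
  apply Wp.flat rfl
  refine ⟨?_, by decide⟩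
  unfold setMultiplicity
  simp only [Program.run, Test.holds_eq, Test.holds_le, Expr.eval, hp.u_eq, hp.v_eq,
    vertexCode_inj, Option.some.injEq, h30, h31, CapGraph.splitDefined_iff]
  by_cases huv : u = v
  · subst huv
    -- For `u = v` each unit consumes two units of `su`; otherwise the limit is the smaller of the
    -- two capacities.
    refine ⟨H.cap none (some u) / 2, by simp, fun β => ?_⟩
    simp only [true_imp_iff]
    omega
  · simp only [huv, if_false, false_imp_iff, and_true]
    split_ifs with h
    · exact ⟨H.cap none (some u), by simp, fun β => by omega⟩
    · exact ⟨H.cap none (some v), by simp, fun β => by omega⟩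

theorem appendPair_spec {n : ℕ} {H : CapGraph (Option (Fin n))} {u v : Fin n}
    {L : List (Option (Fin n) × Option (Fin n))} {σ : Store} (hL : EdgeTable H L σ)
    (hp : HoldsPair u v σ) (hE : H.IsEdgeList L)
    (h32 : s(some u, some v) ∈ L.map (fun e => s(e.1, e.2)) ↔ σ.var 32 = 1) :
    Wp appendPair (fun τ d => (∃ L', EdgeTable H L' τ ∧ CoversEdges H u v L' ∧
      L'.length ≤ L.length + 1) ∧ 0 ≤ d) σ 60 := by
  have hne : ∀ e ∈ L, e.1 ≠ e.2 := by
    intro e he h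
    have := (hE.2 e.1 e.2).1 (List.mem_map.2 ⟨e, he, rfl⟩)
    exact this (h ▸ H.loopless e.1)
  apply Wp.flat rfl
  refine ⟨?_, by decide⟩
  unfold appendPair
  simp only [Program.run, Test.holds_eq, Expr.eval, hp.u_eq, hp.v_eq, vertexCode_inj,
    Option.some.injEq, ← h32]
  split_ifs with h1 h2
  · exact ⟨L, hL, ⟨hE.1, hne, fun x y => (hE.2 x y).2, fun h => absurd h1 h⟩, by omega⟩
  · exact ⟨L, hL, ⟨hE.1, hne, fun x y => (hE.2 x y).2, fun _ => h2⟩, by omega⟩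
  · have hcap : H.cap (some u) (some v) = 0 :=
      by_contra fun h => h2 ((hE.2 _ _).2 h)
    -- The edge `uv` may come into being by the splitting off, so a missing pair is entered with
    -- capacity 0.
    refine ⟨L ++ [(some u, some v)], ⟨?_, ?_⟩, ⟨?_, ?_, ?_, ?_⟩, by simp⟩
    · simp [hL.len_eq]
    · intro j hj
      rw [List.length_append, List.length_singleton] at hj
      rcases Nat.lt_or_ge j L.length with h | h
      · obtain ⟨e1, e2, e3⟩ := hL.entry j h
        have hne' : (j : ℤ) ≠ L.length := by omega
        simp [hL.len_eq, List.getElem_append_left h, hne', e1, e2, e3]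
      · have : j = L.length := by omega
        subst this
        simp [hL.len_eq, hp.v_eq, hcap]
    · rw [List.map_append, List.nodup_append]
      refine ⟨hE.1, by simp, ?_⟩
      rintro a ha b hb rfl
      simp only [List.map_cons, List.map_nil, List.mem_singleton] at hb
      exact h2 (hb ▸ ha)
    · intro e he
      rcases List.mem_append.1 he with h | h
      · exact hne e h
      · rw [List.mem_singleton] at h
        subst h
        simpa using h1
    · intro x y h
      rw [List.map_append]
      exact List.mem_append_left _ ((hE.2 x y).2 h)
    · intro _
      rw [List.map_append]
      exact List.mem_append_right _ (by simp)

/-- Everything before the search. -/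
def prepare : Program := .block [scanEdges, setMultiplicity, appendPair, setLog, makeHalfEdges]

/-- The edge table still describes `H`, possibly with an entry for `uv` of capacity 0, whereas the
half-edges in `D` describe the graph after splitting off `α₀`. The search uses the latter, the
output the former. -/
theorem prepare_spec {n k : ℕ} {H : CapGraph (Option (Fin n))}
    {L : List (Option (Fin n) × Option (Fin n))} {u v : Fin n} (hE : H.IsEdgeList L)
    (hu : H.cap none (some u) ≠ 0) (hv : H.cap none (some v) ≠ 0) :
    Wp prepare (fun τ d => ∃ (L' : List (Option (Fin n) × Option (Fin n))) (α₀ : ℕ) (D : CutData),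
      EdgeTable H L' τ ∧ CoversEdges H u v L' ∧ L'.length ≤ L.length + 1 ∧ HoldsPair u v τ ∧
      τ.var 11 = α₀ ∧ (∀ β, H.SplitDefined u v β ↔ β ≤ α₀) ∧
      D.Represents (H.split u v α₀) k u v ∧ D.SearchInv (-1) τ ∧ D.M = 2 * L'.length ∧
      (D.j = 0 ∨ 2 ^ (D.j - 1) ≤ n) ∧ 0 ≤ d) (inputStore H L k u v)
      (500 * L.length + 30 * n + 700) := by
  have hvar : ∀ x, 5 ≤ x → (inputStore H L k u v).var x = 0 := by
    intro x hx
    simp only [inputStore]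
    rw [List.getD_eq_default _ _ (by simpa using hx)]
  have harr : ∀ a, 3 ≤ a → ∀ i, (inputStore H L k u v).arr a i = 0 := by
    intro a ha i
    simp only [inputStore]
    rw [List.getD_eq_default _ _ (by simpa using ha)]
    simp [listArray]
  have hp : HoldsPair u v (inputStore H L k u v) := ⟨rfl, rfl, rfl⟩
  have hL : EdgeTable H L (inputStore H L k u v) := by
    refine ⟨rfl, fun j hj => ?_⟩
    simp [inputStore, listArray, hj]
  have hk : (inputStore H L k u v).var 2 = k := rfl
  generalize inputStore H L k u v = σ at *
  have hne : ∀ e ∈ L, e.1 ≠ e.2 := by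
    intro e he h
    have := (hE.2 e.1 e.2).1 (List.mem_map.2 ⟨e, he, rfl⟩)
    exact this (h ▸ H.loopless e.1)
  apply Wp.seq
  refine Wp.frame (scanEdges_spec hL hp hne (hvar 32 (by omega))) ?_
  rintro τ1 d1 ⟨h30, h31, h32, hd1⟩ hU1
  have hp1 : HoldsPair u v τ1 := hp.congr (by rintro x (rfl | rfl | rfl) <;> exact hU1.1 _ rfl)
  have hL1 : EdgeTable H L τ1 := hL.congr (hU1.1 _ rfl) (fun a _ => hU1.2 a rfl)
  apply Wp.seq
  refine Wp.frame (setMultiplicity_spec hp1 (h30 ((hE.2 _ _).2 hu)) (h31 ((hE.2 _ _).2 hv))) ?_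
  rintro τ2 d2 ⟨⟨α₀, h11, hα⟩, hd2⟩ hU2
  have hp2 : HoldsPair u v τ2 := hp1.congr (by rintro x (rfl | rfl | rfl) <;> exact hU2.1 _ rfl)
  have hL2 : EdgeTable H L τ2 := hL1.congr (hU2.1 _ rfl) (fun a _ => hU2.2 a rfl)
  apply Wp.seq
  refine Wp.frame (appendPair_spec hL2 hp2 hE (by rw [hU2.1 32 rfl]; exact h32)) ?_
  rintro τ3 d3 ⟨⟨L', hL3, hc, hlen⟩, hd3⟩ hU3
  have hp3 : HoldsPair u v τ3 := hp2.congr (by rintro x (rfl | rfl | rfl) <;> exact hU3.1 _ rfl)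
  apply Wp.seq
  refine Wp.frame (setLog_spec (n := n) hp3.n_eq) ?_
  rintro τ4 d4 ⟨⟨j, h12, hj1, hj2⟩, hd4⟩ hU4
  have hp4 : HoldsPair u v τ4 := hp3.congr (by rintro x (rfl | rfl | rfl) <;> exact hU4.1 _ rfl)
  have hL4 : EdgeTable H L' τ4 := hL3.congr (hU4.1 _ rfl) (fun a _ => hU4.2 a rfl)
  have hv4 : ∀ x, scanEdges.writesVar x = false → setMultiplicity.writesVar x = false →
      appendPair.writesVar x = false → setLog.writesVar x = false → τ4.var x = σ.var x :=
    fun x e1 e2 e3 e4 => (((hU4.1 x e4).trans (hU3.1 x e3)).trans (hU2.1 x e2)).trans (hU1.1 x e1)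
  have ha4 : ∀ x, appendPair.writesArr x = false → τ4.arr x = σ.arr x :=
    fun x e3 => (((hU4.2 x rfl).trans (hU3.2 x e3)).trans (hU2.2 x rfl)).trans (hU1.2 x rfl)
  have h11' : τ4.var 11 = α₀ := ((hU4.1 11 rfl).trans (hU3.1 11 rfl)).trans h11
  refine Wp.frame (makeHalfEdges_spec hL4 hp4 hc ((hα α₀).2 le_rfl) h11'
    ((hv4 10 rfl rfl rfl rfl).trans (hvar 10 (by omega)))
    (fun h => by rw [ha4 12 rfl]; exact harr 12 (by omega) h)) ?_
  rintro τ d ⟨h10, hH, hd⟩ hU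
  have hp5 : HoldsPair u v τ := hp4.congr (by rintro x (rfl | rfl | rfl) <;> exact hU.1 _ rfl)
  have hL5 : EdgeTable H L' τ := hL4.congr (hU.1 _ rfl)
    (by rintro a (rfl | rfl | rfl) <;> exact hU.2 _ rfl)
  have h14 : τ.var 14 = 0 :=
    (hU.1 14 rfl).trans ((hv4 14 rfl rfl rfl rfl).trans (hvar 14 (by omega)))
  refine ⟨L', α₀, {
    n := n, k := k, u := (u : ℕ), v := (v : ℕ), M := 2 * L'.length, j := j
    src := τ.arr 10, dst := τ.arr 11, cc := τ.arr 12
    n_nonneg := by positivity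
    lt_pow := hj1
    src_mem := hH.src_mem
    dst_mem := hH.dst_mem
    cap_nonneg := hH.cap_nonneg
    symm := hH.symm }, hL5, hc, hlen, hp5, (hU.1 11 rfl).trans h11', hα,
    ⟨rfl, rfl, rfl, rfl, ?_⟩, ⟨?_, ?_, ?_, h14.ge, Or.inl h14, ?_⟩, rfl, hj2, ?_⟩
  · intro x y
    by_cases h : s(x, y) ∈ L'.map fun e => s(e.1, e.2)
    · exact hH.mem x y h
    · rw [hc.split_cap_eq_zero α₀ h]; exact hH.notMem x y h
  · refine ⟨hp5.n_eq, ?_, hp5.u_eq, hp5.v_eq, by simpa using h10, ?_, rfl, rfl, rfl⟩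
    · exact (hU.1 2 rfl).trans ((hv4 2 rfl rfl rfl rfl).trans hk)
    · exact (hU.1 12 rfl).trans h12
  · intro y
    rw [hU.2 14 rfl, ha4 14 rfl, harr 14 (by omega)]
    simp
  · intro y
    rw [hU.2 23 rfl, ha4 23 rfl, harr 23 (by omega)]
  · intro w h1 h2; omega
  · omega

/-! ### Output of the resulting graph -/

/-- Writes the graph after the splitting off whose multiplicity is the difference of registers `11`
and `14`. -/
def emitBody : Program :=
  .seq splitCap (.ite (.lt (.const 0) (.var 28))
    (.seq (.store 3 (.var 5) (.get 0 (.var 29))) (.seq (.store 4 (.var 5) (.get 1 (.var 29)))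
      (.seq (.store 5 (.var 5) (.var 28)) (.assign 5 (.add (.var 5) (.const 1))))))
    .skip)

def emit : Program := .block [
  .assign 5 (.const 0),
  .assign 11 (.sub (.var 11) (.var 14)),
  .assign 29 (.const 0),
  .forUp 29 1 emitBody]

theorem emit_spec {n : ℕ} {H : CapGraph (Option (Fin n))} {u v : Fin n} {α : ℕ}
    {L : List (Option (Fin n) × Option (Fin n))} {σ : Store} (hL : EdgeTable H L σ)
    (hp : HoldsPair u v σ) (hc : CoversEdges H u v L) (hα : H.SplitDefined u v α)
    (h11 : σ.var 11 - σ.var 14 = α) :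
    Wp emit (fun τ d => τ.OutputsGraph (H.split u v α) ∧ 0 ≤ d) σ (300 * L.length + 30) := by
  iterate 3
    apply Wp.seq
    apply Wp.flat rfl
  have hcost : (emitBody.flatCost : ℤ) ≤ 280 := by decide
  set G := H.split u v α with hG
  -- The output is the edge table without the pairs whose capacity is now 0, in the same order.
  refine Wp.frame (Wp.forFlat 0 L.length (fun j τ => ∃ l, l = (L.take j.toNat).filter
      (fun e => G.cap e.1 e.2 ≠ 0) ∧ τ.var 5 = l.length ∧ ∀ (j : ℕ) (hj : j < l.length),
      τ.arr 3 j = vertexCode (l[j]).1 ∧ τ.arr 4 j = vertexCode (l[j]).2 ∧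
        τ.arr 5 j = G.cap (l[j]).1 (l[j]).2)
      rfl rfl rfl rfl ?_ ?_ ?_ (by omega) ?_) ?_
  · rintro j τ hj0 hjN h29 - hU ⟨l, hl, h1, h2⟩
    obtain ⟨i, rfl⟩ : ∃ i : ℕ, (i : ℤ) = j := ⟨j.toNat, by omega⟩
    have hi : i < L.length := by omega
    have hp' : HoldsPair u v τ := hp.congr (by
      rintro x (rfl | rfl | rfl) <;> exact (hU.1 _ rfl).trans (by simp [Program.run]))
    have hL' : EdgeTable H L τ := hL.congr ((hU.1 1 rfl).trans (by simp [Program.run])) (by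
      rintro x (rfl | rfl | rfl) <;> exact (hU.2 _ rfl).trans (by simp [Program.run]))
    obtain ⟨e1, e2, e3⟩ := hL'.entry i hi
    have ej : ((i : ℤ) + 1).toNat = i + 1 := by omega
    rw [ej]
    rw [Int.toNat_natCast] at hl
    have h11' : τ.var 11 = α :=
      (hU.1 11 rfl).trans (by simpa [Program.run, Expr.eval] using h11)
    have h28 := run_splitCap hp' hα h11' (hc.ne _ (List.getElem_mem hi)) (by rw [h29]; exact e1)
      (by rw [h29]; exact e2) (by rw [h29]; exact e3)
    have hU' := run_unchanged splitCap rfl τ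
    rw [← hG] at h28
    unfold emitBody
    rw [Program.run]
    set ρ := splitCap.run τ with hρ
    have r29 : ρ.var 29 = i := (hU'.1 29 rfl).trans h29
    have r5 : ρ.var 5 = l.length := (hU'.1 5 rfl).trans h1
    have e1' : ρ.arr 0 i = _ := (congrFun (hU'.2 0 rfl) _).trans e1
    have e2' : ρ.arr 1 i = _ := (congrFun (hU'.2 1 rfl) _).trans e2
    have etake : (L.take (i + 1)).filter (fun e => G.cap e.1 e.2 ≠ 0) =
        l ++ if G.cap (L[i]).1 (L[i]).2 ≠ 0 then [L[i]] else [] := by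
      rw [List.take_add_one, List.getElem?_eq_getElem hi, List.filter_append, ← hl]
      congr 1
      simp [List.filter_cons]
    rw [etake]
    have hpos : (Test.lt (Expr.const 0) (Expr.var 28)).holds ρ ↔ G.cap (L[i]).1 (L[i]).2 ≠ 0 := by
      simp only [Test.holds_lt, Expr.eval, h28]; omega
    rw [Program.run]
    by_cases hcase : G.cap (L[i]).1 (L[i]).2 ≠ 0
    · rw [if_pos hcase, if_pos (hpos.2 hcase)]
      refine ⟨_, rfl, by simp [Program.run, Expr.eval, r5], ?_⟩
      intro a ha
      rw [List.length_append, List.length_singleton] at ha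
      rcases Nat.lt_or_ge a l.length with h | h
      · obtain ⟨f1, f2, f3⟩ := h2 a h
        have hne' : (a : ℤ) ≠ l.length := by omega
        simp [Program.run, Expr.eval, r5, List.getElem_append_left h, hne', hU'.2 3 rfl,
          hU'.2 4 rfl, hU'.2 5 rfl, f1, f2, f3]
      · have : a = l.length := by omega
        subst this
        simp [Program.run, Expr.eval, r5, r29, e1', e2', h28]
    · rw [if_neg hcase, if_neg (hpos.not.2 hcase), List.append_nil]
      refine ⟨l, rfl, by simp [Program.run, r5], ?_⟩
      intro a ha
      obtain ⟨f1, f2, f3⟩ := h2 a ha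
      simp [Program.run, hU'.2 3 rfl, hU'.2 4 rfl, hU'.2 5 rfl, f1, f2, f3]
  · simp [Program.run, Expr.eval]
  · simpa [Program.run] using hL.len_eq
  · exact ⟨[], by simp, by simp [Program.run, Expr.eval], fun j hj => by simp at hj⟩
  · rintro τ d ⟨⟨l, hl, h1, h2⟩, h4⟩ -
    rw [Int.toNat_natCast, List.take_length] at hl
    refine ⟨⟨l, ⟨?_, ?_⟩, h1, h2⟩, ?_⟩
    · rw [hl]
      exact hc.nodup.sublist (List.filter_sublist.map _)
    · intro x y
      have hcap : ∀ e : Option (Fin n) × Option (Fin n), s(e.1, e.2) = s(x, y) →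
          G.cap e.1 e.2 = G.cap x y := by
        intro e he
        rcases Sym2.eq_iff.1 he with ⟨a, b⟩ | ⟨a, b⟩
        · rw [a, b]
        · rw [a, b, G.symm]
      rw [hl, List.mem_map]
      change _ ↔ G.cap x y ≠ 0
      constructor
      · rintro ⟨e, he, h⟩
        rw [← hcap e h]
        simpa using (List.mem_filter.1 he).2
      · intro h
        have : s(x, y) ∈ L.map fun e => s(e.1, e.2) :=
          by_contra fun h' => h (hc.split_cap_eq_zero α h')
        obtain ⟨e, he, h'⟩ := List.mem_map.1 this
        exact ⟨e, List.mem_filter.2 ⟨he, by simpa [hcap e h'] using h⟩, h'⟩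
    · simp only [Expr.cost, Program.flatCost]
      push_cast
      nlinarith

/-! ### The time bound and the main theorem -/

theorem CapGraph.IsEdgeList.ncard_edgeSet {W : Type*} {G : CapGraph W} {L : List (W × W)}
    (h : G.IsEdgeList L) : G.graph.edgeSet.ncard = L.length := by
  classical
  have : G.graph.edgeSet = ((L.map fun e => s(e.1, e.2)).toFinset : Set (Sym2 W)) := by
    ext p
    induction p with
    | _ x y =>
      rw [SimpleGraph.mem_edgeSet, Finset.mem_coe, List.mem_toFinset]
      exact (h.2 x y).symm
  rw [this, Set.ncard_coe_finset, List.toFinset_card_of_nodup h.1, List.length_map]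

/-- From `2 ^ (j - 1) ≤ n` one gets `(j - 1) * log 2 ≤ log n`; as `1 ≤ log n` for `n ≥ 3`, the
summand 1 is absorbed too. -/
theorem digits_le_log {n j : ℕ} (hn : 3 ≤ n) (hj : j = 0 ∨ 2 ^ (j - 1) ≤ n) :
    (j : ℝ) ≤ 3 * Real.log n := by
  have h1 : 1 ≤ Real.log n := by
    rw [Real.le_log_iff_exp_le (by positivity)]
    have : (3 : ℝ) ≤ n := by exact_mod_cast hn
    linarith [Real.exp_one_lt_d9]
  rcases Nat.eq_zero_or_pos j with rfl | hpos
  · push_cast; linarith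
  · have h2 : (2 : ℝ) ^ (j - 1) ≤ n := by exact_mod_cast hj.resolve_left hpos.ne'
    have h3 := Real.log_le_log (by positivity) h2
    rw [Real.log_pow, Nat.cast_sub hpos] at h3
    have h4 := Real.log_two_gt_d9
    have h5 : (1 : ℝ) ≤ j := by exact_mod_cast hpos
    push_cast at h3
    nlinarith

/-- The arithmetic of the time bound. -/
theorem time_bound {n m j M ℓ t : ℝ} (hn : 3 ≤ n) (hm : 1 ≤ m) (hℓ : 1 ≤ ℓ) (hj : j ≤ 3 * ℓ)
    (hM : M ≤ 4 * m)
    (ht : t ≤ (500 * m + 30 * n + 700) +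
      (((1060 * M + (2200 * j + 700) * n + 630) * n + 80) * (n + 1) + 10) +
      (300 * (m + 1) + 30)) : t ≤ 30000 * (n ^ 2 * (m + n * ℓ)) := by
  have hnℓ : n ≤ n * ℓ := by nlinarith
  set q := m + n * ℓ with hq
  have hq4 : 4 ≤ q := by linarith
  have hmq : m ≤ q := by linarith
  have hjn : j * n ≤ 3 * q := by nlinarith
  have h1 : 1060 * M + (2200 * j + 700) * n + 630 ≤ 12000 * q := by nlinarith
  have h2 : (1060 * M + (2200 * j + 700) * n + 630) * n + 80 ≤ 12100 * (q * n) := by nlinarith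
  have h3 : ((1060 * M + (2200 * j + 700) * n + 630) * n + 80) * (n + 1) ≤
      12100 * (q * n) * (n + 1) := by nlinarith
  have h4 : n + 1 ≤ 4 / 3 * n := by linarith
  have hqn : 0 ≤ q * n := by positivity
  have h5 : 12100 * (q * n) * (n + 1) ≤ 16200 * (n ^ 2 * q) := by nlinarith
  have h6 : 9 * q ≤ n ^ 2 * q := by nlinarith
  linarith

/-- The program that computes a maximal splitting off. -/
def maxSplitProgram : Program := .block [prepare, search, emit]

theorem mainTheorem7 :
    ∃ (p : Program) (C : ℝ),
      ∀ (n k : ℕ) (H : CapGraph (Option (Fin n)))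
        (L : List (Option (Fin n) × Option (Fin n))) (u v : Fin n),
        1 ≤ k → H.TwoConnectedIn k → H.IsEdgeList L →
        some u ∈ H.graph.neighborSet none → some v ∈ H.graph.neighborSet none →
        ∃ (α : ℕ) (τ : Store) (t : ℕ),
          H.IsMaxSplit k u v α ∧
          Exec p (inputStore H L k u v) τ t ∧
          (t : ℝ) ≤ C * ((n : ℝ) ^ 2 *
            ((H.graph.edgeSet.ncard : ℝ) + (n : ℝ) * Real.log (n : ℝ))) ∧
          τ.OutputsGraph (H.split u v α) ∧
          ((H.split u v α).cap none (some u) ≠ 0 →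
            (H.split u v α).cap none (some v) ≠ 0 →
            (u = v → 2 ≤ (H.split u v α).cap none (some u)) →
            ∃ X : Biset (Fin n), (H.split u v α).Blocks k X u v ∧ τ.OutputsBiset X) := by
  refine ⟨maxSplitProgram, 30000, ?_⟩
  intro n k H L u v _ hH hE hu hv
  obtain ⟨τ1, t1, d1, hx1, ht1, L', α₀, D, hL1, hc, hlen, hp1, h11, hα, hD, hs, hM, hj, hd1⟩ :=
    prepare_spec (k := k) hE hu hv
  obtain ⟨τ2, t2, d2, hx2, ht2, hs2, hd2⟩ := CutData.search_spec hs
  have hU2 : Unchanged search τ1 τ2 := ⟨hx2.var_eq, hx2.arr_eq⟩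
  rw [hD.n_eq] at hs2 ht2
  obtain ⟨α, hαb, hmax, hblock⟩ := hs2.isMaxSplit hD hH hα
  have hp2 : HoldsPair u v τ2 := hp1.congr (by rintro x (rfl | rfl | rfl) <;> exact hU2.1 _ rfl)
  have hL2 : EdgeTable H L' τ2 := hL1.congr (hU2.1 _ rfl)
    (by rintro a (rfl | rfl | rfl) <;> exact hU2.2 _ rfl)
  obtain ⟨τ3, t3, d3, hx3, ht3, hout, hd3⟩ := emit_spec hL2 hp2 hc hmax.1.1
    -- The search leaves `α₀` in register `11` and `b` in register `14`, so `emit` recomputes the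
    -- capacities from `H` with the difference.
    (by rw [hU2.1 11 rfl, h11, hαb])
  refine ⟨α, τ3, t1 + (t2 + t3), hmax, .seq hx1 (.seq hx2 hx3), ?_, hout, ?_⟩
  · rw [hE.ncard_edgeSet]
    have hn : 3 ≤ n := by simpa using hH.1
    -- The edge `su` exists. Hence the at most `2 * (m + 1)` half-edges are at most `4 * m`.
    have hm : 1 ≤ L.length := by
      have := (hE.2 none (some u)).2 hu
      obtain ⟨e, he, -⟩ := List.mem_map.1 this
      exact List.length_pos_of_mem he
    have hℓ : 1 ≤ Real.log n := by
      rw [Real.le_log_iff_exp_le (by positivity)]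
      have : (3 : ℝ) ≤ n := by exact_mod_cast hn
      linarith [Real.exp_one_lt_d9]
    have h1 : (t1 : ℤ) ≤ 500 * L.length + 30 * n + 700 := by omega
    have h2 : (t2 : ℤ) ≤ ((1060 * D.M + (2200 * D.j + 700) * n + 630) * n + 80) * (n + 1) + 10 := by
      omega
    have h3 : (t3 : ℤ) ≤ 300 * (L.length + 1) + 30 := by omega
    have h1' : (t1 : ℝ) ≤ 500 * L.length + 30 * n + 700 := by exact_mod_cast h1
    have h2' : (t2 : ℝ) ≤
        ((1060 * D.M + (2200 * D.j + 700) * n + 630) * n + 80) * (n + 1) + 10 := by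
      exact_mod_cast h2
    have h3' : (t3 : ℝ) ≤ 300 * (L.length + 1) + 30 := by exact_mod_cast h3
    have hM' : (D.M : ℝ) ≤ 4 * L.length := by
      have : D.M ≤ 4 * L.length := by omega
      exact_mod_cast this
    refine time_bound (by exact_mod_cast hn) (by exact_mod_cast hm) hℓ (digits_le_log hn hj) hM' ?_
    push_cast
    linarith
  · intro g1 g2 g3
    obtain ⟨X, hX, hO⟩ := hblock g1 g2 g3
    refine ⟨X, hX, fun x => ?_⟩
    -- The biset recorded by the search is still there, since `emit` does not write to arrays `6`
    -- and `7`.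
    rw [hx3.arr_eq 6 rfl, hx3.arr_eq 7 rfl]
    exact hO x
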